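/- Let $\mathbb F$ be any field. For $k\in\mathbb N$ let \[T_k=\sum_{S,T,U\in\binom{[3k]}{k},\ S\cup T\cup U=[3k]}X_SY_TZ_U,\] a trilinear form over $\mathbb F$ of dimension $N=\binom{3k}{k}$. The rank $\mathbf R(T)$ of a trilinear form $T$ is the least $r$ such that $T$ is a linear combination of $r$ forms $(\sum_i a_iX_i)(\sum_j b_jY_j)(\sum_l c_lZ_l)$, and its asymptotic rank is $\mathrm{AR}(T)=\lim_{r\to\infty}\mathbf R(T^{\otimes r})^{1/r}$, where $T^{\otimes r}$ is the $r$-fold Kronecker power. In the problem $s$-Set Cover one is given $t\in\mathbb N$ and a family $\mathcal F\subseteq 2^{[n]}$ of sets of size at most $s$, and has to decide whether some at most $t$ sets of $\mathcal F$ have union $[n]$. The set cover conjecture says: for every $\varepsilon>0$ there is an $s\in\mathbb N$ such that no randomized algorithm (with success probability at least $2/3$ on every input, on a random access machine with logarithmic cost) solves $s$-Set Cover in time $O(2^{(1-\varepsilon)n})$, where the bound on the time leaves room for reading the binary digits of $t$, i.e. it is $O(2^{(1-\varepsilon)n}+\log (t+1))$. If the set cover conjecture holds, then: (1) for every $0<\varepsilon\le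 8$ and all sufficiently large $k$, $\mathrm{AR}(T_k)>(8-\varepsilon)^k$; (2) for all sufficiently large $k$, the tensor $T_k$ of dimension $N=\binom{3k}{k}$ satisfies $\mathrm{AR}(T_k)>N^{1.08}$. -/

import Mathlib

open Filter Topology

/-! ### Tensors, tensor rank, asymptotic rank -/

/-- A tensor (trilinear form in three disjoint sets of variables `X_i`, `Y_j`, `Z_k` indexed by
`ι`), given by its coefficients. Its dimension is the cardinality of `ι`. -/
abbrev Tensor (F : Type*) (ι : Type*) := ι → ι → ι → F

/-- `T` is a sum of `r` rank-one tensors `(∑ a_i X_i) (∑ b_j Y_j) (∑ c_k Z_k)`. (The scalars of a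
linear combination are absorbed in the first factor.) -/
def IsSumOfRankOne {F ι : Type*} [Field F] (T : Tensor F ι) (r : ℕ) : Prop :=
  ∃ a b c : Fin r → ι → F, ∀ i j k, T i j k = ∑ l, a l i * b l j * c l k

/-- The tensor rank: the least number of rank-one tensors that sum to `T`. -/
noncomputable def tensorRank {F ι : Type*} [Field F] (T : Tensor F ι) : ℕ :=
  sInf {r : ℕ | IsSumOfRankOne T r}

/-- The `r`-fold Kronecker product of `T` with itself: its variables are indexed by `r`-tuples of
indices, and its coefficients are the products of coefficients of `T`. -/
def kroneckerPow {F ι : Type*} [Field F] (T : Tensor F ι) (r : ℕ) : Tensor F (Fin r → ι) :=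
  fun x y z => ∏ m, T (x m) (y m) (z m)

/-- The asymptotic rank `lim_{r → ∞} R(T^{⊗ r})^{1/r}`; the limit exists by
`tendsto_asymptoticRank` below. -/
noncomputable def asymptoticRank {F ι : Type*} [Field F] (T : Tensor F ι) : ℝ :=
  limUnder atTop (fun r : ℕ => (tensorRank (kroneckerPow T r) : ℝ) ^ ((1 : ℝ) / (r : ℝ)))

/-- The tensor `T_k = ∑ X_S Y_T Z_U` over all `k`-element subsets `S, T, U` of a `3k`-element set
whose union is the whole set. Its dimension is `(3k).choose k`. -/
def tripartitionTensor (F : Type*) [Field F] (k : ℕ) :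
    Tensor F {S : Finset (Fin (3 * k)) // S.card = k} :=
  fun S T U => if S.1 ∪ T.1 ∪ U.1 = Finset.univ then 1 else 0

theorem IsSumOfRankOne.of_fintype {F ι κ : Type*} [Field F] [Fintype κ] {T : Tensor F ι}
    (a b c : κ → ι → F) (h : ∀ i j k, T i j k = ∑ l, a l i * b l j * c l k) :
    IsSumOfRankOne T (Fintype.card κ) := by
  let e := (Fintype.equivFin κ).symm
  refine ⟨fun l => a (e l), fun l => b (e l), fun l => c (e l), fun i j k => ?_⟩
  rw [h, ← e.sum_comp]

theorem isSumOfRankOne_tensorRank {F ι : Type*} [Field F] [Fintype ι] (T : Tensor F ι) :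
    IsSumOfRankOne T (tensorRank T) := by
  classical
  refine Nat.sInf_mem (s := {r : ℕ | IsSumOfRankOne T r})
    ⟨Fintype.card (ι × ι × ι), IsSumOfRankOne.of_fintype
      (fun l i => if l.1 = i then T l.1 l.2.1 l.2.2 else 0)
      (fun l j => if l.2.1 = j then 1 else 0) (fun l k => if l.2.2 = k then 1 else 0) ?_⟩
  intro i j k
  simp [Fintype.sum_prod_type]

theorem tensorRank_kroneckerPow_add {F ι : Type*} [Field F] [Fintype ι] (T : Tensor F ι)
    (m n : ℕ) : tensorRank (kroneckerPow T (m + n)) ≤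
      tensorRank (kroneckerPow T m) * tensorRank (kroneckerPow T n) := by
  classical
  obtain ⟨a, b, c, h⟩ := isSumOfRankOne_tensorRank (kroneckerPow T m)
  obtain ⟨a', b', c', h'⟩ := isSumOfRankOne_tensorRank (kroneckerPow T n)
  have key : IsSumOfRankOne (kroneckerPow T (m + n))
      (Fintype.card (Fin (tensorRank (kroneckerPow T m)) ×
        Fin (tensorRank (kroneckerPow T n)))) := by
    refine IsSumOfRankOne.of_fintype
      (fun l x => a l.1 (fun i => x (Fin.castAdd n i)) * a' l.2 (fun i => x (Fin.natAdd m i)))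
      (fun l x => b l.1 (fun i => x (Fin.castAdd n i)) * b' l.2 (fun i => x (Fin.natAdd m i)))
      (fun l x => c l.1 (fun i => x (Fin.castAdd n i)) * c' l.2 (fun i => x (Fin.natAdd m i)))
      ?_
    intro x y z
    have e : kroneckerPow T (m + n) x y z =
        kroneckerPow T m (fun i => x (Fin.castAdd n i)) (fun i => y (Fin.castAdd n i))
          (fun i => z (Fin.castAdd n i)) *
        kroneckerPow T n (fun i => x (Fin.natAdd m i)) (fun i => y (Fin.natAdd m i))
          (fun i => z (Fin.natAdd m i)) := by
      simp [kroneckerPow, Fin.prod_univ_add]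
    rw [e, h, h', Finset.sum_mul_sum, Fintype.sum_prod_type]
    refine Finset.sum_congr rfl fun p _ => Finset.sum_congr rfl fun q _ => ?_
    ring
  refine (Nat.sInf_le key).trans ?_
  simp

theorem tensorRank_zero {F ι : Type*} [Field F] (T : Tensor F ι) (h : ∀ i j k, T i j k = 0) :
    tensorRank T = 0 := by
  refine Nat.le_zero.1 (Nat.sInf_le ?_)
  exact ⟨0, 0, 0, fun i j k => by simp [h]⟩

theorem eq_zero_of_tensorRank {F ι : Type*} [Field F] [Fintype ι] (T : Tensor F ι)
    (h : tensorRank T = 0) (i j k : ι) : T i j k = 0 := by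
  have h1 := isSumOfRankOne_tensorRank T
  rw [h] at h1
  obtain ⟨a, b, c, h2⟩ := h1
  simpa using h2 i j k

/-- The limit that defines the asymptotic rank exists, for every tensor of finite dimension. -/
theorem tendsto_asymptoticRank {F ι : Type*} [Field F] [Fintype ι] (T : Tensor F ι) :
    Tendsto (fun r : ℕ => (tensorRank (kroneckerPow T r) : ℝ) ^ ((1 : ℝ) / (r : ℝ))) atTop
      (𝓝 (asymptoticRank T)) := by
  refine tendsto_nhds_limUnder ?_
  by_cases h0 : ∃ r, tensorRank (kroneckerPow T r) = 0
  · obtain ⟨r, hr⟩ := h0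
    have hT : ∀ i j k, T i j k = 0 := by
      intro i j k
      have := eq_zero_of_tensorRank _ hr (fun _ => i) (fun _ => j) (fun _ => k)
      simp only [kroneckerPow, Finset.prod_const] at this
      exact eq_zero_of_pow_eq_zero this
    refine ⟨0, tendsto_const_nhds.congr' ?_⟩
    filter_upwards [eventually_ge_atTop 1] with n hn
    have hz : tensorRank (kroneckerPow T n) = 0 := by
      refine tensorRank_zero _ fun x y z => ?_
      exact Finset.prod_eq_zero (Finset.mem_univ (⟨0, hn⟩ : Fin n)) (hT _ _ _)
    have hn' : (1 : ℝ) / (n : ℝ) ≠ 0 := by positivity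
    rw [hz, Nat.cast_zero, Real.zero_rpow hn']
  · push Not at h0
    have hpos : ∀ r, (0 : ℝ) < tensorRank (kroneckerPow T r) := fun r => by
      exact_mod_cast Nat.pos_of_ne_zero (h0 r)
    have hsub : Subadditive (fun r => Real.log (tensorRank (kroneckerPow T r))) := by
      intro m n
      rw [← Real.log_mul (hpos m).ne' (hpos n).ne']
      refine Real.log_le_log (hpos _) ?_
      exact_mod_cast tensorRank_kroneckerPow_add T m n
    have hbdd : BddBelow (Set.range fun n : ℕ =>
        Real.log (tensorRank (kroneckerPow T n)) / (n : ℝ)) := by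
      refine ⟨0, ?_⟩
      rintro _ ⟨n, rfl⟩
      exact div_nonneg (Real.log_natCast_nonneg _) (Nat.cast_nonneg _)
    refine ⟨Real.exp hsub.lim, ?_⟩
    refine ((Real.continuous_exp.tendsto _).comp (hsub.tendsto_lim hbdd)).congr fun n => ?_
    rw [Real.rpow_def_of_pos (hpos n)]
    simp [div_eq_mul_inv]

/-! ### Randomized algorithms: a random access machine with coin tosses and logarithmic cost -/

/-- The contents of the cells of a random access machine, each a natural number. -/
abbrev RAM.Memory := ℕ → ℕ

/-- The arithmetic operations of the machine (`sub` truncates at `0`; `x / 0 = 0` and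
`x % 0 = x`). -/
inductive RAM.Op
  | add
  | sub
  | mul
  | div
  | mod

/-- The value of an operation. -/
def RAM.Op.eval : RAM.Op → ℕ → ℕ → ℕ
  | .add, x, y => x + y
  | .sub, x, y => x - y
  | .mul, x, y => x * y
  | .div, x, y => x / y
  | .mod, x, y => x % y

/-- The cost of an operation: linear in the bit lengths of the operands for addition and
subtraction, and the product of the bit lengths (schoolbook algorithms) for the others. -/
def RAM.Op.cost : RAM.Op → ℕ → ℕ → ℕ
  | .add, x, y | .sub, x, y => Nat.size x + Nat.size y + 1
  | .mul, x, y | .div, x, y | .mod, x, y => (Nat.size x + 1) * (Nat.size y + 1)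

/-- Expressions: constants, the content of the cell with a computed address (indirect addressing),
and arithmetic operations. -/
inductive RAM.Expr
  | const (c : ℕ)
  | load (a : RAM.Expr)
  | op (o : RAM.Op) (e₁ e₂ : RAM.Expr)

/-- The value of an expression. -/
def RAM.Expr.eval (M : RAM.Memory) : RAM.Expr → ℕ
  | .const c => c
  | .load a => M (a.eval M)
  | .op o e₁ e₂ => o.eval (e₁.eval M) (e₂.eval M)

/-- The logarithmic cost of evaluating an expression: every operation is charged for the bit
lengths of the addresses and the numbers that it handles. -/
def RAM.Expr.cost (M : RAM.Memory) : RAM.Expr → ℕ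
  | .const c => Nat.size c + 1
  | .load a => a.cost M + Nat.size (a.eval M) + Nat.size (M (a.eval M)) + 1
  | .op o e₁ e₂ => e₁.cost M + e₂.cost M + o.cost (e₁.eval M) (e₂.eval M)

/-- Programs. `store a e` writes the value of `e` to the cell with address `a`, `coin a` writes the
result of a fair coin toss to the cell with address `a`; tests ask whether a value is nonzero. -/
inductive RAM.Prog
  | skip
  | store (a e : RAM.Expr)
  | coin (a : RAM.Expr)
  | seq (p q : RAM.Prog)
  | ite (e : RAM.Expr) (p q : RAM.Prog)
  | loop (e : RAM.Expr) (p : RAM.Prog)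

/-- `RAM.Exec p M b M' b' t`: the program `p`, started with memory `M` and with `b` as the
results of the coming coin tosses, halts with memory `M'`, with `b'` as the unused rest of `b`,
and at total cost `t`. It does not hold for any `M' b' t` if `p` runs forever or makes more than
`b.length` coin tosses. -/
inductive RAM.Exec :
    RAM.Prog → RAM.Memory → List Bool → RAM.Memory → List Bool → ℕ → Prop
  | skip (M : RAM.Memory) (b : List Bool) : RAM.Exec .skip M b M b 1
  | store (a e : RAM.Expr) (M : RAM.Memory) (b : List Bool) :
      RAM.Exec (.store a e) M b (Function.update M (a.eval M) (e.eval M)) b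
        (a.cost M + e.cost M + Nat.size (a.eval M) + Nat.size (e.eval M) + 1)
  | coin (a : RAM.Expr) (M : RAM.Memory) (x : Bool) (b : List Bool) :
      RAM.Exec (.coin a) M (x :: b) (Function.update M (a.eval M) x.toNat) b
        (a.cost M + Nat.size (a.eval M) + 1)
  | seq {p q : RAM.Prog} {M M' M'' : RAM.Memory} {b b' b'' : List Bool} {t t' : ℕ}
      (hp : RAM.Exec p M b M' b' t) (hq : RAM.Exec q M' b' M'' b'' t') :
      RAM.Exec (.seq p q) M b M'' b'' (t + t' + 1)
  | ite_true {e : RAM.Expr} {p q : RAM.Prog} {M M' : RAM.Memory} {b b' : List Bool} {t : ℕ}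
      (he : e.eval M ≠ 0) (hp : RAM.Exec p M b M' b' t) :
      RAM.Exec (.ite e p q) M b M' b' (e.cost M + t + 1)
  | ite_false {e : RAM.Expr} {p q : RAM.Prog} {M M' : RAM.Memory} {b b' : List Bool} {t : ℕ}
      (he : e.eval M = 0) (hq : RAM.Exec q M b M' b' t) :
      RAM.Exec (.ite e p q) M b M' b' (e.cost M + t + 1)
  | loop_true {e : RAM.Expr} {p : RAM.Prog} {M M' M'' : RAM.Memory} {b b' b'' : List Bool}
      {t t' : ℕ} (he : e.eval M ≠ 0) (hp : RAM.Exec p M b M' b' t)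
      (hl : RAM.Exec (.loop e p) M' b' M'' b'' t') :
      RAM.Exec (.loop e p) M b M'' b'' (e.cost M + t + t' + 1)
  | loop_false {e : RAM.Expr} {p : RAM.Prog} {M : RAM.Memory} {b : List Bool}
      (he : e.eval M = 0) :
      RAM.Exec (.loop e p) M b M b (e.cost M + 1)

/-- On the input memory `M`, the randomized program `p` always halts at cost at most `τ`, and with
probability at least `2/3` its output (the answer is "yes" if cell `0` holds `1` at the end, and
"no" otherwise) is the truth value of `answer`. The probability is over `N` independent fair coin
tosses, where `N` is large enough for all runs of `p` on `M` (its choice has no influence on the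
probability). -/
def RAM.DecidesWithin (p : RAM.Prog) (M : RAM.Memory) (answer : Prop) (τ : ℝ) : Prop :=
  ∃ N : ℕ,
    (∀ b : Fin N → Bool, ∃ (M' : RAM.Memory) (b' : List Bool) (t : ℕ),
      RAM.Exec p M (List.ofFn b) M' b' t ∧ (t : ℝ) ≤ τ) ∧
    (2 / 3 : ℝ) * 2 ^ N ≤
      Nat.card {b : Fin N → Bool // ∃ (M' : RAM.Memory) (b' : List Bool) (t : ℕ),
        RAM.Exec p M (List.ofFn b) M' b' t ∧ (M' 0 = 1 ↔ answer)}

/-! ### Set cover and the set cover conjecture -/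

/-- The answer of the set cover problem: at most `t` sets of the family `𝓕` cover `[n]`. -/
def HasSetCover {n : ℕ} (𝓕 : Finset (Finset (Fin n))) (t : ℕ) : Prop :=
  ∃ 𝓖 ⊆ 𝓕, 𝓖.card ≤ t ∧ 𝓖.biUnion id = Finset.univ

/-- The number whose binary digits are the characteristic vector of `X`. -/
def setCode {n : ℕ} (X : Finset (Fin n)) : ℕ := ∑ x ∈ X, 2 ^ (x : ℕ)

/-- The input memory for a set cover instance: the cells `0`, `1`, `2` hold `n`, `t` and the
number of sets, the following cells hold the codes of the sets in the order of the list, and all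
other cells are `0`. -/
def setCoverInput (n t : ℕ) (L : List (Finset (Fin n))) : RAM.Memory
  | 0 => n
  | 1 => t
  | 2 => L.length
  | i + 3 => (L.map setCode).getD i 0

/-- The randomized program `p` solves `s`-set cover, with running time at most `τ n t` on inputs
with universe `[n]` and threshold `t`. A family of sets, each of size at most `s`, is presented as
a list of its members without repetitions, in any order. -/
def SolvesSetCover (s : ℕ) (p : RAM.Prog) (τ : ℕ → ℕ → ℝ) : Prop :=
  ∀ (n t : ℕ) (L : List (Finset (Fin n))), L.Nodup → (∀ X ∈ L, X.card ≤ s) →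
    RAM.DecidesWithin p (setCoverInput n t L) (HasSetCover L.toFinset t) (τ n t)

/-- The set cover conjecture: for every `ε > 0` there is an `s` such that no randomized algorithm
solves `s`-set cover in time `O(2 ^ ((1 - ε) n))`. The threshold `t` is an arbitrary natural number,
so the time bound also has room for reading the binary digits of `t`. -/
def SetCoverConjecture : Prop :=
  ∀ ε : ℝ, 0 < ε → ∃ s : ℕ, ¬ ∃ (p : RAM.Prog) (C : ℝ),
    SolvesSetCover s p (fun n t => C * ((2 : ℝ) ^ ((1 - ε) * (n : ℝ)) + (Nat.size t : ℝ)))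

/-! The argument is by contraposition. If the asymptotic rank of `T_k` is at most `(8 - ε)^k` for
arbitrarily large `k`, then there is a `δ > 0`, depending on `ε` only, such that for every `s` the
`s`-set cover problem has a randomized algorithm with running time `O(2^((1 - δ) n))`, apart from
reading the threshold. This contradicts the conjecture.

A block of `3kn` elements has `8^(kn)` subsets, but only tuples of `n` subsets, each with at most
`k` of the `3k` elements of its part, are needed; there are at most `(27/4)^(kn)` of these. The
reason is that every cover by small sets can be divided into three groups such that each group is
responsible for about one third of every part. This is the theorem of Beck and Fiala
(`BeckFiala.exists_rounding`), used twice in `BeckFiala.exists_balanced_coloring`. Its error is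
bounded in terms of `s` alone, so it suffices to let a part have `3(k - 2s)` genuine elements and to
fill it up with dummy elements until every group has exactly `k`. For large `k` the loss is
negligible.

Dynamic programming computes, for all sets described by such tuples, the least number of members of
the family that cover them (`spec_coverNumbersCmd`). It remains to decide whether three of the
described sets cover the universe within the budget. That is the question whether a Kronecker power
of `T_k`, restricted to the indices within the budget, is nonzero. It is evaluated at random
zero-one vectors, where a nonzero trilinear form survives with probability at least `1/8` over every
field (`card_exists_chosenSum_ne_zero`). A decomposition of a fixed power of `T_k` into `R` terms
gives three `R × R` matrices, and their Kronecker powers are applied to vectors one factor at a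
time, as in Yates's algorithm (`sum_layer`). The time is `R^r` times a polynomial for `r` blocks,
where `R ≤ ν^(kn)` with `ν < 8`.

The machine computes with integers, so the decomposition has to be moved from the given field to a
prime field. The tensor has integer coefficients, so a decomposition survives the passage to a
residue field of a finitely generated ring, which is finite; restriction of scalars then costs only
a constant factor (`exists_prime_isSumOfRankOne`).

The second claim follows from the first one, as `N ≤ (27/4)^k` and `(27/4)^1.08 < 8`. -/

/-! ### A small imperative language with arrays, and its compilation to random access machines -/

namespace RAM

/-- The number of bits of the value of an expression is at most this number times `b + 1` if all
cells have at most `b` bits. -/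
def Expr.sizeWeight : Expr → ℕ
  | .const c => Nat.size c
  | .load _ => 1
  | .op _ e₁ e₂ => e₁.sizeWeight + e₂.sizeWeight + 1

/-- The cost of an expression is at most this number times `(b + 1) ^ 2` if all cells have at most
`b` bits. -/
def Expr.costWeight : Expr → ℕ
  | .const c => Nat.size c + 1
  | .load a => a.costWeight + a.sizeWeight + 1
  | .op _ e₁ e₂ =>
    e₁.costWeight + e₂.costWeight + (e₁.sizeWeight + 1) * (e₂.sizeWeight + 1)

theorem size_add_le (x y : ℕ) : Nat.size (x + y) ≤ Nat.size x + Nat.size y + 1 := by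
  rw [Nat.size_le]
  have hx := Nat.lt_size_self x
  have hy := Nat.lt_size_self y
  have h1 : 2 ^ Nat.size x ≤ 2 ^ (Nat.size x + Nat.size y) :=
    Nat.pow_le_pow_right (by norm_num) (by omega)
  have h2 : 2 ^ Nat.size y ≤ 2 ^ (Nat.size x + Nat.size y) :=
    Nat.pow_le_pow_right (by norm_num) (by omega)
  rw [pow_succ]
  omega

theorem size_mul_le (x y : ℕ) : Nat.size (x * y) ≤ Nat.size x + Nat.size y := by
  rw [Nat.size_le, pow_add]
  exact Nat.mul_lt_mul'' (Nat.lt_size_self x) (Nat.lt_size_self y)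

theorem Expr.size_eval_le {M : Memory} {b : ℕ} (hM : ∀ a, Nat.size (M a) ≤ b) (e : Expr) :
    Nat.size (e.eval M) ≤ e.sizeWeight * (b + 1) := by
  induction e with
  | const c => simp only [eval, sizeWeight]; nlinarith [Nat.zero_le (Nat.size c * b)]
  | load a _ => simp only [eval, sizeWeight]; have := hM (a.eval M); omega
  | op o e₁ e₂ h₁ h₂ =>
    have key : Nat.size (o.eval (e₁.eval M) (e₂.eval M)) ≤
        Nat.size (e₁.eval M) + Nat.size (e₂.eval M) + 1 := by
      cases o with
      | add => exact size_add_le _ _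
      | sub => exact (Nat.size_le_size (Nat.sub_le _ _)).trans (by omega)
      | mul => exact (size_mul_le _ _).trans (by omega)
      | div => exact (Nat.size_le_size (Nat.div_le_self _ _)).trans (by omega)
      | mod => exact (Nat.size_le_size (Nat.mod_le _ _)).trans (by omega)
    simp only [eval, sizeWeight]
    nlinarith

theorem Expr.cost_le {M : Memory} {b : ℕ} (hM : ∀ a, Nat.size (M a) ≤ b) (e : Expr) :
    e.cost M ≤ e.costWeight * (b + 1) ^ 2 := by
  have hb : 1 ≤ (b + 1) ^ 2 := Nat.one_le_pow _ _ (by omega)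
  have hb' : b + 1 ≤ (b + 1) ^ 2 := by nlinarith
  induction e with
  | const c => simp only [cost, costWeight]; nlinarith [Nat.zero_le (Nat.size c)]
  | load a h =>
    simp only [cost, costWeight]
    have h1 := a.size_eval_le hM
    have h2 := hM (a.eval M)
    have h3 : a.sizeWeight * (b + 1) ≤ a.sizeWeight * (b + 1) ^ 2 := Nat.mul_le_mul_left _ hb'
    nlinarith
  | op o e₁ e₂ h₁ h₂ =>
    have s1 := e₁.size_eval_le hM
    have s2 := e₂.size_eval_le hM
    have key : o.cost (e₁.eval M) (e₂.eval M) ≤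
        (Nat.size (e₁.eval M) + 1) * (Nat.size (e₂.eval M) + 1) := by
      cases o <;> simp only [Op.cost, le_refl] <;> nlinarith [Nat.zero_le
        (Nat.size (e₁.eval M) * Nat.size (e₂.eval M))]
    have k2 : (Nat.size (e₁.eval M) + 1) * (Nat.size (e₂.eval M) + 1) ≤
        ((e₁.sizeWeight + 1) * (b + 1)) * ((e₂.sizeWeight + 1) * (b + 1)) :=
      Nat.mul_le_mul (by nlinarith) (by nlinarith)
    simp only [cost, costWeight]
    calc _ ≤ e₁.costWeight * (b + 1) ^ 2 + e₂.costWeight * (b + 1) ^ 2 +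
        ((e₁.sizeWeight + 1) * (b + 1)) * ((e₂.sizeWeight + 1) * (b + 1)) := by omega
      _ = _ := by ring

end RAM

/-! ### Array programs: memory layout, expressions and commands -/

namespace ArrayLang

open RAM

/-- The contents of 32 arrays of natural numbers. Scalar variables are arrays of which only the
entry `0` is used. -/
abbrev Store := Fin 32 → ℕ → ℕ

/-- The store with one entry overwritten. -/
def upd (σ : Store) (c : Fin 32) (i v : ℕ) : Store :=
  fun c' i' => if c' = c ∧ i' = i then v else σ c' i'

theorem upd_same (σ : Store) (c : Fin 32) (i v : ℕ) : upd σ c i v c i = v := by simp [upd]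

theorem upd_ne (σ : Store) {c c' : Fin 32} (i v : ℕ) (h : c' ≠ c) : upd σ c i v c' = σ c' := by
  funext j; simp [upd, h]

theorem upd_apply (σ : Store) (c : Fin 32) (i v j : ℕ) :
    upd σ c i v c j = if j = i then v else σ c j := by simp [upd]

/-- Expressions over the read-only input and the arrays. -/
inductive HExpr
  | const (c : ℕ)
  | input (e : HExpr)
  | arr (c : Fin 32) (e : HExpr)
  | op (o : RAM.Op) (e₁ e₂ : HExpr)
  | table (B : ℕ) (f : ℕ → ℕ) (e : HExpr)

/-- The value of an expression. -/
def HExpr.eval (I : ℕ → ℕ) (σ : Store) : HExpr → ℕ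
  | .const c => c
  -- The reduction keeps the address inside the input area, where `mem` agrees with `I`, so that
  -- compilation is correct without side conditions.
  | .input e => I (e.eval I σ % (I 2 + 3))
  | .arr c e => σ c (e.eval I σ)
  | .op o e₁ e₂ => o.eval (e₁.eval I σ) (e₂.eval I σ)
  | .table B f e => if e.eval I σ < B then f (e.eval I σ) else 0

/-- The arrays that an expression reads. -/
def HExpr.reads : HExpr → List (Fin 32)
  | .const _ => []
  | .input e => e.reads
  | .arr c e => c :: e.reads
  | .op _ e₁ e₂ => e₁.reads ++ e₂.reads
  | .table _ _ e => e.reads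

theorem HExpr.eval_congr {I : ℕ → ℕ} {σ τ : Store} (e : HExpr)
    (h : ∀ a ∈ e.reads, σ a = τ a) : e.eval I σ = e.eval I τ := by
  induction e with
  | const c => rfl
  | input e ih => simp only [eval, ih h]
  | arr c e ih =>
    simp only [eval]
    rw [h c (by simp [reads]), ih fun a ha => h a (by simp [reads, ha])]
  | op o e₁ e₂ h₁ h₂ =>
    simp only [eval]
    rw [h₁ fun a ha => h a (by simp [reads, ha]), h₂ fun a ha => h a (by simp [reads, ha])]
  | table B f e ih => simp only [eval, ih h]

/-- The memory of the machine: the input occupies the first `I 2 + 3` cells, and the arrays are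
interleaved in the cells after it. -/
def mem (I : ℕ → ℕ) (σ : Store) : Memory := fun a =>
  if a < I 2 + 3 then I a
  else σ ⟨(a - (I 2 + 3)) % 32, Nat.mod_lt _ (by norm_num)⟩ ((a - (I 2 + 3)) / 32)

theorem mem_cell (I : ℕ → ℕ) (σ : Store) (c : Fin 32) (i : ℕ) :
    mem I σ (I 2 + (3 + c.1) + 32 * i) = σ c i := by
  have hc := c.2
  have h1 : I 2 + (3 + c.1) + 32 * i - (I 2 + 3) = c.1 + 32 * i := by omega
  have h2 : ¬ I 2 + (3 + c.1) + 32 * i < I 2 + 3 := by omega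
  simp only [mem, h2, if_false, h1]
  have h3 : (⟨(c.1 + 32 * i) % 32, Nat.mod_lt _ (by norm_num)⟩ : Fin 32) = c :=
    Fin.ext (show (c.1 + 32 * i) % 32 = c.1 by omega)
  rw [h3, show (c.1 + 32 * i) / 32 = i by omega]

theorem mem_update (I : ℕ → ℕ) (σ : Store) (c : Fin 32) (i v : ℕ) :
    Function.update (mem I σ) (I 2 + (3 + c.1) + 32 * i) v = mem I (upd σ c i v) := by
  funext a
  have hc := c.2
  by_cases h : a = I 2 + (3 + c.1) + 32 * i
  · subst h
    rw [Function.update_self, mem_cell, upd_same]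
  · rw [Function.update_of_ne h]
    simp only [mem]
    split_ifs with h1
    · rfl
    · simp only [upd]
      rw [if_neg]
      rintro ⟨h2, h3⟩
      rw [Fin.ext_iff] at h2
      simp only [] at h2
      omega

theorem mem_two (I : ℕ → ℕ) (σ : Store) : mem I σ 2 = I 2 := by
  simp only [mem]; rw [if_pos (by omega)]

/-- The address of an array entry. -/
def addr (c : Fin 32) (e : RAM.Expr) : RAM.Expr :=
  .op .add (.op .add (.load (.const 2)) (.const (3 + c.1))) (.op .mul (.const 32) e)

theorem eval_addr (I : ℕ → ℕ) (σ : Store) (c : Fin 32) (e : RAM.Expr) :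
    (addr c e).eval (mem I σ) = I 2 + (3 + c.1) + 32 * e.eval (mem I σ) := by
  simp [addr, RAM.Expr.eval, RAM.Op.eval, mem_two]

/-- An expression for a finite table. -/
def tableExpr (f : ℕ → ℕ) (e : RAM.Expr) : ℕ → RAM.Expr
  | 0 => .const 0
  | B + 1 => .op .add (tableExpr f e B) (.op .mul (.const (f B))
      (.op .sub (.const 1) (.op .add (.op .sub e (.const B)) (.op .sub (.const B) e))))

/-- With truncated subtraction, `(e - B) + (B - e)` is the distance of `e` and `B`, and `1` minus it
is the indicator of `e = B`. -/
theorem eval_tableExpr (M : RAM.Memory) (f : ℕ → ℕ) (e : RAM.Expr) (B : ℕ) :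
    (tableExpr f e B).eval M = if e.eval M < B then f (e.eval M) else 0 := by
  induction B with
  | zero => simp [tableExpr, RAM.Expr.eval]
  | succ B ih =>
    simp only [tableExpr, RAM.Expr.eval, RAM.Op.eval, ih]
    rcases lt_trichotomy (e.eval M) B with h | h | h
    · rw [if_pos h, if_pos (by omega), show 1 - (e.eval M - B + (B - e.eval M)) = 0 by omega]
      simp
    · rw [h]; simp
    · rw [if_neg (by omega), if_neg (by omega),
        show 1 - (e.eval M - B + (B - e.eval M)) = 0 by omega]
      simp

/-- The compilation of expressions. -/
def HExpr.compile : HExpr → RAM.Expr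
  | .const c => .const c
  | .input e => .load (.op .mod e.compile (.op .add (.load (.const 2)) (.const 3)))
  | .arr c e => .load (addr c e.compile)
  | .op o e₁ e₂ => .op o e₁.compile e₂.compile
  | .table B f e => tableExpr f e.compile B

theorem HExpr.eval_compile (I : ℕ → ℕ) (σ : Store) (e : HExpr) :
    e.compile.eval (mem I σ) = e.eval I σ := by
  induction e with
  | const c => rfl
  | input e ih =>
    simp only [compile, RAM.Expr.eval, RAM.Op.eval, ih, eval, mem_two]
    rw [mem, if_pos (Nat.mod_lt _ (by omega))]
  | arr c e ih =>
    simp only [compile, RAM.Expr.eval, eval_addr, ih, eval, mem_cell]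
  | op o e₁ e₂ h₁ h₂ => simp only [compile, RAM.Expr.eval, h₁, h₂, eval]
  | table B f e ih => simp only [compile, eval_tableExpr, ih, eval]

/-- Commands: assignments to array entries, sequences, and loops `for v < e`. -/
inductive Cmd
  | assign (c : Fin 32) (i e : HExpr)
  | seq (p q : Cmd)
  | loop (v : Fin 32) (e : HExpr) (body : Cmd)

/-- The store before the `k`-th round of a loop. -/
def iter (v : Fin 32) (f : Store → Store) (σ : Store) : ℕ → Store
  | 0 => upd σ v 0 0
  | k + 1 => upd (f (iter v f σ k)) v 0 (k + 1)

/-- The effect of a command. -/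
def Cmd.run (I : ℕ → ℕ) : Cmd → Store → Store
  | .assign c i e, σ => upd σ c (i.eval I σ) (e.eval I σ)
  | .seq p q, σ => q.run I (p.run I σ)
  | .loop v e body, σ => iter v (body.run I) σ (e.eval I σ)

/-- The arrays that a command may modify. -/
def Cmd.mods : Cmd → List (Fin 32)
  | .assign c _ _ => [c]
  | .seq p q => p.mods ++ q.mods
  | .loop v _ body => v :: body.mods

/-- The arrays that the loop bounds in a command read. -/
def Cmd.boundReads : Cmd → List (Fin 32)
  | .assign _ _ _ => []
  | .seq p q => p.boundReads ++ q.boundReads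
  | .loop _ e body => e.reads ++ body.boundReads

/-- No loop modifies its own variable, its bound, or the bounds of the loops inside it, and no
command modifies the loop bounds of a later one. -/
def Cmd.wf : Cmd → Bool
  | .assign _ _ _ => true
  | .seq p q => p.wf && q.wf && q.boundReads.all fun a => !p.mods.elem a
  | .loop v e body => body.wf && !body.mods.elem v &&
      (e.reads ++ body.boundReads).all fun a => !(v :: body.mods).elem a

theorem Cmd.run_frame {I : ℕ → ℕ} (p : Cmd) {a : Fin 32} (h : a ∉ p.mods) (σ : Store) :
    p.run I σ a = σ a := by
  induction p generalizing σ with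
  | assign c i e => exact upd_ne _ _ _ (by simpa [mods] using h)
  | seq p q hp hq =>
    simp only [mods, List.mem_append, not_or] at h
    simp only [run]
    rw [hq h.2, hp h.1]
  | loop v e body ih =>
    simp only [mods, List.mem_cons, not_or] at h
    simp only [run]
    induction e.eval I σ with
    | zero => exact upd_ne _ _ _ h.1
    | succ k hk => rw [iter, upd_ne _ _ _ h.1, ih h.2, hk]

end ArrayLang

/-! ### Costs of machine loops and assignments -/

namespace RAM

/-- The cost of a loop of `K` rounds. -/
theorem exec_loop {e : Expr} {p : Prog} (K T T₀ : ℕ) (S : ℕ → Memory) (B : ℕ → List Bool)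
    (hne : ∀ i < K, e.eval (S i) ≠ 0) (h0 : e.eval (S K) = 0)
    (hcost : ∀ i ≤ K, e.cost (S i) ≤ T₀)
    (hbody : ∀ i < K, ∃ t ≤ T, Exec p (S i) (B i) (S (i + 1)) (B (i + 1)) t) :
    ∃ t ≤ K * (T₀ + T + 1) + T₀ + 1, Exec (.loop e p) (S 0) (B 0) (S K) (B K) t := by
  induction K generalizing S B with
  | zero => exact ⟨_, by have := hcost 0 le_rfl; omega, Exec.loop_false h0⟩
  | succ K ih =>
    obtain ⟨t, ht, hl⟩ := ih (fun i => S (i + 1)) (fun i => B (i + 1))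
      (fun i hi => hne _ (by omega)) h0 (fun i hi => hcost _ (by omega))
      (fun i hi => hbody _ (by omega))
    obtain ⟨t', ht', hp⟩ := hbody 0 (by omega)
    refine ⟨_, ?_, Exec.loop_true (hne 0 (by omega)) hp hl⟩
    have := hcost 0 (by omega)
    rw [Nat.add_mul]
    omega

/-- The cost of an assignment is at most this number times `(b + 1) ^ 2` if all cells have at most
`b` bits. -/
def storeWeight (a e : Expr) : ℕ :=
  a.costWeight + e.costWeight + a.sizeWeight + e.sizeWeight + 1

theorem exec_store {M : Memory} {b : ℕ} (hM : ∀ a, Nat.size (M a) ≤ b) (a e : Expr)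
    (B : List Bool) : ∃ t ≤ storeWeight a e * (b + 1) ^ 2,
      Exec (.store a e) M B (Function.update M (a.eval M) (e.eval M)) B t := by
  refine ⟨_, ?_, Exec.store a e M B⟩
  have h1 := a.cost_le hM
  have h2 := e.cost_le hM
  have h3 := a.size_eval_le hM
  have h4 := e.size_eval_le hM
  have hb : 1 ≤ (b + 1) ^ 2 := Nat.one_le_pow _ _ (by omega)
  have hb' : b + 1 ≤ (b + 1) ^ 2 := by nlinarith
  have h5 := Nat.mul_le_mul_left a.sizeWeight hb'
  have h6 := Nat.mul_le_mul_left e.sizeWeight hb'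
  simp only [storeWeight, add_mul, one_mul]
  omega

end RAM

/-! ### Compilation of commands, and program logic -/

namespace ArrayLang

open RAM

/-- The expression for the scalar variable `v`. -/
def scalar (v : Fin 32) : RAM.Expr := .load (addr v (.const 0))

theorem eval_scalar (I : ℕ → ℕ) (σ : Store) (v : Fin 32) :
    (scalar v).eval (mem I σ) = σ v 0 := by
  simp only [scalar, RAM.Expr.eval, eval_addr, mem_cell]

/-- The loop test `e - v`. -/
def testExpr (v : Fin 32) (e : HExpr) : RAM.Expr := .op .sub e.compile (scalar v)

/-- The assignment `v := 0`. -/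
def resetProg (v : Fin 32) : RAM.Prog := .store (addr v (.const 0)) (.const 0)

/-- The assignment `v := v + 1`. -/
def incrProg (v : Fin 32) : RAM.Prog :=
  .store (addr v (.const 0)) (.op .add (scalar v) (.const 1))

/-- The loop `for v < e`. -/
def forProg (v : Fin 32) (e : HExpr) (p : RAM.Prog) : RAM.Prog :=
  .seq (resetProg v) (.loop (testExpr v e) (.seq p (incrProg v)))

/-- The compilation of commands. -/
def Cmd.compile : Cmd → RAM.Prog
  | .assign c i e => .store (addr c i.compile) e.compile
  | .seq p q => .seq p.compile q.compile
  | .loop v e body => forProg v e body.compile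

/-- The cost of the administration of a loop, per round. -/
def forWeight (v : Fin 32) (e : HExpr) : ℕ :=
  storeWeight (addr v (.const 0)) (.const 0) + (testExpr v e).costWeight +
    storeWeight (addr v (.const 0)) (.op .add (scalar v) (.const 1)) + 3

/-- A bound for the running time of a command, in units of `(b + 1) ^ 2` if all numbers have at
most `b` bits. -/
def Cmd.time (I : ℕ → ℕ) : Cmd → Store → ℕ
  | .assign c i e, _ => storeWeight (addr c i.compile) e.compile
  | .seq p q, σ => p.time I σ + q.time I σ + 1
  -- Charging every round with the time of the body at the initial store is justified for
  -- well-formed commands, whose bodies leave all loop bounds unchanged.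
  | .loop v e body, σ => (e.eval I σ + 1) * (body.time I σ + forWeight v e)

/-- Branching is absent, so the loop bounds are the only data on which the time depends. This is
what makes all rounds of a well-formed loop equally expensive. -/
theorem Cmd.time_congr {I : ℕ → ℕ} {σ τ : Store} (p : Cmd)
    (h : ∀ a ∈ p.boundReads, σ a = τ a) : p.time I σ = p.time I τ := by
  induction p with
  | assign c i e => rfl
  | seq p q hp hq =>
    simp only [time]
    rw [hp fun a ha => h a (by simp [boundReads, ha]),
      hq fun a ha => h a (by simp [boundReads, ha])]
  | loop v e body ih =>
    simp only [time]
    rw [ih fun a ha => h a (by simp [boundReads, ha]),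
      e.eval_congr fun a ha => h a (by simp [boundReads, ha])]

/-- All numbers that the command writes have at most `b` bits. -/
def Cmd.Fits (I : ℕ → ℕ) (b : ℕ) : Cmd → Store → Prop
  | .assign _ _ e, σ => Nat.size (e.eval I σ) ≤ b
  | .seq p q, σ => p.Fits I b σ ∧ q.Fits I b (p.run I σ)
  | .loop v e body, σ => Nat.size (e.eval I σ) ≤ b ∧
      ∀ i < e.eval I σ, body.Fits I b (iter v (body.run I) σ i)

theorem size_upd {σ : Store} {b : ℕ} (hσ : ∀ c i, Nat.size (σ c i) ≤ b) {c : Fin 32} {i v : ℕ}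
    (hv : Nat.size v ≤ b) (c' : Fin 32) (i' : ℕ) : Nat.size (upd σ c i v c' i') ≤ b := by
  simp only [upd]
  split_ifs
  · exact hv
  · exact hσ _ _

theorem size_mem {I : ℕ → ℕ} {σ : Store} {b : ℕ} (hI : ∀ a, Nat.size (I a) ≤ b)
    (hσ : ∀ c i, Nat.size (σ c i) ≤ b) (a : ℕ) : Nat.size (mem I σ a) ≤ b := by
  simp only [mem]
  split_ifs
  · exact hI _
  · exact hσ _ _

theorem Cmd.size_run {I : ℕ → ℕ} {b : ℕ} (p : Cmd) {σ : Store}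
    (hσ : ∀ c i, Nat.size (σ c i) ≤ b) (hp : p.Fits I b σ) (c : Fin 32) (i : ℕ) :
    Nat.size (p.run I σ c i) ≤ b := by
  induction p generalizing σ c i with
  | assign c i e => exact size_upd hσ hp _ _
  | seq p q h₁ h₂ => exact h₂ (fun c i => h₁ hσ hp.1 c i) hp.2 _ _
  | loop v e body ih =>
    obtain ⟨h1, h2⟩ := hp
    simp only [run]
    have key : ∀ k ≤ e.eval I σ, ∀ c i, Nat.size (iter v (body.run I) σ k c i) ≤ b := by
      intro k
      induction k with
      | zero => exact fun _ c i => size_upd hσ (by simp) c i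
      | succ k hk =>
        intro hk' c i
        exact size_upd (fun c i => ih (hk (by omega)) (h2 k (by omega)) c i)
          ((Nat.size_le_size hk').trans h1) c i
    exact key _ le_rfl _ _

theorem iter_frame {v : Fin 32} {p : Cmd} {I : ℕ → ℕ} {σ : Store} (k : ℕ) {a : Fin 32}
    (ha : a ≠ v) (hp : a ∉ p.mods) : iter v (p.run I) σ k a = σ a := by
  induction k with
  | zero => exact upd_ne _ _ _ ha
  | succ k hk => rw [iter, upd_ne _ _ _ ha, p.run_frame hp, hk]

theorem iter_var {v : Fin 32} {f : Store → Store} {σ : Store} (k : ℕ) :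
    iter v f σ k v 0 = k := by
  cases k <;> simp [iter, upd_same]

/-- The loop rule of the machine: `B i` are the coins that are left before the `i`-th round. -/
theorem exec_for {I : ℕ → ℕ} {b : ℕ} (hI : ∀ a, Nat.size (I a) ≤ b) (v : Fin 32) (e : HExpr)
    (p : RAM.Prog) (f : Store → Store) (σ : Store) (hσ : ∀ c i, Nat.size (σ c i) ≤ b)
    (B : ℕ → List Bool) (K T : ℕ)
    (hK : ∀ i ≤ K, e.eval I (iter v f σ i) = K)
    (hsize : ∀ i ≤ K, ∀ c j, Nat.size (iter v f σ i c j) ≤ b)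
    (hsize' : ∀ i < K, ∀ c j, Nat.size (f (iter v f σ i) c j) ≤ b)
    (hvar : ∀ i < K, f (iter v f σ i) v 0 = i)
    (hbody : ∀ i < K, ∃ t ≤ T * (b + 1) ^ 2,
      RAM.Exec p (mem I (iter v f σ i)) (B i) (mem I (f (iter v f σ i))) (B (i + 1)) t) :
    ∃ t ≤ (K + 1) * (T + forWeight v e) * (b + 1) ^ 2,
      RAM.Exec (forProg v e p) (mem I σ) (B 0) (mem I (iter v f σ K)) (B K) t := by
  have hupd : ∀ τ : Store, Function.update (mem I τ) ((addr v (.const 0)).eval (mem I τ)) =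
      fun w => mem I (upd τ v 0 w) := by
    intro τ
    funext w
    rw [eval_addr, ← mem_update]
    rfl
  have hcell : ∀ τ : Store, (testExpr v e).eval (mem I τ) = e.eval I τ - τ v 0 := by
    intro τ
    simp only [testExpr, RAM.Expr.eval, RAM.Op.eval, e.eval_compile, eval_scalar]
  obtain ⟨t₀, ht₀, hx₀⟩ := exec_store (size_mem hI hσ) (addr v (.const 0)) (.const 0) (B 0)
  rw [hupd] at hx₀
  obtain ⟨t, ht, hx⟩ := exec_loop (e := testExpr v e) (p := .seq p (incrProg v)) K
    ((T + storeWeight (addr v (.const 0)) (.op .add (scalar v) (.const 1)) + 1) * (b + 1) ^ 2)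
    ((testExpr v e).costWeight * (b + 1) ^ 2) (fun i => mem I (iter v f σ i)) B
    (fun i hi => by
      rw [hcell, hK i hi.le, iter_var]; omega)
    (by rw [hcell, hK K le_rfl, iter_var]; omega)
    (fun i hi => RAM.Expr.cost_le (size_mem hI (hsize i hi)) _)
    (fun i hi => by
      obtain ⟨t₁, ht₁, hx₁⟩ := hbody i hi
      obtain ⟨t₂, ht₂, hx₂⟩ := exec_store (size_mem hI (hsize' i hi)) (addr v (.const 0))
        (.op .add (scalar v) (.const 1)) (B (i + 1))
      rw [hupd] at hx₂
      have hev : (RAM.Expr.op .add (scalar v) (.const 1)).eval (mem I (f (iter v f σ i))) =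
          i + 1 := by
        simp only [RAM.Expr.eval, RAM.Op.eval, eval_scalar, hvar i hi]
      rw [hev] at hx₂
      refine ⟨_, ?_, Exec.seq hx₁ hx₂⟩
      have : 1 ≤ (b + 1) ^ 2 := Nat.one_le_pow _ _ (by omega)
      simp only [add_mul, one_mul]
      omega)
  refine ⟨_, ?_, Exec.seq hx₀ hx⟩
  have h1 : 1 ≤ (b + 1) ^ 2 := Nat.one_le_pow _ _ (by omega)
  simp only [forWeight]
  generalize (b + 1) ^ 2 = q at *
  generalize storeWeight (addr v (.const 0)) (.const 0) = w₀ at *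
  generalize storeWeight (addr v (.const 0)) (.op .add (scalar v) (.const 1)) = w₁ at *
  generalize (testExpr v e).costWeight = w₂ at *
  have h2 : K * (w₂ * q + (T + w₁ + 1) * q + 1) ≤ K * ((T + w₁ + w₂ + 2) * q) :=
    Nat.mul_le_mul_left _ (by nlinarith)
  nlinarith [Nat.zero_le (K * (w₀ * q)), Nat.zero_le (K * q), Nat.zero_le (T * q),
    Nat.zero_le (w₁ * q)]

/-- The compilation of commands is correct. -/
theorem Cmd.exec_compile {I : ℕ → ℕ} {b : ℕ} (hI : ∀ a, Nat.size (I a) ≤ b) (p : Cmd)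
    (hwf : p.wf = true) (σ : Store) (hσ : ∀ c i, Nat.size (σ c i) ≤ b) (hp : p.Fits I b σ)
    (B : List Bool) : ∃ t ≤ p.time I σ * (b + 1) ^ 2,
      RAM.Exec p.compile (mem I σ) B (mem I (p.run I σ)) B t := by
  induction p generalizing σ B with
  | assign c i e =>
    obtain ⟨t, ht, hx⟩ := exec_store (size_mem hI hσ) (addr c i.compile) e.compile B
    rw [eval_addr, mem_update, i.eval_compile, e.eval_compile] at hx
    exact ⟨t, ht, hx⟩
  | seq p q h₁ h₂ =>
    simp only [wf, Bool.and_eq_true, List.all_eq_true] at hwf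
    obtain ⟨⟨w1, w2⟩, w3⟩ := hwf
    obtain ⟨t, ht, hx⟩ := h₁ w1 σ hσ hp.1 B
    obtain ⟨t', ht', hx'⟩ := h₂ w2 _ (p.size_run hσ hp.1) hp.2 B
    refine ⟨_, ?_, Exec.seq hx hx'⟩
    have hc : q.time I (p.run I σ) = q.time I σ :=
      q.time_congr fun a ha => p.run_frame (by simpa using w3 a ha) σ
    rw [hc] at ht'
    have : 1 ≤ (b + 1) ^ 2 := Nat.one_le_pow _ _ (by omega)
    simp only [time, add_mul, one_mul]
    omega
  | loop v e body ih =>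
    simp only [wf, Bool.and_eq_true, List.all_eq_true] at hwf
    obtain ⟨⟨w1, w2⟩, w3⟩ := hwf
    have w2' : v ∉ body.mods := by simpa using w2
    have w3' : ∀ a ∈ e.reads ++ body.boundReads, a ≠ v ∧ a ∉ body.mods := by
      intro a ha
      simpa [not_or] using w3 a ha
    obtain ⟨h1, h2⟩ := hp
    have hs : ∀ i ≤ e.eval I σ, ∀ c j, Nat.size (iter v (body.run I) σ i c j) ≤ b := by
      intro k hk c i
      have := Cmd.size_run (I := I) (b := b) (.loop v (.const k) body) hσ
        ⟨(Nat.size_le_size hk).trans h1, fun i hi => h2 i (lt_of_lt_of_le hi hk)⟩ c i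
      exact this
    exact exec_for hI v e body.compile (body.run I) σ hσ (fun _ => B) (e.eval I σ)
      (body.time I σ)
      (fun i _ => e.eval_congr fun a ha =>
        iter_frame i (w3' a (by simp [ha])).1 (w3' a (by simp [ha])).2)
      hs (fun i hi => body.size_run (hs i hi.le) (h2 i hi))
      (fun i hi => by rw [body.run_frame w2', iter_var])
      (fun i hi => by
        obtain ⟨t, ht, hx⟩ := ih w1 _ (hs i hi.le) (h2 i hi) B
        refine ⟨t, ?_, hx⟩
        rwa [body.time_congr fun a ha =>
          (iter_frame i (w3' a (by simp [ha])).1 (w3' a (by simp [ha])).2).symm])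

/-- Total correctness: the numbers written have at most `b` bits, and the final store satisfies
`Q`. -/
def Spec (I : ℕ → ℕ) (b : ℕ) (p : Cmd) (σ : Store) (Q : Store → Prop) : Prop :=
  p.Fits I b σ ∧ Q (p.run I σ)

theorem Spec.assign {I : ℕ → ℕ} {b : ℕ} {c : Fin 32} {i e : HExpr} {σ : Store}
    {Q : Store → Prop} (i' v : ℕ) (hi : i.eval I σ = i') (hv : e.eval I σ = v)
    (hsize : Nat.size v ≤ b) (hQ : Q (upd σ c i' v)) : Spec I b (.assign c i e) σ Q := by
  subst hi hv
  exact ⟨hsize, hQ⟩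

theorem Spec.seq {I : ℕ → ℕ} {b : ℕ} {p q : Cmd} {σ : Store} {Q : Store → Prop}
    (h : Spec I b p σ fun τ => Spec I b q τ Q) : Spec I b (.seq p q) σ Q :=
  ⟨⟨h.1, h.2.1⟩, h.2.2⟩

/-- The weakening rule, which also says that the command changes nothing else. -/
theorem Spec.mono {I : ℕ → ℕ} {b : ℕ} {p : Cmd} {σ : Store} {Q Q' : Store → Prop}
    (h : Spec I b p σ Q) (hQ : ∀ τ, Q τ → (∀ a, p.mods.elem a = false → τ a = σ a) → Q' τ) :
    Spec I b p σ Q' :=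
  ⟨h.1, hQ _ h.2 fun _ ha => p.run_frame (by simpa using ha) σ⟩

/-- The invariant `Inv i` describes the store at the start of round `i`, when the counter has
already been set. This explains the updates of `v` in the initial condition and at the end of a
round. The body may also rely on the arrays outside its list of modified ones. -/
theorem Spec.loop {I : ℕ → ℕ} {b : ℕ} {v : Fin 32} {e : HExpr} {p : Cmd} {σ : Store}
    {Q : Store → Prop} (Inv : ℕ → Store → Prop) (K : ℕ)
    (hK : e.eval I σ = K) (hsize : Nat.size K ≤ b) (h0 : Inv 0 (upd σ v 0 0))
    (hstep : ∀ i < K, ∀ τ, Inv i τ → τ v 0 = i → (∀ a, (v :: p.mods).elem a = false → τ a = σ a) →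
      Spec I b p τ fun τ' => Inv (i + 1) (upd τ' v 0 (i + 1)))
    (hQ : ∀ τ, Inv K τ → Q τ) : Spec I b (.loop v e p) σ Q := by
  have key : ∀ i ≤ K, Inv i (iter v (p.run I) σ i) ∧
      (∀ j < i, p.Fits I b (iter v (p.run I) σ j)) := by
    intro i
    induction i with
    | zero => exact fun _ => ⟨h0, fun j hj => absurd hj (by omega)⟩
    | succ i ih =>
      intro hi
      obtain ⟨h1, h2⟩ := ih (by omega)
      have h3 := hstep i (by omega) _ h1 (iter_var i) fun a ha => by
        have ha : a ∉ v :: p.mods := by simpa using ha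
        simp only [List.mem_cons, not_or] at ha
        exact iter_frame i ha.1 ha.2
      refine ⟨h3.2, fun j hj => ?_⟩
      rcases Nat.lt_succ_iff_lt_or_eq.1 hj with h | rfl
      · exact h2 j h
      · exact h3.1
  refine ⟨⟨hK ▸ hsize, ?_⟩, ?_⟩
  · rw [hK]; exact (key K le_rfl).2
  · simp only [Cmd.run, hK]
    exact hQ _ (key K le_rfl).1

end ArrayLang

/-! ### Covering schemes -/

/-- A way to cut the universe into blocks of `m` elements, and to decide by multiplying `R × R`
matrices whether three subsets of a block cover the block. The digits `d < R` stand for subsets of a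
block, and `has d e` says that the subset of the digit `d` contains the element `e`. -/
structure CoverScheme (s : ℕ) where
  m : ℕ
  R : ℕ
  p : ℕ
  m_pos : 0 < m
  R_pos : 0 < R
  prime : p.Prime
  has : ℕ → ℕ → Prop
  sub : ℕ → ℕ → ℕ
  sub_lt : ∀ d x, sub d x < R
  not_has_zero : ∀ e, ¬ has 0 e
  has_sub : ∀ d < R, ∀ x, ∀ e < m, (has (sub d x) e ↔ has d e ∧ x.testBit e = false)
  -- Different digits may have the same elements in the block. An empty difference must nevertheless
  -- be the digit `0`, at which the dynamic program starts.
  sub_eq_zero : ∀ d < R, ∀ x, (∀ e < m, has d e → x.testBit e = true) → sub d x = 0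
  mat : ℕ → ℕ → ℕ → ZMod p
  sound : ∀ d : ℕ → ℕ, (∀ a < 3, d a < R) →
    ∑ l ∈ Finset.range R, mat 0 l (d 0) * mat 1 l (d 1) * mat 2 l (d 2) ≠ 0 →
    ∀ e < m, ∃ a < 3, has (d a) e
  -- Triples of digits are only required for partitions whose pieces are small. `piece` assigns the
  -- elements of all `r` blocks to pieces, and one colouring of the pieces serves all blocks.
  complete : ∀ (r : ℕ) (α : Type) [DecidableEq α] (piece : ℕ → α),
    (∀ i, ((Finset.range (m * r)).filter fun e => piece e = i).card ≤ s) →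
    ∃ χ : α → ℕ, (∀ i, χ i < 3) ∧ ∀ u < r, ∃ d : ℕ → ℕ, (∀ a < 3, d a < R) ∧
      (∀ a < 3, ∀ e < m, (has (d a) e ↔ χ (piece (m * u + e)) = a)) ∧
      ∑ l ∈ Finset.range R, mat 0 l (d 0) * mat 1 l (d 1) * mat 2 l (d 2) ≠ 0

/-- The digit number `u` of `i` in base `R`. -/
def digit (R u i : ℕ) : ℕ := i / R ^ u % R

theorem digit_lt {R : ℕ} (hR : 0 < R) (u i : ℕ) : digit R u i < R := Nat.mod_lt _ hR

theorem sum_digits_lt {R : ℕ} (hR : 0 < R) {d : ℕ → ℕ} (r : ℕ) (hd : ∀ u < r, d u < R) :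
    ∑ u ∈ Finset.range r, R ^ u * d u < R ^ r := by
  induction r with
  | zero => simp
  | succ r ih =>
    rw [Finset.sum_range_succ, pow_succ]
    have h1 := ih fun u hu => hd u (by omega)
    have h2 : R ^ r * d r ≤ R ^ r * (R - 1) := Nat.mul_le_mul_left _ (by have := hd r; omega)
    obtain ⟨R, rfl⟩ : ∃ R', R = R' + 1 := ⟨R - 1, by omega⟩
    simp only [Nat.add_sub_cancel] at h2
    rw [Nat.mul_add]
    omega

theorem digit_sum {R : ℕ} (hR : 0 < R) {d : ℕ → ℕ} (r : ℕ) (hd : ∀ u < r, d u < R) {u : ℕ}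
    (hu : u < r) : digit R u (∑ v ∈ Finset.range r, R ^ v * d v) = d u := by
  induction r with
  | zero => omega
  | succ r ih =>
    rw [Finset.sum_range_succ, digit]
    rcases Nat.lt_succ_iff_lt_or_eq.1 hu with h | rfl
    · have h1 : R ^ r * d r = R ^ u * (R * (R ^ (r - u - 1) * d r)) := by
        rw [← mul_assoc, ← mul_assoc, ← pow_succ, ← pow_add]
        congr 2
        omega
      rw [h1, Nat.add_mul_div_left _ _ (by positivity), Nat.add_mul_mod_self_left]
      exact ih (fun u hu => hd u (by omega)) h
    · rw [Nat.add_mul_div_left _ _ (by positivity),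
        Nat.div_eq_of_lt (sum_digits_lt hR _ fun u hu => hd u (by omega)), zero_add,
        Nat.mod_eq_of_lt (hd _ (by omega))]

namespace CoverScheme

variable {s : ℕ} (D : CoverScheme s)

/-- The element `e` belongs to the set with index `i`. -/
def Mem (i e : ℕ) : Prop := D.has (digit D.R (e / D.m) i) (e % D.m)

/-- The index of the set with index `i` minus the set with code `X`. -/
def diff (r X i : ℕ) : ℕ := ∑ u ∈ Finset.range r,
  D.R ^ u * D.sub (digit D.R u i) (X / 2 ^ (D.m * u) % 2 ^ D.m)

theorem diff_lt (r X i : ℕ) : D.diff r X i < D.R ^ r :=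
  sum_digits_lt D.R_pos r fun _ _ => D.sub_lt _ _

theorem testBit_block (X u e : ℕ) (he : e < D.m) :
    (X / 2 ^ (D.m * u) % 2 ^ D.m).testBit e = X.testBit (D.m * u + e) := by
  rw [Nat.testBit_mod_two_pow, Nat.testBit_div_two_pow]
  simp [he, add_comm]

theorem mem_diff {r X i e : ℕ} (he : e < D.m * r) :
    D.Mem (D.diff r X i) e ↔ D.Mem i e ∧ X.testBit e = false := by
  have hm : e % D.m < D.m := Nat.mod_lt _ D.m_pos
  have hr : e / D.m < r := Nat.div_lt_of_lt_mul he
  rw [Mem, diff, digit_sum D.R_pos r (fun _ _ => D.sub_lt _ _) hr,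
    D.has_sub _ (digit_lt D.R_pos _ _) _ _ hm, D.testBit_block _ _ _ hm, Nat.div_add_mod, Mem]

theorem diff_eq_zero {r X i : ℕ} (h : ∀ e < D.m * r, D.Mem i e → X.testBit e = true) :
    D.diff r X i = 0 := by
  refine Finset.sum_eq_zero fun u hu => ?_
  rw [Finset.mem_range] at hu
  rw [D.sub_eq_zero _ (digit_lt D.R_pos _ _), mul_zero]
  intro e he hd
  rw [D.testBit_block _ _ _ he]
  refine h _ ?_ ?_
  · calc D.m * u + e < D.m * u + D.m := by omega
      _ = D.m * (u + 1) := by ring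
      _ ≤ D.m * r := Nat.mul_le_mul_left _ hu
  · rw [Mem, Nat.mul_add_div D.m_pos, Nat.div_eq_of_lt he, add_zero, Nat.mul_add_mod,
      Nat.mod_eq_of_lt he]
    exact hd

theorem not_mem_zero (e : ℕ) : ¬ D.Mem 0 e := by
  simp [Mem, digit, D.not_has_zero]

end CoverScheme

/-! ### The set cover program: dynamic programming over the sets of the scheme -/

namespace ArrayLang

instance : Add HExpr := ⟨HExpr.op .add⟩
instance : Sub HExpr := ⟨HExpr.op .sub⟩
instance : Mul HExpr := ⟨HExpr.op .mul⟩
instance : Div HExpr := ⟨HExpr.op .div⟩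
instance : Mod HExpr := ⟨HExpr.op .mod⟩

/-- The expression for the scalar variable `v`. -/
def var (v : Fin 32) : HExpr := .arr v (.const 0)

section Eval

variable (I : ℕ → ℕ) (σ : Store) (e₁ e₂ : HExpr)

theorem eval_add : (e₁ + e₂).eval I σ = e₁.eval I σ + e₂.eval I σ := rfl
theorem eval_sub : (e₁ - e₂).eval I σ = e₁.eval I σ - e₂.eval I σ := rfl
theorem eval_mul : (e₁ * e₂).eval I σ = e₁.eval I σ * e₂.eval I σ := rfl
theorem eval_div : (e₁ / e₂).eval I σ = e₁.eval I σ / e₂.eval I σ := rfl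
theorem eval_mod : (e₁ % e₂).eval I σ = e₁.eval I σ % e₂.eval I σ := rfl
theorem eval_const (c : ℕ) : (HExpr.const c).eval I σ = c := rfl
theorem eval_var (v : Fin 32) : (var v).eval I σ = σ v 0 := rfl
theorem eval_arr (v : Fin 32) : (HExpr.arr v e₁).eval I σ = σ v (e₁.eval I σ) := rfl
theorem eval_input : (HExpr.input e₁).eval I σ = I (e₁.eval I σ % (I 2 + 3)) := rfl
theorem eval_table (B : ℕ) (f : ℕ → ℕ) : (HExpr.table B f e₁).eval I σ =
    if e₁.eval I σ < B then f (e₁.eval I σ) else 0 := rfl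

end Eval

/-- The assignment to a scalar variable. -/
def set (v : Fin 32) (e : HExpr) : Cmd := .assign v (.const 0) e

theorem Spec.set {I : ℕ → ℕ} {b : ℕ} {c : Fin 32} {e : HExpr} {σ : Store}
    {Q : Store → Prop} (v : ℕ) (hv : e.eval I σ = v)
    (hsize : Nat.size v ≤ b) (hQ : Q (upd σ c 0 v)) : Spec I b (ArrayLang.set c e) σ Q :=
  Spec.assign 0 v rfl hv hsize hQ

end ArrayLang

namespace CoverScheme

open ArrayLang

variable {s : ℕ} (D : CoverScheme s)

/-- One round of the computation of `diff`. Variables: `6` is the round `u`, `7` is `R ^ u`, `8` and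
`9` are what is left of the code and of the index, `10` is the result. -/
def diffRound : Cmd :=
  .seq (set 10 (var 10 + var 7 * .table (D.R * 2 ^ D.m)
      (fun j => D.sub (j / 2 ^ D.m) (j % 2 ^ D.m))
      (var 9 % .const D.R * .const (2 ^ D.m) + var 8 % .const (2 ^ D.m))))
    (.seq (set 7 (var 7 * .const D.R))
      (.seq (set 9 (var 9 / .const D.R)) (set 8 (var 8 / .const (2 ^ D.m)))))

/-- The computation of `diff`. Variable `0` is the number of blocks, `2` is the code, `5` is the
index. -/
def diffCmd : Cmd :=
  .seq (set 10 (.const 0)) (.seq (set 7 (.const 1)) (.seq (set 9 (var 5)) (.seq (set 8 (var 2))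
    (.loop 6 (var 0) D.diffRound))))

theorem spec_diffCmd {I : ℕ → ℕ} {b big : ℕ} (hbig : Nat.size big ≤ b) (σ : Store) (r X i : ℕ)
    (hr : σ 0 0 = r) (hX : σ 2 0 = X) (hi : σ 5 0 = i) (h1 : r ≤ big) (h2 : D.R ^ r ≤ big)
    (h3 : X ≤ big) (h4 : i ≤ big) :
    Spec I b D.diffCmd σ fun τ => τ 10 0 = D.diff r X i := by
  have fits : ∀ v ≤ big, Nat.size v ≤ b := fun v hv => (Nat.size_le_size hv).trans hbig
  have hpow : ∀ u ≤ r, D.R ^ u ≤ D.R ^ r := fun u hu => Nat.pow_le_pow_right D.R_pos hu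
  have hone : 1 ≤ big := (Nat.one_le_pow r _ D.R_pos).trans h2
  refine Spec.seq (Spec.set 0 rfl (fits _ (by omega)) ?_)
  refine Spec.seq (Spec.set 1 rfl (fits _ hone) ?_)
  refine Spec.seq (Spec.set i (by simp [eval_var, upd, hi]) (fits _ h4) ?_)
  refine Spec.seq (Spec.set X (by simp [eval_var, upd, hX]) (fits _ h3) ?_)
  refine Spec.loop (fun u τ => τ 10 0 = D.diff u X i ∧ τ 7 0 = D.R ^ u ∧
    τ 9 0 = i / D.R ^ u ∧ τ 8 0 = X / 2 ^ (D.m * u)) r (by simp [eval_var, upd, hr]) (fits _ h1)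
    (by simp [upd, diff]) ?_ (fun τ h => h.1)
  rintro u hu τ ⟨t10, t7, t9, t8⟩ - -
  have hd : D.diff (u + 1) X i = D.diff u X i +
      D.R ^ u * D.sub (digit D.R u i) (X / 2 ^ (D.m * u) % 2 ^ D.m) := by
    rw [diff, Finset.sum_range_succ, diff]
  refine Spec.seq (Spec.set (D.diff (u + 1) X i) ?_
    (fits _ ((D.diff_lt _ _ _).le.trans ((hpow _ hu).trans h2))) ?_)
  · simp only [eval_add, eval_mul, eval_mod, eval_var, eval_const, eval_table, t10, t7, t9, t8]
    have hx : X / 2 ^ (D.m * u) % 2 ^ D.m < 2 ^ D.m := Nat.mod_lt _ (by positivity)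
    have hdg : i / D.R ^ u % D.R < D.R := Nat.mod_lt _ D.R_pos
    rw [if_pos, hd, digit]
    · congr 3
      · rw [mul_comm, Nat.mul_add_div (by positivity), Nat.div_eq_of_lt hx, add_zero]
      · rw [mul_comm, Nat.mul_add_mod, Nat.mod_eq_of_lt hx]
    · calc _ < i / D.R ^ u % D.R * 2 ^ D.m + 2 ^ D.m := by omega
        _ = (i / D.R ^ u % D.R + 1) * 2 ^ D.m := by ring
        _ ≤ _ := Nat.mul_le_mul_right _ hdg
  refine Spec.seq (Spec.set (D.R ^ (u + 1)) (by
    simp [eval_mul, eval_var, eval_const, upd, t7, pow_succ]) (fits _ ((hpow _ hu).trans h2)) ?_)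
  refine Spec.seq (Spec.set (i / D.R ^ (u + 1)) (by
    simp [eval_div, eval_var, eval_const, upd, t9, pow_succ, Nat.div_div_eq_div_mul])
    (fits _ ((Nat.div_le_self _ _).trans h4)) ?_)
  refine Spec.set (X / 2 ^ (D.m * (u + 1))) (by
    simp [eval_div, eval_var, eval_const, upd, t8, mul_add, pow_add, Nat.div_div_eq_div_mul])
    (fits _ ((Nat.div_le_self _ _).trans h3)) ?_
  simp [upd]

/-- One pass over all indices `i` (variable `5`), which replaces `f i` by the minimum of `f i` and
`f (diff i) + c`. The array `17` is `f`, variable `3` is `c`, and `1` is the number of indices. -/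
def relaxCmd : Cmd :=
  -- Truncated subtraction gives `x - (x - y) = min x y`.
  .loop 5 (var 1) (.seq D.diffCmd (.assign 17 (var 5) (.arr 17 (var 5) -
    (.arr 17 (var 5) - (.arr 17 (var 10) + var 3)))))

/-- The pass works in place, so `f (diff i)` may be the old or the new value. This is harmless:
values only decrease, and `Good` is preserved by the update in either case. `Good i v` will express
that the value `v` is attained by an actual cover of the set with index `i`. -/
theorem spec_relaxCmd {I : ℕ → ℕ} {b big : ℕ} (hbig : Nat.size big ≤ b) (σ : Store)
    (r X c : ℕ) (hr : σ 0 0 = r) (hN : σ 1 0 = D.R ^ r) (hX : σ 2 0 = X) (hc : σ 3 0 = c)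
    (h1 : r ≤ big) (h2 : D.R ^ r ≤ big) (h3 : X ≤ big)
    (Good : ℕ → ℕ → Prop) (hf : ∀ i < D.R ^ r, σ 17 i ≤ big ∧ Good i (σ 17 i))
    (hGood : ∀ i < D.R ^ r, ∀ v, Good (D.diff r X i) v → Good i (v + c)) :
    Spec I b D.relaxCmd σ fun τ => ∀ i < D.R ^ r, Good i (τ 17 i) ∧ τ 17 i ≤ σ 17 i ∧
      τ 17 i ≤ σ 17 (D.diff r X i) + c := by
  have fits : ∀ v ≤ big, Nat.size v ≤ b := fun v hv => (Nat.size_le_size hv).trans hbig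
  refine Spec.loop (fun k τ => (∀ i < D.R ^ r, Good i (τ 17 i) ∧ τ 17 i ≤ σ 17 i) ∧
      ∀ i < k, τ 17 i ≤ σ 17 (D.diff r X i) + c) (D.R ^ r) (by simp [eval_var, hN]) (fits _ h2)
    ⟨fun i hi => by simpa [upd] using (hf i hi).2, fun i hi => by omega⟩ ?_
    (fun τ h i hi => ⟨(h.1 i hi).1, (h.1 i hi).2, h.2 i hi⟩)
  rintro i hi τ ⟨t1, t2⟩ ti frame
  have e0 : τ 0 = σ 0 := frame 0 rfl
  have e2 : τ 2 = σ 2 := frame 2 rfl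
  have e3 : τ 3 = σ 3 := frame 3 rfl
  refine Spec.seq (Spec.mono (D.spec_diffCmd hbig τ r X i (by rw [e0, hr]) (by rw [e2, hX]) ti
    h1 h2 h3 (hi.le.trans h2)) ?_)
  intro τ' t10 frame'
  have f17 : τ' 17 = τ 17 := frame' 17 rfl
  have f5 : τ' 5 = τ 5 := frame' 5 rfl
  have f3 : τ' 3 = τ 3 := frame' 3 rfl
  set o := D.diff r X i with ho
  have hoN : o < D.R ^ r := D.diff_lt _ _ _
  refine Spec.assign i (min (τ 17 i) (τ 17 o + c)) (by rw [eval_var, f5, ti]) ?_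
    (fits _ ((min_le_left _ _).trans ((t1 i hi).2.trans (hf i hi).1))) ?_
  · simp only [eval_sub, eval_add, eval_arr, eval_var, t10, f17, f5, f3, e3, ti, hc]
    omega
  · refine ⟨fun j hj => ?_, fun j hj => ?_⟩
    · by_cases hji : j = i
      · subst hji
        simp only [upd]
        simp only [show (17 : Fin 32) ≠ 5 by decide, false_and, if_false, and_self,
          if_true]
        refine ⟨?_, (min_le_left _ _).trans (t1 j hj).2⟩
        rcases min_choice (τ 17 j) (τ 17 o + c) with h | h <;> rw [h]
        · exact (t1 j hj).1
        · exact hGood j hj _ (t1 o hoN).1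
      · simpa [upd, hji, f17] using t1 j hj
    · by_cases hji : j = i
      · subst hji
        simp only [upd]
        simp only [show (17 : Fin 32) ≠ 5 by decide, false_and, if_false, and_self,
          if_true]
        exact (min_le_right _ _).trans (Nat.add_le_add_right (t1 o hoN).2 c)
      · simpa [upd, hji, f17] using t2 j (by omega)

end CoverScheme

/-! ### Dynamic programming for the cover numbers -/

namespace CoverScheme

open ArrayLang

variable {s : ℕ} (D : CoverScheme s)

/-- The number of blocks for a universe of `n` elements. -/
def blocks (n : ℕ) : ℕ := n / D.m + 1

theorem le_blocks (n : ℕ) : n ≤ D.m * D.blocks n := by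
  have := Nat.lt_mul_div_succ n D.m_pos
  rw [blocks]; omega

/-- Puts the number of blocks in variable `0`. -/
def blocksCmd : Cmd := set 0 (.input (.const 0) / .const D.m + .const 1)

/-- Puts the number of indices in variable `1`, and the code of the elements that are not in the
universe in variable `2`. -/
def setupCmd : Cmd :=
  .seq (set 1 (.const 1)) (.seq (set 25 (.const 1)) (.seq
    (.loop 6 (var 0) (.seq (set 1 (var 1 * .const D.R)) (set 25 (var 25 * .const (2 ^ D.m)))))
    (.seq (set 23 (.const 1)) (.seq (.loop 6 (.input (.const 0)) (set 23 (var 23 * .const 2)))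
      (set 2 (var 25 - var 23))))))

theorem spec_blocksCmd {I : ℕ → ℕ} {b n : ℕ} (hI : I 0 = n) (hbig : Nat.size (D.blocks n) ≤ b)
    (σ : Store) : Spec I b D.blocksCmd σ fun τ => τ 0 0 = D.blocks n := by
  refine Spec.set _ ?_ hbig (by simp [upd])
  simp only [eval_add, eval_div, eval_input, eval_const, Nat.zero_mod, hI]
  rfl

theorem spec_setupCmd {I : ℕ → ℕ} {b big n : ℕ} (hI : I 0 = n) (hbig : Nat.size big ≤ b)
    (σ : Store) (hσ : σ 0 0 = D.blocks n) (h1 : D.blocks n ≤ big)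
    (h2 : D.R ^ D.blocks n ≤ big) (h3 : 2 ^ (D.m * D.blocks n) ≤ big) :
    Spec I b D.setupCmd σ fun τ => τ 1 0 = D.R ^ D.blocks n ∧
      τ 2 0 = 2 ^ (D.m * D.blocks n) - 2 ^ n := by
  have fits : ∀ v ≤ big, Nat.size v ≤ b := fun v hv => (Nat.size_le_size hv).trans hbig
  have hone : 1 ≤ big := (Nat.one_le_pow _ _ D.R_pos).trans h2
  have hnr := D.le_blocks n
  generalize D.blocks n = r at *
  have hp1 : ∀ u ≤ r, D.R ^ u ≤ big := fun u hu => (Nat.pow_le_pow_right D.R_pos hu).trans h2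
  have hp2 : ∀ u ≤ D.m * r, 2 ^ u ≤ big := fun u hu =>
    (Nat.pow_le_pow_right (by norm_num) hu).trans h3
  refine Spec.seq (Spec.set 1 rfl (fits _ hone) (Spec.seq (Spec.set 1 rfl (fits _ hone) ?_)))
  refine Spec.seq (Spec.loop (fun u τ => τ 1 0 = D.R ^ u ∧ τ 25 0 = 2 ^ (D.m * u)) r
    (by simp [eval_var, upd, hσ]) (fits _ h1) (by simp [upd]) ?_ ?_)
  · rintro u hu τ ⟨t1, t2⟩ - -
    refine Spec.seq (Spec.set (D.R ^ (u + 1)) (by simp [eval_mul, eval_var, eval_const, t1,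
      pow_succ]) (fits _ (hp1 _ hu)) (Spec.set (2 ^ (D.m * (u + 1))) (by
        simp [eval_mul, eval_var, eval_const, t2, upd, mul_add, pow_add])
        (fits _ (hp2 _ (Nat.mul_le_mul_left _ hu))) (by simp [upd])))
  rintro τ ⟨t1, t2⟩
  refine Spec.seq (Spec.set 1 rfl (fits _ hone) ?_)
  refine Spec.seq (Spec.loop (fun u τ => τ 1 0 = D.R ^ r ∧ τ 25 0 = 2 ^ (D.m * r) ∧
    τ 23 0 = 2 ^ u) n (by simp [eval_input, eval_const, hI])
    (fits _ (Nat.lt_two_pow_self.le.trans (hp2 _ hnr))) (by simp [upd, t1, t2]) ?_ ?_)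
  · rintro u hu τ ⟨t1, t2, t3⟩ - -
    exact Spec.set (2 ^ (u + 1)) (by simp [eval_mul, eval_var, eval_const, t3, pow_succ])
      (fits _ (hp2 _ (by omega))) (by simp [upd, t1, t2])
  · rintro τ ⟨t1, t2, t3⟩
    exact Spec.set (2 ^ (D.m * r) - 2 ^ n) (by simp [eval_sub, eval_var, t2, t3])
      (fits _ ((Nat.sub_le _ _).trans h3)) (by simp [upd, t1])

/-- Computes for all indices `i` the least number `f i` of sets that cover the set of the index `i`,
or `n + 1` if there is no cover. -/
def coverNumbersCmd : Cmd :=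
  .seq (.loop 5 (var 1) (.assign 17 (var 5)
    ((.input (.const 0) + .const 1) * (.const 1 - (.const 1 - var 5)))))
    (.seq (set 3 (.const 0)) (.seq D.relaxCmd (.seq (set 3 (.const 1))
      (.loop 4 (.input (.const 2)) (.seq (set 2 (.input (.const 3 + var 4))) D.relaxCmd)))))

/-- The sets with numbers in `G` cover the part in `[n]` of the set with index `i`. -/
def Covers (code : ℕ → ℕ) (n : ℕ) (G : Finset ℕ) (i : ℕ) : Prop :=
  ∀ e < D.m * D.blocks n, D.Mem i e → n ≤ e ∨ ∃ x ∈ G, (code x).testBit e = true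

theorem testBit_complement {n k e : ℕ} (he : e < k) (hn : n ≤ k) :
    (2 ^ k - 2 ^ n).testBit e = decide (n ≤ e) := by
  obtain ⟨j, rfl⟩ := Nat.exists_eq_add_of_le hn
  rw [pow_add, show 2 ^ n * 2 ^ j - 2 ^ n = 2 ^ n * (2 ^ j - 1) by rw [Nat.mul_sub, mul_one],
    Nat.testBit_two_pow_mul, Nat.testBit_two_pow_sub_one]
  by_cases h : n ≤ e
  · simp [h]; omega
  · simp [h]

/-- Together with `Covers.insert` this is the recurrence of the dynamic program: whether the set `x`
is used is accounted for by passing to the difference. -/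
theorem Covers.erase {code : ℕ → ℕ} {n : ℕ} {G : Finset ℕ} {i x : ℕ} (h : D.Covers code n G i) :
    D.Covers code n (G.erase x) (D.diff (D.blocks n) (code x) i) := by
  intro e he hm
  rw [D.mem_diff he] at hm
  rcases h e he hm.1 with h' | ⟨y, hy, h'⟩
  · exact Or.inl h'
  · refine Or.inr ⟨y, Finset.mem_erase.2 ⟨?_, hy⟩, h'⟩
    rintro rfl
    simp [h'] at hm

theorem Covers.insert {code : ℕ → ℕ} {n : ℕ} {G : Finset ℕ} {i x : ℕ}
    (h : D.Covers code n G (D.diff (D.blocks n) (code x) i)) :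
    D.Covers code n (insert x G) i := by
  intro e he hm
  by_cases hx : (code x).testBit e = true
  · exact Or.inr ⟨x, Finset.mem_insert_self _ _, hx⟩
  · rcases h e he ((D.mem_diff he).2 ⟨hm, by simpa using hx⟩) with h' | ⟨y, hy, h'⟩
    · exact Or.inl h'
    · exact Or.inr ⟨y, Finset.mem_insert_of_mem hy, h'⟩

/-- The family is processed one set at a time, and after `k` sets the values are optimal among
subfamilies of the first `k`. An optimal subfamily either omits the current set, or the others cover
the difference. The elements of the last block outside `[n]` are removed at no cost by the first
pass. The value `n + 1` stands for infinity. -/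
theorem spec_coverNumbersCmd {I : ℕ → ℕ} {b big n ℓ : ℕ} (hI : I 0 = n) (hℓ : I 2 = ℓ)
    (code : ℕ → ℕ) (hcode : ∀ x < ℓ, I (3 + x) = code x ∧ code x ≤ big)
    (hbig : Nat.size big ≤ b) (σ : Store) (h1 : D.blocks n ≤ big)
    (h2 : D.R ^ D.blocks n ≤ big) (h3 : 2 ^ (D.m * D.blocks n) ≤ big) (h4 : n + 1 ≤ big)
    (h5 : ℓ ≤ big)
    (s0 : σ 0 0 = D.blocks n) (s1 : σ 1 0 = D.R ^ D.blocks n)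
    (s2 : σ 2 0 = 2 ^ (D.m * D.blocks n) - 2 ^ n) :
    Spec I b D.coverNumbersCmd σ fun τ => ∀ i < D.R ^ D.blocks n, τ 17 i ≤ n + 1 ∧
      (τ 17 i ≤ n → ∃ G ⊆ Finset.range ℓ, G.card ≤ τ 17 i ∧ D.Covers code n G i) ∧
      ∀ G ⊆ Finset.range ℓ, D.Covers code n G i → τ 17 i ≤ G.card := by
  have fits : ∀ v ≤ big, Nat.size v ≤ b := fun v hv => (Nat.size_le_size hv).trans hbig
  have hone : 1 ≤ big := (Nat.one_le_pow _ _ D.R_pos).trans h2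
  have hnr := D.le_blocks n
  set r := D.blocks n with hr
  set N := D.R ^ r with hN
  have hNpos : 0 < N := Nat.pow_pos D.R_pos
  let Good : ℕ → ℕ → ℕ → Prop := fun k i v => v ≤ n + 1 ∧
    (v ≤ n → ∃ G ⊆ Finset.range k, G.card ≤ v ∧ D.Covers code n G i)
  refine Spec.seq (Spec.mono (Spec.loop (fun k τ => ∀ i < k, τ 17 i = if i = 0 then 0 else n + 1)
    N (by simp [eval_var, s1]) (fits _ h2) (by simp) ?_ (fun τ h => h)) ?_)
  · rintro i hi τ t ti -
    refine Spec.assign i (if i = 0 then 0 else n + 1) (by rw [eval_var, ti]) ?_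
      (fits _ (by split_ifs <;> omega)) ?_
    · simp only [eval_mul, eval_add, eval_sub, eval_input, eval_const, eval_var, Nat.zero_mod,
        hI, ti]
      split_ifs with h
      · simp [h]
      · rw [show 1 - (1 - i) = 1 by omega, mul_one]
    · intro j hj
      by_cases hji : j = i
      · simp [upd, hji]
      · simpa [upd, hji] using t j (by omega)
  intro τ₁ t₁ fr₁
  have a0 : τ₁ 0 = σ 0 := fr₁ 0 rfl
  have a1 : τ₁ 1 = σ 1 := fr₁ 1 rfl
  have a2 : τ₁ 2 = σ 2 := fr₁ 2 rfl
  refine Spec.seq (Spec.set 0 rfl (fits _ (by omega)) ?_)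
  refine Spec.seq (Spec.mono (D.spec_relaxCmd hbig _ r (2 ^ (D.m * r) - 2 ^ n) 0
    (by simp [upd, a0, s0]) (by simp [upd, a1, s1, hN]) (by simp [upd, a2, s2]) (by simp [upd])
    h1 h2 ((Nat.sub_le _ _).trans h3) (Good 0) ?_ ?_) ?_)
  · intro i hi
    have : upd τ₁ 3 0 0 17 i = if i = 0 then 0 else n + 1 := by simp [upd, t₁ i hi]
    rw [this]
    split_ifs with h
    · refine ⟨Nat.zero_le _, Nat.zero_le _, fun _ => ⟨∅, by simp, by simp, fun e _ hm => ?_⟩⟩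
      rw [h] at hm
      exact absurd hm (D.not_mem_zero e)
    · exact ⟨h4, le_rfl, fun h => by omega⟩
  · rintro i hi v ⟨hv, h⟩
    refine ⟨hv, fun hv' => ?_⟩
    obtain ⟨G, hG, hc, hcov⟩ := h hv'
    refine ⟨G, hG, hc, fun e he hm => ?_⟩
    by_cases hne : n ≤ e
    · exact Or.inl hne
    · exact hcov e he ((D.mem_diff he).2 ⟨hm, by
        rw [testBit_complement (k := D.m * r) he hnr]; simpa using hne⟩)
  intro τ₂ t₂ fr₂
  have b0 : τ₂ 0 0 = r :=
    (congrFun (fr₂ 0 rfl) 0).trans (by simp [upd, a0, s0])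
  have b1 : τ₂ 1 0 = N :=
    (congrFun (fr₂ 1 rfl) 0).trans (by simp [upd, a1, s1])
  -- A set without elements of `[n]` has difference `0` in the first pass, and `f 0 = 0`.
  have c2 : ∀ i < N, D.Covers code n ∅ i → τ₂ 17 i ≤ 0 := by
    intro i hi hcov
    have h := (t₂ i hi).2.2
    rw [D.diff_eq_zero] at h
    · simpa [upd, t₁ 0 hNpos] using h
    · intro e he hm
      rw [testBit_complement he hnr]
      simpa using hcov e he hm
  refine Spec.seq (Spec.set 1 rfl (fits _ hone) ?_)
  refine Spec.loop (fun k τ => ∀ i < N, Good k i (τ 17 i) ∧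
    ∀ G ⊆ Finset.range k, D.Covers code n G i → τ 17 i ≤ G.card) ℓ
    (by
      simp only [eval_input, eval_const, hℓ]
      rw [Nat.mod_eq_of_lt (by omega), hℓ])
    (fits _ h5) ?_ ?_ (fun τ h i hi => ⟨(h i hi).1.1, (h i hi).1.2, (h i hi).2⟩)
  · intro i hi
    have e : upd (upd τ₂ 3 0 1) 4 0 0 17 i = τ₂ 17 i := by simp [upd]
    rw [e]
    refine ⟨(t₂ i hi).1, fun G hG hcov => ?_⟩
    obtain rfl : G = ∅ := by simpa using hG
    exact c2 i hi hcov
  · intro x hx τ t tx fr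
    have f0 : τ 0 = upd τ₂ 3 0 1 0 := fr 0 rfl
    have f1 : τ 1 = upd τ₂ 3 0 1 1 := fr 1 rfl
    have f3 : τ 3 = upd τ₂ 3 0 1 3 := fr 3 rfl
    refine Spec.seq (Spec.set (code x) ?_ (fits _ (hcode x hx).2) ?_)
    · simp only [eval_input, eval_add, eval_const, eval_var, tx, hℓ]
      rw [Nat.mod_eq_of_lt (by omega), (hcode x hx).1]
    refine Spec.mono (D.spec_relaxCmd hbig _ r (code x) 1 (by simp [upd, f0, b0])
      (by simp [upd, f1, b1]; rfl) (by simp [upd]) (by simp [upd, f3]) h1 h2 (hcode x hx).2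
      -- Adding `1` can push a value beyond `n + 1`, so the predicate admits all values from `n + 1`
      -- on. The bound `n + 1` is recovered afterwards since values never increase.
      (fun i v => 1 ≤ v ∧ n + 1 ≤ v ∨ Good (x + 1) i v) ?_ ?_) ?_
    · intro i hi
      have e : upd τ 2 0 (code x) 17 i = τ 17 i := by simp [upd]
      rw [e]
      obtain ⟨⟨g1, g2⟩, g3⟩ := t i hi
      refine ⟨g1.trans h4, Or.inr ⟨g1, fun h => ?_⟩⟩
      obtain ⟨G, hG, hc⟩ := g2 h
      exact ⟨G, hG.trans (Finset.range_subset_range.2 (by omega)), hc⟩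
    · rintro i hi v (h | ⟨g1, g2⟩)
      · exact Or.inl (by omega)
      · by_cases hv : v ≤ n
        · refine Or.inr ⟨by omega, fun _ => ?_⟩
          obtain ⟨G, hG, hc, hcov⟩ := g2 hv
          refine ⟨insert x G, ?_, (Finset.card_insert_le _ _).trans (by omega), hcov.insert⟩
          intro y hy
          rcases Finset.mem_insert.1 hy with rfl | hy
          · simp
          · exact hG hy
        · exact Or.inl (by omega)
    · intro τ' t' fr' i hi
      have e : ∀ i, upd τ 2 0 (code x) 17 i = τ 17 i := fun i => by simp [upd]
      have e' : ∀ i, upd τ' 4 0 (x + 1) 17 i = τ' 17 i := fun i => by simp [upd]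
      rw [e']
      obtain ⟨g1, g2, g3⟩ := t' i hi
      rw [e] at g2 g3
      refine ⟨?_, fun G hG hcov => ?_⟩
      · have := (t i hi).1.1
        rcases g1 with g1 | g1
        · exact ⟨by omega, fun h => by omega⟩
        · exact g1
      · by_cases hxG : x ∈ G
        · have h := (t (D.diff r (code x) i) (D.diff_lt _ _ _)).2 (G.erase x) ?_ hcov.erase
          · rw [Finset.card_erase_of_mem hxG] at h
            have := Finset.card_pos.2 ⟨x, hxG⟩
            omega
          · intro y hy
            have h1 := Finset.ne_of_mem_erase hy
            have h2 := Finset.mem_range.1 (hG (Finset.mem_of_mem_erase hy))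
            exact Finset.mem_range.2 (by omega)
        · refine g2.trans ((t i hi).2 G (fun y hy => ?_) hcov)
          have h2 := Finset.mem_range.1 (hG hy)
          have : y ≠ x := fun h => hxG (h ▸ hy)
          exact Finset.mem_range.2 (by omega)

end CoverScheme

/-! ### Sums over numbers given by their digits -/

theorem sum_range_mul {M : Type*} [AddCommMonoid M] (f : ℕ → M) (A B : ℕ) :
    ∑ i ∈ Finset.range (A * B), f i =
      ∑ y ∈ Finset.range B, ∑ x ∈ Finset.range A, f (x + A * y) := by
  induction B with
  | zero => simp
  | succ B ih =>
    rw [Nat.mul_succ, Finset.sum_range_add, ih, Finset.sum_range_succ]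
    simp only [add_comm]

theorem digit_add_of_lt {R u v : ℕ} (hR : 0 < R) (x y : ℕ) (hv : v < u) :
    digit R v (x + R ^ u * y) = digit R v x := by
  have h : R ^ u * y = R ^ v * (R * (R ^ (u - v - 1) * y)) := by
    rw [← mul_assoc, ← mul_assoc, ← pow_succ, ← pow_add]
    congr 2
    omega
  rw [digit, h, Nat.add_mul_div_left _ _ (by positivity), Nat.add_mul_mod_self_left, digit]

theorem digit_add_self {R u x y : ℕ} (hR : 0 < R) (hx : x < R ^ u) (hy : y < R) :
    digit R u (x + R ^ u * y) = y := by
  rw [digit, Nat.add_mul_div_left _ _ (by positivity), Nat.div_eq_of_lt hx, zero_add,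
    Nat.mod_eq_of_lt hy]

/-- The distributive law: a number below `R ^ r` is the same as a choice of one digit for each of
the `r` factors. -/
theorem sum_prod_digit {K : Type*} [CommSemiring K] {R : ℕ} (hR : 0 < R) (g : ℕ → ℕ → K)
    (r : ℕ) : ∑ i ∈ Finset.range (R ^ r), ∏ v ∈ Finset.range r, g v (digit R v i) =
      ∏ v ∈ Finset.range r, ∑ l ∈ Finset.range R, g v l := by
  induction r with
  | zero => simp
  | succ r ih =>
    rw [pow_succ, sum_range_mul, Finset.prod_range_succ, ← ih, Finset.mul_sum]
    refine Finset.sum_congr rfl fun y hy => ?_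
    rw [Finset.sum_mul]
    refine Finset.sum_congr rfl fun x hx => ?_
    rw [Finset.prod_range_succ, digit_add_self hR (Finset.mem_range.1 hx) (Finset.mem_range.1 hy)]
    congr 1
    exact Finset.prod_congr rfl fun v hv => by
      rw [digit_add_of_lt hR _ _ (Finset.mem_range.1 hv)]

/-! ### Fast multiplication by Kronecker powers of matrices -/

namespace CoverScheme

open ArrayLang

variable {s : ℕ} (D : CoverScheme s)

/-- The coefficient of the block tensor. -/
def coeff (d : ℕ → ℕ) : ZMod D.p :=
  ∑ l ∈ Finset.range D.R, D.mat 0 l (d 0) * D.mat 1 l (d 1) * D.mat 2 l (d 2)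

/-- Multiplication of three vectors of length `R ^ r` by the `r`-fold Kronecker powers of the three
matrices, after `u` of the `r` factors. Every factor rotates the digits of the indices. -/
def layer (r : ℕ) (w : ℕ → ℕ) : ℕ → ℕ → ℕ
  | 0, j => w j
  | u + 1, j => (∑ e ∈ Finset.range D.R,
      (D.mat (j / D.R ^ r) (j % D.R ^ r / (D.R ^ r / D.R)) e).val *
        layer r w u (j - j % D.R ^ r + j % D.R ^ r % (D.R ^ r / D.R) * D.R + e)) % D.p

/-- A step uses the top digit of `i` as the row of the matrix, moves the other digits up by one
position, and puts the summation variable in the lowest position. After `u` steps the top `u` digits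
of `i` have been paired with the digits of `x`, and the remaining ones sit above them. After `r`
steps the rotation is complete, and digits in equal positions are paired. -/
theorem cast_layer (r : ℕ) (w : ℕ → ℕ) (a : ℕ) (u : ℕ) (hu : u ≤ r) (i : ℕ)
    (hi : i < D.R ^ r) : (D.layer r w u (a * D.R ^ r + i) : ZMod D.p) =
      ∑ x ∈ Finset.range (D.R ^ u),
        (∏ v ∈ Finset.range u, D.mat a (digit D.R (r - u + v) i) (digit D.R v x)) *
          (w (a * D.R ^ r + (x + D.R ^ u * (i % D.R ^ (r - u)))) : ZMod D.p) := by
  have : NeZero D.p := ⟨D.prime.ne_zero⟩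
  induction u generalizing i with
  | zero => simp [layer, Nat.mod_eq_of_lt hi]
  | succ u ih =>
    obtain ⟨k, rfl⟩ : ∃ k, r = u + k + 1 := ⟨r - u - 1, by omega⟩
    set R := D.R with hR
    have hR0 : 0 < R := D.R_pos
    have hN0 : 0 < R ^ (u + k + 1) := Nat.pow_pos hR0
    have hq : R ^ (u + k + 1) / R = R ^ (u + k) := by
      rw [pow_succ, Nat.mul_div_cancel _ hR0]
    have hj1 : (a * R ^ (u + k + 1) + i) / R ^ (u + k + 1) = a := by
      rw [mul_comm, Nat.mul_add_div hN0, Nat.div_eq_of_lt hi, add_zero]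
    have hj2 : (a * R ^ (u + k + 1) + i) % R ^ (u + k + 1) = i := by
      rw [mul_comm, Nat.mul_add_mod, Nat.mod_eq_of_lt hi]
    have hi' : i / R ^ (u + k) < R := Nat.div_lt_of_lt_mul (by rwa [← pow_succ])
    rw [layer, ← hR, hj1, hj2, hq, ZMod.natCast_mod, Nat.cast_sum, pow_succ R u, sum_range_mul]
    refine Finset.sum_congr rfl fun e he => ?_
    have he := Finset.mem_range.1 he
    rw [Nat.add_sub_cancel, add_assoc (a * _), Nat.cast_mul, ZMod.natCast_val, ZMod.cast_id]
    set q := i % R ^ (u + k) with hqdef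
    have hqlt : q < R ^ (u + k) := Nat.mod_lt _ (Nat.pow_pos hR0)
    have hlt : q * R + e < R ^ (u + k + 1) := by
      rw [pow_succ]
      calc q * R + e < q * R + R := by omega
        _ = (q + 1) * R := by ring
        _ ≤ _ := Nat.mul_le_mul_right _ hqlt
    rw [ih (by omega) _ hlt, Finset.mul_sum]
    refine Finset.sum_congr rfl fun x hx => ?_
    have hx := Finset.mem_range.1 hx
    rw [Finset.prod_range_succ, digit_add_self hR0 hx he]
    have e1 : digit R (u + k + 1 - (u + 1) + u) i = i / R ^ (u + k) := by
      rw [digit, show u + k + 1 - (u + 1) + u = u + k by omega, Nat.mod_eq_of_lt hi']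
    have e2 : ∀ v ∈ Finset.range u, D.mat a (digit R (u + k + 1 - u + v) (q * R + e))
        (digit R v x) = D.mat a (digit R (u + k + 1 - (u + 1) + v) i)
        (digit R v (x + R ^ u * e)) := by
      intro v hv
      have hv := Finset.mem_range.1 hv
      rw [digit_add_of_lt hR0 _ _ hv]
      congr 1
      rw [digit, show u + k + 1 - u + v = (k + v) + 1 by omega, pow_succ, mul_comm (R ^ (k + v)),
        ← Nat.div_div_eq_div_mul, mul_comm q, Nat.mul_add_div hR0, Nat.div_eq_of_lt he, add_zero,
        show u + k + 1 - (u + 1) + v = k + v by omega]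
      conv_rhs => rw [← Nat.mod_add_div i (R ^ (u + k))]
      exact (digit_add_of_lt hR0 _ _ (by omega)).symm
    have e3 : x + R ^ u * ((q * R + e) % R ^ (u + k + 1 - u)) =
        x + R ^ u * e + R ^ (u + 1) * (i % R ^ (u + k + 1 - (u + 1))) := by
      rw [show u + k + 1 - u = k + 1 by omega, show u + k + 1 - (u + 1) = k by omega,
        pow_succ R k, mul_comm (R ^ k), mul_comm q, Nat.mod_mul, Nat.mul_add_mod,
        Nat.mod_eq_of_lt he, Nat.mul_add_div hR0, Nat.div_eq_of_lt he, add_zero, hqdef,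
        Nat.mod_mod_of_dvd _ (pow_dvd_pow R (show k ≤ u + k by omega))]
      ring
    rw [e1, Finset.prod_congr rfl e2, e3, pow_succ R u]
    ring

/-- The value of the `r`-th Kronecker power of the block tensor at three vectors. -/
def form (r : ℕ) (w : ℕ → ℕ → ZMod D.p) : ZMod D.p :=
  ∑ x ∈ Finset.range (D.R ^ r), ∑ y ∈ Finset.range (D.R ^ r), ∑ z ∈ Finset.range (D.R ^ r),
    (∏ v ∈ Finset.range r, D.coeff
      (fun a => if a = 0 then digit D.R v x else if a = 1 then digit D.R v y else digit D.R v z)) *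
      (w 0 x * w 1 y * w 2 z)

/-- The `r`-th power of a sum of `R` rank-one terms has `R ^ r` terms, indexed by `i`. The three
factors of the term `i` are the entries `i` of the final layers. Expanding them and exchanging the
sums reduces the identity to `sum_prod_digit`. -/
theorem sum_layer (r : ℕ) (w : ℕ → ℕ) :
    ∑ i ∈ Finset.range (D.R ^ r), ((D.layer r w r (0 * D.R ^ r + i) : ZMod D.p) *
      D.layer r w r (1 * D.R ^ r + i) * D.layer r w r (2 * D.R ^ r + i)) =
      D.form r (fun a i => (w (a * D.R ^ r + i) : ZMod D.p)) := by
  have h : ∀ a, ∀ i ∈ Finset.range (D.R ^ r), (D.layer r w r (a * D.R ^ r + i) : ZMod D.p) =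
      ∑ x ∈ Finset.range (D.R ^ r),
        (∏ v ∈ Finset.range r, D.mat a (digit D.R v i) (digit D.R v x)) *
          (w (a * D.R ^ r + x) : ZMod D.p) := by
    intro a i hi
    rw [D.cast_layer r w a r le_rfl i (Finset.mem_range.1 hi)]
    refine Finset.sum_congr rfl fun x _ => ?_
    simp [Nat.mod_one]
  have h3 : ∀ f g k : ℕ → ZMod D.p, ∀ S : Finset ℕ, (∑ x ∈ S, f x) * (∑ y ∈ S, g y) *
      (∑ z ∈ S, k z) = ∑ x ∈ S, ∑ y ∈ S, ∑ z ∈ S, f x * g y * k z := by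
    intro f g k S
    rw [Finset.sum_mul_sum, Finset.sum_mul]
    exact Finset.sum_congr rfl fun x _ => Finset.sum_mul_sum _ _ _ _
  rw [Finset.sum_congr rfl fun i hi => by rw [h 0 i hi, h 1 i hi, h 2 i hi, h3], form,
    Finset.sum_comm]
  refine Finset.sum_congr rfl fun x _ => ?_
  rw [Finset.sum_comm]
  refine Finset.sum_congr rfl fun y _ => ?_
  rw [Finset.sum_comm]
  refine Finset.sum_congr rfl fun z _ => ?_
  have h4 := sum_prod_digit D.R_pos (fun v l => D.mat 0 l (digit D.R v x) *
    D.mat 1 l (digit D.R v y) * D.mat 2 l (digit D.R v z)) r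
  simp only [coeff, if_true, one_ne_zero, if_false, show (2 : ℕ) ≠ 0 by norm_num,
    show (2 : ℕ) ≠ 1 by norm_num]
  rw [← h4, Finset.sum_mul]
  refine Finset.sum_congr rfl fun i _ => ?_
  rw [Finset.prod_mul_distrib, Finset.prod_mul_distrib]
  ring

end CoverScheme

/-! ### Program for the evaluation of the trilinear form -/

namespace CoverScheme

open ArrayLang

variable {s : ℕ} (D : CoverScheme s)

theorem layer_le {r B : ℕ} {w : ℕ → ℕ} (hw : ∀ j < 3 * D.R ^ r, w j ≤ B) (hB : D.p ≤ B)
    (u : ℕ) {j : ℕ} (hj : j < 3 * D.R ^ r) : D.layer r w u j ≤ B := by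
  cases u with
  | zero => exact hw j hj
  | succ u => exact (Nat.mod_lt _ D.prime.pos).le.trans hB

/-- The entry of a matrix, with the axis, row and column packed into one number. -/
def packedMat (j : ℕ) : ℕ := (D.mat (j / (D.R * D.R)) (j / D.R % D.R) (j % D.R)).val

theorem packedMat_eq {a l e : ℕ} (hl : l < D.R) (he : e < D.R) :
    D.packedMat ((a * D.R + l) * D.R + e) = (D.mat a l e).val := by
  have h1 : ((a * D.R + l) * D.R + e) / D.R = a * D.R + l := by
    rw [mul_comm, Nat.mul_add_div D.R_pos, Nat.div_eq_of_lt he, add_zero]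
  rw [packedMat, ← Nat.div_div_eq_div_mul, h1]
  congr 1
  · rw [mul_comm a, Nat.mul_add_div D.R_pos, Nat.div_eq_of_lt hl, add_zero, Nat.mul_add_mod,
      Nat.mod_eq_of_lt hl, mul_comm, Nat.mul_add_mod, Nat.mod_eq_of_lt he]

/-- The computation of one entry of the next layer; `20` is the number of the entry, `22` is the
accumulator. The layers are stored one after the other in the array `19`. -/
def layerRound : Cmd :=
  .seq (set 22 (.const 0)) (.seq
    (.loop 21 (.const D.R) (set 22 (var 22 + .table (3 * (D.R * D.R)) D.packedMat
        (((var 20 / var 1) % .const 3 * .const D.R + var 20 % var 1 / (var 1 / .const D.R)) *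
          .const D.R + var 21) *
      .arr 19 (var 20 - var 20 % var 1 + var 20 % var 1 % (var 1 / .const D.R) * .const D.R +
        var 21))))
    (.assign 19 (.const 3 * var 1 + var 20) (var 22 % .const D.p)))

/-- The computation of the value of the form at the vectors in the first `3 * R ^ r` entries of the
array `19`. -/
def formCmd : Cmd :=
  .seq (.loop 20 (.const 3 * var 1 * var 0) D.layerRound) (.seq (set 14 (.const 0))
    (.loop 5 (var 1) (set 14 ((var 14 + .arr 19 (.const 3 * var 1 * var 0 + var 5) *
      .arr 19 (.const 3 * var 1 * var 0 + var 1 + var 5) *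
      .arr 19 (.const 3 * var 1 * var 0 + .const 2 * var 1 + var 5)) % .const D.p))))

theorem spec_layerRound {I : ℕ → ℕ} {b big : ℕ} (hbig : Nat.size big ≤ b) (τ : Store)
    (r : ℕ) (w : ℕ → ℕ) (hr : 0 < r) (h1 : τ 1 0 = D.R ^ r) (h3 : D.R * D.p ^ 2 ≤ big)
    (hw : ∀ j < 3 * D.R ^ r, w j ≤ D.p) (u j : ℕ) (hj : j < 3 * D.R ^ r)
    (hτ : τ 20 0 = u * (3 * D.R ^ r) + j)
    (hV : ∀ k < 3 * D.R ^ r, u * (3 * D.R ^ r) + k < 3 * D.R ^ r + (u * (3 * D.R ^ r) + j) →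
      τ 19 (u * (3 * D.R ^ r) + k) = D.layer r w u k) :
    Spec I b D.layerRound τ fun τ' => (∀ i, i ≠ (u + 1) * (3 * D.R ^ r) + j →
      τ' 19 i = τ 19 i) ∧ τ' 19 ((u + 1) * (3 * D.R ^ r) + j) = D.layer r w (u + 1) j := by
  have fits : ∀ v ≤ big, Nat.size v ≤ b := fun v hv => (Nat.size_le_size hv).trans hbig
  have hp : 0 < D.p := D.prime.pos
  have : NeZero D.p := ⟨hp.ne'⟩
  set R := D.R with hR
  have hR0 : 0 < R := D.R_pos
  set N := R ^ r with hN
  have hN0 : 0 < N := Nat.pow_pos hR0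
  have hRbig : R ≤ big := (Nat.le_mul_of_pos_right R (by positivity)).trans h3
  have hNR : N / R * R = N := Nat.div_mul_cancel (dvd_pow_self R hr.ne')
  have hq0 : 0 < N / R := Nat.pos_of_mul_pos_right (by rw [hNR]; exact hN0)
  have hjmod : (u * (3 * N) + j) % N = j % N := by
    rw [← mul_assoc, Nat.mul_add_mod_self_right]
  have hjdiv : (u * (3 * N) + j) / N % 3 = j / N := by
    rw [← mul_assoc, add_comm, Nat.add_mul_div_right _ _ hN0, Nat.add_mul_mod_self_right,
      Nat.mod_eq_of_lt (Nat.div_lt_of_lt_mul (by omega))]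
  have hjle : j % N ≤ j := Nat.mod_le _ _
  have hjm : j % N < N := Nat.mod_lt _ hN0
  have hl : j % N / (N / R) < R := Nat.div_lt_of_lt_mul (by rw [hNR]; exact hjm)
  have hidx : ∀ e < R, j % N % (N / R) * R + e < N := by
    intro e he
    have : j % N % (N / R) < N / R := Nat.mod_lt _ hq0
    calc _ < j % N % (N / R) * R + R := by omega
      _ = (j % N % (N / R) + 1) * R := by ring
      _ ≤ N / R * R := Nat.mul_le_mul_right _ this
      _ = N := hNR
  have hjN : j / N < 3 := Nat.div_lt_of_lt_mul (by omega)
  have hjNle : j - j % N + N ≤ 3 * N := by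
    have h5 := Nat.div_add_mod j N
    have h6 : N * (j / N) ≤ N * 2 := Nat.mul_le_mul_left _ (by omega)
    omega
  let term : ℕ → ℕ := fun e => (D.mat (j / N) (j % N / (N / R)) e).val *
    D.layer r w u (j - j % N + j % N % (N / R) * R + e)
  have hterm : ∀ k ≤ R, ∑ e ∈ Finset.range k, term e ≤ big := by
    intro k hk
    refine le_trans ?_ h3
    calc _ ≤ ∑ e ∈ Finset.range k, D.p ^ 2 := by
          refine Finset.sum_le_sum fun e he => ?_
          rw [sq]
          have he := Finset.mem_range.1 he
          have := hidx e (by omega)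
          have hlt : j - j % N + j % N % (N / R) * R + e < 3 * N := by omega
          exact Nat.mul_le_mul (ZMod.val_lt _).le (D.layer_le hw le_rfl u hlt)
      _ = k * D.p ^ 2 := by simp
      _ ≤ _ := Nat.mul_le_mul_right _ hk
  refine Spec.seq (Spec.set 0 rfl (fits _ (by omega)) ?_)
  refine Spec.seq (Spec.mono (Spec.loop (fun k ρ => ρ 22 0 = ∑ e ∈ Finset.range k, term e)
    R rfl (fits _ hRbig) (by simp [upd]) ?_ (fun _ h => h)) ?_)
  · rintro e he ρ t te fr
    have f1 : ρ 1 = τ 1 := (fr 1 rfl).trans (upd_ne _ _ _ (by decide))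
    have f20 : ρ 20 = τ 20 := (fr 20 rfl).trans (upd_ne _ _ _ (by decide))
    have f19 : ρ 19 = τ 19 := (fr 19 rfl).trans (upd_ne _ _ _ (by decide))
    refine Spec.set (∑ e ∈ Finset.range (e + 1), term e) ?_ (fits _ (hterm _ he)) (by simp [upd])
    simp only [eval_add, eval_sub, eval_mul, eval_div, eval_mod, eval_var, eval_arr, eval_const,
      eval_table, f1, f20, f19, h1, hτ, t, te, ← hR, hjmod, hjdiv]
    have hlt : (j / N * R + j % N / (N / R)) * R + e < 3 * (R * R) := by
      have e1 : j / N * R + j % N / (N / R) + 1 ≤ 3 * R := by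
        calc _ ≤ j / N * R + R := by omega
          _ = (j / N + 1) * R := by ring
          _ ≤ _ := Nat.mul_le_mul_right _ hjN
      calc _ < (j / N * R + j % N / (N / R)) * R + R := by omega
        _ = (j / N * R + j % N / (N / R) + 1) * R := by ring
        _ ≤ 3 * R * R := Nat.mul_le_mul_right _ e1
        _ = _ := by ring
    rw [if_pos hlt, D.packedMat_eq hl he, Finset.sum_range_succ]
    have hi := hidx e he
    rw [show u * (3 * N) + j - j % N + j % N % (N / R) * R + e =
      u * (3 * N) + (j - j % N + j % N % (N / R) * R + e) by omega, hV _ (by omega) (by omega)]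
  · intro ρ t fr
    have f1 : ρ 1 = τ 1 := (fr 1 rfl).trans (upd_ne _ _ _ (by decide))
    have f20 : ρ 20 = τ 20 := (fr 20 rfl).trans (upd_ne _ _ _ (by decide))
    have f19 : ρ 19 = τ 19 := (fr 19 rfl).trans (upd_ne _ _ _ (by decide))
    refine Spec.assign ((u + 1) * (3 * N) + j) (D.layer r w (u + 1) j) ?_ ?_ (fits _ ?_) ?_
    · simp only [eval_add, eval_mul, eval_const, eval_var, f1, f20, h1, hτ]
      ring
    · simp only [eval_mod, eval_var, eval_const, t]
      rfl
    · exact (D.layer_le hw le_rfl _ hj).trans ((Nat.le_self_pow (by norm_num) _).trans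
        ((Nat.le_mul_of_pos_left _ hR0).trans h3))
    · refine ⟨fun i hi => ?_, upd_same _ _ _ _⟩
      rw [upd_apply, if_neg hi, f19]

theorem spec_formCmd {I : ℕ → ℕ} {b big : ℕ} (hbig : Nat.size big ≤ b) (σ : Store)
    (r : ℕ) (w : ℕ → ℕ) (hr : 0 < r) (h0 : σ 0 0 = r) (h1 : σ 1 0 = D.R ^ r)
    (h2 : 3 * D.R ^ r * r ≤ big) (h3 : D.R * D.p ^ 2 ≤ big)
    (hw : ∀ j < 3 * D.R ^ r, w j ≤ D.p) (hV : ∀ j < 3 * D.R ^ r, σ 19 j = w j) :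
    Spec I b D.formCmd σ fun τ => τ 14 0 < D.p ∧
      (τ 14 0 = 0 ↔ D.form r (fun a i => (w (a * D.R ^ r + i) : ZMod D.p)) = 0) := by
  have fits : ∀ v ≤ big, Nat.size v ≤ b := fun v hv => (Nat.size_le_size hv).trans hbig
  have hp : 0 < D.p := D.prime.pos
  have hN0 : 0 < D.R ^ r := Nat.pow_pos D.R_pos
  have hNbig : D.R ^ r ≤ big :=
    (by nlinarith : D.R ^ r ≤ 3 * D.R ^ r * r).trans h2
  have hpbig : D.p ≤ big := (Nat.le_self_pow (by norm_num : 2 ≠ 0) _).trans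
    ((Nat.le_mul_of_pos_left _ D.R_pos).trans h3)
  -- Layer `u` starts at position `3 * R ^ r * u`. After `k` steps the positions below `3 * R ^ r +
  -- k` are filled, where the first summand is layer `0`.
  refine Spec.seq (Spec.mono (Spec.loop (fun k τ => ∀ u j, j < 3 * D.R ^ r →
      u * (3 * D.R ^ r) + j < 3 * D.R ^ r + k →
      τ 19 (u * (3 * D.R ^ r) + j) = D.layer r w u j) (3 * D.R ^ r * r)
    (by simp [eval_mul, eval_const, eval_var, h0, h1]) (fits _ h2) ?_ ?_ (fun τ h => h)) ?_)
  · intro u j hj hlt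
    obtain rfl : u = 0 := by
      by_contra hu
      have : 3 * D.R ^ r ≤ u * (3 * D.R ^ r) := Nat.le_mul_of_pos_left _ (Nat.pos_of_ne_zero hu)
      omega
    simpa [upd, layer] using hV j hj
  · intro k hk τ t tk fr
    have f1 : τ 1 = σ 1 := fr 1 rfl
    have hk' := Nat.div_add_mod' k (3 * D.R ^ r)
    have hkm : k % (3 * D.R ^ r) < 3 * D.R ^ r := Nat.mod_lt _ (by omega)
    refine Spec.mono (D.spec_layerRound hbig τ r w hr (by rw [f1, h1]) h3 hw
      (k / (3 * D.R ^ r)) (k % (3 * D.R ^ r)) hkm (by rw [tk, hk'])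
      (fun i hi hlt => t _ i hi (by rw [hk'] at hlt; exact hlt))) ?_
    rintro τ' ⟨g1, g2⟩ -
    intro u j hj hlt
    rw [upd_ne _ _ _ (by decide)]
    by_cases he : u * (3 * D.R ^ r) + j =
        (k / (3 * D.R ^ r) + 1) * (3 * D.R ^ r) + k % (3 * D.R ^ r)
    · have hu : u = k / (3 * D.R ^ r) + 1 := by
        have := congrArg (· / (3 * D.R ^ r)) he
        simp only [mul_comm _ (3 * D.R ^ r)] at this
        rwa [Nat.mul_add_div (by omega), Nat.mul_add_div (by omega), Nat.div_eq_of_lt hj,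
          Nat.div_eq_of_lt hkm, add_zero, add_zero] at this
      have hj' : j = k % (3 * D.R ^ r) := by subst hu; omega
      rw [hu, hj']
      exact g2
    · rw [g1 _ he]
      refine t u j hj ?_
      rw [add_mul, one_mul] at he
      omega
  intro τ t fr
  have f0 : τ 0 = σ 0 := fr 0 rfl
  have f1 : τ 1 = σ 1 := fr 1 rfl
  refine Spec.seq (Spec.set 0 rfl (fits _ (by omega)) ?_)
  refine Spec.loop (fun k ρ => ρ 14 0 < D.p ∧ (ρ 14 0 : ZMod D.p) = ∑ i ∈ Finset.range k,
    ((D.layer r w r (0 * D.R ^ r + i) : ZMod D.p) *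
      D.layer r w r (1 * D.R ^ r + i) * D.layer r w r (2 * D.R ^ r + i))) (D.R ^ r)
    (by simp [eval_var, upd, f1, h1]) (fits _ hNbig) (by simp [upd, hp]) ?_ ?_
  · rintro i hi ρ ⟨t1, t2⟩ ti fr'
    have e0 : ρ 0 0 = r := by
      rw [fr' 0 rfl, upd_ne _ _ _ (by decide), f0, h0]
    have e1 : ρ 1 0 = D.R ^ r := by
      rw [fr' 1 rfl, upd_ne _ _ _ (by decide), f1, h1]
    have e19 : ρ 19 = τ 19 := (fr' 19 rfl).trans (upd_ne _ _ _ (by decide))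
    have hl : ∀ j < 3 * D.R ^ r, τ 19 (3 * D.R ^ r * r + j) = D.layer r w r j := by
      intro j hj
      rw [mul_comm _ r]
      exact t r j hj (by rw [mul_comm]; omega)
    refine Spec.set _ rfl (fits _ ?_) ?_
    · rw [eval_mod]
      exact (Nat.mod_lt _ hp).le.trans hpbig
    · simp only [eval_add, eval_mul, eval_mod, eval_var, eval_arr, eval_const, e0, e1, e19, ti]
      rw [upd_ne _ _ _ (by decide), upd_same, add_assoc (3 * D.R ^ r * r),
        add_assoc (3 * D.R ^ r * r), hl i (by omega),
        hl (D.R ^ r + i) (by omega), hl (2 * D.R ^ r + i) (by omega)]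
      refine ⟨Nat.mod_lt _ hp, ?_⟩
      rw [ZMod.natCast_mod, Finset.sum_range_succ, ← t2, zero_mul, zero_add, one_mul]
      push_cast
      ring
  · rintro ρ ⟨t1, t2⟩
    rw [D.sum_layer] at t2
    refine ⟨t1, ?_⟩
    rw [← t2, ZMod.natCast_eq_zero_iff]
    exact ⟨fun h => by simp [h], fun h => Nat.eq_zero_of_dvd_of_lt h t1⟩

end CoverScheme

/-! ### Search over experiments and budgets -/

namespace CoverScheme

open ArrayLang

variable {s : ℕ} (D : CoverScheme s)

/-- The numbers of sets that the three parts of the universe may use. -/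
def quota (T j₁ j₂ a : ℕ) : ℕ := if a = 0 then j₁ else if a = 1 then j₂ else T - (j₁ + j₂)

/-- Three concatenated vectors of length `N`: the weight of an index `i` is kept in the vector number
`a` if `f i` is at most the quota of `a`. -/
def query (N T : ℕ) (f W : ℕ → ℕ) (ρ j₁ j₂ j : ℕ) : ℕ :=
  W (ρ * (3 * N) + j) * ((1 - (f (j % N) - quota T j₁ j₂ (j / N))) * (1 - (j₁ + j₂ - T)))

/-- The form does not vanish at the three vectors. -/
def Hit (r T : ℕ) (f W : ℕ → ℕ) (ρ j₁ j₂ : ℕ) : Prop :=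
  D.form r (fun a i => (query (D.R ^ r) T f W ρ j₁ j₂ (a * D.R ^ r + i) : ZMod D.p)) ≠ 0

/-- Writes the three vectors to the array `19`. Variables: `11`, `12` and `13` are the number of the
experiment and the first two quotas, the array `16` contains all quotas, and the arrays `17` and `18`
contain `f` and the weights. -/
def queryCmd : Cmd :=
  .seq (.assign 16 (.const 0) (var 12)) (.seq (.assign 16 (.const 1) (var 13))
    (.seq (.assign 16 (.const 2) (.input (.const 1) - (var 12 + var 13)))
      (.loop 20 (.const 3 * var 1) (.assign 19 (var 20)
        (.arr 18 (var 11 * (.const 3 * var 1) + var 20) *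
          ((.const 1 - (.arr 17 (var 20 % var 1) - .arr 16 (var 20 / var 1))) *
            (.const 1 - (var 12 + var 13 - .input (.const 1)))))))))

/-- One evaluation of the form; variable `15` becomes `1` if the value is not zero. -/
def queryRound : Cmd :=
  .seq queryCmd (.seq D.formCmd (set 15 (.const 1 - (.const 1 - (var 15 + var 14)))))

/-- Nine experiments, each with all possible quotas. -/
def searchCmd : Cmd :=
  .seq (set 15 (.const 0)) (.loop 11 (.const 9) (.loop 12 (.input (.const 1) + .const 1)
    (.loop 13 (.input (.const 1) + .const 1) D.queryRound)))

theorem query_le_one {N T : ℕ} {f W : ℕ → ℕ} {ρ : ℕ} (hρ : ρ < 9) (hW : ∀ j < 27 * N, W j ≤ 1)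
    (j₁ j₂ : ℕ) {j : ℕ} (hj : j < 3 * N) : query N T f W ρ j₁ j₂ j ≤ 1 := by
  have h1 : ρ * (3 * N) ≤ 8 * (3 * N) := Nat.mul_le_mul_right _ (by omega)
  have h2 := hW (ρ * (3 * N) + j) (by omega)
  calc _ ≤ 1 * (1 * 1) := Nat.mul_le_mul h2 (Nat.mul_le_mul (Nat.sub_le _ _) (Nat.sub_le _ _))
    _ = 1 := rfl

theorem spec_queryRound {I : ℕ → ℕ} {b big : ℕ} (hbig : Nat.size big ≤ b) (σ : Store)
    (r T ρ j₁ j₂ : ℕ) (hT : I 1 = T) (hr : 0 < r) (h0 : σ 0 0 = r) (h1 : σ 1 0 = D.R ^ r)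
    (h2 : 3 * D.R ^ r * r ≤ big) (h3 : D.R * D.p ^ 2 ≤ big) (hTbig : T ≤ big)
    (hj₁ : j₁ ≤ big) (hj₂ : j₂ ≤ big) (hρ : ρ < 9) (hW : ∀ j < 27 * D.R ^ r, σ 18 j ≤ 1)
    (s11 : σ 11 0 = ρ) (s12 : σ 12 0 = j₁) (s13 : σ 13 0 = j₂) (s15 : σ 15 0 ≤ 1) :
    Spec I b D.queryRound σ fun τ => τ 15 0 ≤ 1 ∧
      (τ 15 0 = 1 ↔ σ 15 0 = 1 ∨ D.Hit r T (σ 17) (σ 18) ρ j₁ j₂) := by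
  have fits : ∀ v ≤ big, Nat.size v ≤ b := fun v hv => (Nat.size_le_size hv).trans hbig
  have hp : 0 < D.p := D.prime.pos
  have hN0 : 0 < D.R ^ r := Nat.pow_pos D.R_pos
  have h3N : 3 * D.R ^ r ≤ big := (Nat.le_mul_of_pos_right _ hr).trans h2
  have hI1 : I (1 % (I 2 + 3)) = T := by rw [Nat.mod_eq_of_lt (by omega), hT]
  have hq : ∀ j < 3 * D.R ^ r, query (D.R ^ r) T (σ 17) (σ 18) ρ j₁ j₂ j ≤ 1 :=
    fun j hj => query_le_one hρ hW j₁ j₂ hj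
  have hquery : Spec I b queryCmd σ fun τ => ∀ j < 3 * D.R ^ r,
      τ 19 j = query (D.R ^ r) T (σ 17) (σ 18) ρ j₁ j₂ j := by
    refine Spec.seq (Spec.assign 0 j₁ rfl s12 (fits _ hj₁) ?_)
    refine Spec.seq (Spec.assign 1 j₂ rfl (by simp [eval_var, upd, s13]) (fits _ hj₂) ?_)
    refine Spec.seq (Spec.assign 2 (T - (j₁ + j₂)) rfl (by
      simp [eval_sub, eval_add, eval_input, eval_const, eval_var, upd, s12, s13, hT])
      (fits _ ((Nat.sub_le _ _).trans hTbig)) ?_)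
    refine Spec.loop (fun k τ => ∀ j < k, τ 19 j = query (D.R ^ r) T (σ 17) (σ 18) ρ j₁ j₂ j)
      (3 * D.R ^ r) (by simp [eval_mul, eval_const, eval_var, upd, h1]) (fits _ h3N)
      (by simp) ?_ (fun _ h => h)
    intro k hk τ t tk fr
    have f1 : τ 1 0 = D.R ^ r := by rw [fr 1 rfl]; simp [upd, h1]
    have f11 : τ 11 0 = ρ := by rw [fr 11 rfl]; simp [upd, s11]
    have f12 : τ 12 0 = j₁ := by rw [fr 12 rfl]; simp [upd, s12]
    have f13 : τ 13 0 = j₂ := by rw [fr 13 rfl]; simp [upd, s13]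
    have f17 : τ 17 = σ 17 := by rw [fr 17 rfl]; funext i; simp [upd]
    have f18 : τ 18 = σ 18 := by rw [fr 18 rfl]; funext i; simp [upd]
    have f16 : ∀ a < 3, τ 16 a = quota T j₁ j₂ a := by
      intro a ha
      rw [fr 16 rfl]
      interval_cases a <;> simp [upd, quota]
    have hk3 : k / D.R ^ r < 3 := Nat.div_lt_of_lt_mul (by omega)
    refine Spec.assign k (query (D.R ^ r) T (σ 17) (σ 18) ρ j₁ j₂ k) (by rw [eval_var, tk]) ?_
      (fits _ ((hq k hk).trans (by omega))) ?_
    · simp only [eval_add, eval_sub, eval_mul, eval_div, eval_mod, eval_var, eval_arr,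
        eval_const, eval_input, hI1, tk, f1, f11, f12, f13, f17, f18, f16 _ hk3]
      rfl
    · intro j hj
      by_cases hjk : j = k
      · simp [upd, hjk]
      · simpa [upd, hjk] using t j (by omega)
  refine Spec.seq (Spec.mono hquery ?_)
  intro τ t fr
  have f0 : τ 0 = σ 0 := fr 0 rfl
  have f1 : τ 1 = σ 1 := fr 1 rfl
  have f15 : τ 15 = σ 15 := fr 15 rfl
  refine Spec.seq (Spec.mono (D.spec_formCmd hbig τ r
    (query (D.R ^ r) T (σ 17) (σ 18) ρ j₁ j₂) hr (by rw [f0, h0]) (by rw [f1, h1]) h2 h3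
    (fun j hj => (hq j hj).trans hp) t) ?_)
  rintro τ' ⟨-, t2⟩ fr'
  have e15 : τ' 15 = σ 15 := (fr' 15 rfl).trans f15
  refine Spec.set (1 - (1 - (σ 15 0 + τ' 14 0))) (by
    simp only [eval_sub, eval_add, eval_const, eval_var, e15]) (fits _ (by omega)) ?_
  rw [upd_same, Hit, Ne, ← t2]
  omega

theorem spec_searchCmd {I : ℕ → ℕ} {b big : ℕ} (hbig : Nat.size big ≤ b) (σ : Store)
    (r T : ℕ) (hT : I 1 = T) (hr : 0 < r) (h0 : σ 0 0 = r) (h1 : σ 1 0 = D.R ^ r)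
    (h2 : 3 * D.R ^ r * r ≤ big) (h3 : D.R * D.p ^ 2 ≤ big) (hTbig : T + 1 ≤ big)
    (h9 : 9 ≤ big) (hW : ∀ j < 27 * D.R ^ r, σ 18 j ≤ 1) :
    Spec I b D.searchCmd σ fun τ => τ 15 0 ≤ 1 ∧
      (τ 15 0 = 1 ↔ ∃ ρ < 9, ∃ j₁ ≤ T, ∃ j₂ ≤ T, D.Hit r T (σ 17) (σ 18) ρ j₁ j₂) := by
  have fits : ∀ v ≤ big, Nat.size v ≤ b := fun v hv => (Nat.size_le_size hv).trans hbig
  refine Spec.seq (Spec.set 0 rfl (fits _ (by omega)) ?_)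
  refine Spec.loop (fun k τ => τ 15 0 ≤ 1 ∧ (τ 15 0 = 1 ↔ ∃ ρ < k, ∃ j₁ ≤ T, ∃ j₂ ≤ T,
    D.Hit r T (σ 17) (σ 18) ρ j₁ j₂)) 9 rfl (fits _ h9) (by simp [upd]) ?_ (fun _ h => h)
  rintro ρ hρ τ ⟨t1, t2⟩ tk fr
  refine Spec.loop (fun k τ' => τ' 15 0 ≤ 1 ∧ (τ' 15 0 = 1 ↔ τ 15 0 = 1 ∨ ∃ j₁ < k, ∃ j₂ ≤ T,
    D.Hit r T (σ 17) (σ 18) ρ j₁ j₂)) (T + 1)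
    (by simp [eval_add, eval_input, eval_const, hT]) (fits _ hTbig) (by simpa [upd] using t1) ?_ ?_
  · rintro j₁ hj₁ τ' ⟨t1', t2'⟩ tk' fr'
    refine Spec.loop (fun k τ'' => τ'' 15 0 ≤ 1 ∧ (τ'' 15 0 = 1 ↔ τ' 15 0 = 1 ∨ ∃ j₂ < k,
      D.Hit r T (σ 17) (σ 18) ρ j₁ j₂)) (T + 1)
      (by simp [eval_add, eval_input, eval_const, hT]) (fits _ hTbig)
      (by simpa [upd] using t1') ?_ ?_
    · rintro j₂ hj₂ τ'' ⟨t1'', t2''⟩ tk'' fr''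
      have g0 : τ'' 0 = σ 0 := (fr'' 0 rfl).trans ((fr' 0 rfl).trans
        ((fr 0 rfl).trans (upd_ne _ _ _ (by decide))))
      have g1 : τ'' 1 = σ 1 := (fr'' 1 rfl).trans ((fr' 1 rfl).trans
        ((fr 1 rfl).trans (upd_ne _ _ _ (by decide))))
      have g17 : τ'' 17 = σ 17 := (fr'' 17 rfl).trans ((fr' 17 rfl).trans
        ((fr 17 rfl).trans (upd_ne _ _ _ (by decide))))
      have g18 : τ'' 18 = σ 18 := (fr'' 18 rfl).trans ((fr' 18 rfl).trans
        ((fr 18 rfl).trans (upd_ne _ _ _ (by decide))))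
      have g12 : τ'' 12 0 = j₁ := by rw [fr'' 12 rfl, tk']
      have g11 : τ'' 11 0 = ρ := by rw [fr'' 11 rfl, fr' 11 rfl, tk]
      refine Spec.mono (D.spec_queryRound hbig τ'' r T ρ j₁ j₂ hT hr (by rw [g0, h0])
        (by rw [g1, h1]) h2 h3 (by omega) (by omega) (by omega) hρ (by rw [g18]; exact hW)
        g11 g12 tk'' t1'') ?_
      rintro ω ⟨w1, w2⟩ -
      rw [upd_ne _ _ _ (by decide)]
      refine ⟨w1, ?_⟩
      rw [w2, t2'', g17, g18, or_assoc]
      refine or_congr Iff.rfl ⟨?_, ?_⟩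
      · rintro (⟨j, hj, h⟩ | h)
        · exact ⟨j, by omega, h⟩
        · exact ⟨j₂, by omega, h⟩
      · rintro ⟨j, hj, h⟩
        rcases Nat.lt_succ_iff_lt_or_eq.1 hj with hj | rfl
        · exact Or.inl ⟨j, hj, h⟩
        · exact Or.inr h
    · rintro ω ⟨w1, w2⟩
      rw [upd_ne _ _ _ (by decide)]
      refine ⟨w1, ?_⟩
      rw [w2, t2', or_assoc]
      refine or_congr Iff.rfl ⟨?_, ?_⟩
      · rintro (⟨j, hj, h⟩ | ⟨j, hj, h⟩)
        · exact ⟨j, by omega, h⟩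
        · exact ⟨j₁, by omega, j, by omega, h⟩
      · rintro ⟨j, hj, j', hj', h⟩
        rcases Nat.lt_succ_iff_lt_or_eq.1 hj with hj | rfl
        · exact Or.inl ⟨j, hj, j', hj', h⟩
        · exact Or.inr ⟨j', by omega, h⟩
  · rintro ω ⟨w1, w2⟩
    rw [upd_ne _ _ _ (by decide)]
    refine ⟨w1, ?_⟩
    rw [w2, t2]
    refine ⟨?_, ?_⟩
    · rintro (⟨j, hj, h⟩ | ⟨j, hj, j', hj', h⟩)
      · exact ⟨j, by omega, h⟩
      · exact ⟨ρ, by omega, j, by omega, j', hj', h⟩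
    · rintro ⟨j, hj, j₁, hj₁, h⟩
      rcases Nat.lt_succ_iff_lt_or_eq.1 hj with hj | rfl
      · exact Or.inl ⟨j, hj, j₁, hj₁, h⟩
      · exact Or.inr ⟨j₁, by omega, h⟩

end CoverScheme

/-! ### Random zero-one vectors and multilinear forms -/

/-- The sum of the `c i` over the `i` that are chosen by `b`. -/
def chosenSum {ι A : Type*} [Fintype ι] [AddCommGroup A] (c : ι → A) (b : ι → Bool) : A :=
  ∑ i, if b i then c i else 0

/-- Flipping the choice at `i₀` changes the sum by `c i₀` or its negative, so it maps the choices
with sum zero injectively to choices with nonzero sum. This needs no large field, and `A` may be a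
group of functions, which allows iteration. -/
theorem two_pow_le_card_chosenSum_ne_zero {ι A : Type*} [Fintype ι] [DecidableEq ι]
    [AddCommGroup A] [DecidableEq A] (c : ι → A) (i₀ : ι) (h : c i₀ ≠ 0) :
    Fintype.card (ι → Bool) ≤ 2 * (Finset.univ.filter fun b => chosenSum c b ≠ 0).card := by
  have hflip : (Finset.univ.filter fun b => ¬ chosenSum c b ≠ 0).card ≤
      (Finset.univ.filter fun b => chosenSum c b ≠ 0).card := by
    refine Finset.card_le_card_of_injOn (fun b => Function.update b i₀ (!b i₀)) ?_ ?_
    · intro b hb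
      simp only [Finset.coe_filter, Finset.mem_univ, true_and, Set.mem_ofPred_eq, not_not] at hb ⊢
      intro h'
      have e : ∀ b : ι → Bool, chosenSum c b = (if b i₀ then c i₀ else 0) +
          ∑ i ∈ Finset.univ.erase i₀, if b i then c i else 0 := fun b =>
        (Finset.add_sum_erase _ _ (Finset.mem_univ i₀)).symm
      have e' : (∑ i ∈ Finset.univ.erase i₀,
          if Function.update b i₀ (!b i₀) i = true then c i else 0) =
          ∑ i ∈ Finset.univ.erase i₀, if b i then c i else 0 :=
        Finset.sum_congr rfl fun i hi => by
          rw [Function.update_of_ne (Finset.ne_of_mem_erase hi)]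
      rw [e] at hb h'
      rw [e', Function.update_self] at h'
      have h2 := add_right_cancel (h'.trans hb.symm)
      cases hbi : b i₀ <;> simp [hbi] at h2
      · exact h h2
      · exact h h2.symm
    · intro b _ b' _ hbb
      funext i
      have := congrFun hbb i
      by_cases hi : i = i₀
      · subst hi; simpa using this
      · simpa [Function.update_of_ne hi] using this
  have := Finset.card_filter_add_card_filter_not (s := (Finset.univ : Finset (ι → Bool)))
    (fun b => chosenSum c b ≠ 0)
  rw [Finset.card_univ] at this
  omega

/-- With probability at least `1/2` the first vector leaves a nonzero linear form, at which the
second vector succeeds with probability at least `1/2`. Another such step gives `1/8` in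
`card_chosenSum₃`. -/
theorem card_chosenSum₂ {ι K : Type*} [Fintype ι] [DecidableEq ι] [AddCommGroup K]
    [DecidableEq K] (c : ι → ι → K) (h : c ≠ 0) :
    Fintype.card (ι → Bool) ^ 2 ≤ 4 * ∑ b : ι → Bool,
      (Finset.univ.filter fun b' => chosenSum (chosenSum c b) b' ≠ 0).card := by
  obtain ⟨i₀, hi⟩ := Function.ne_iff.1 h
  have h1 := two_pow_le_card_chosenSum_ne_zero c i₀ hi
  have h2 : ∀ b ∈ Finset.univ.filter fun b => chosenSum c b ≠ 0, Fintype.card (ι → Bool) ≤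
      2 * (Finset.univ.filter fun b' => chosenSum (chosenSum c b) b' ≠ 0).card := by
    intro b hb
    obtain ⟨j, hj⟩ := Function.ne_iff.1 (Finset.mem_filter.1 hb).2
    exact two_pow_le_card_chosenSum_ne_zero _ j hj
  have h3 := Finset.card_nsmul_le_sum _ _ _ h2
  have h4 := Finset.sum_le_sum_of_subset (f := fun b => 2 * (Finset.univ.filter fun b' =>
    chosenSum (chosenSum c b) b' ≠ 0).card) (Finset.filter_subset
    (fun b => chosenSum c b ≠ 0) Finset.univ)
  rw [smul_eq_mul] at h3
  rw [← Finset.mul_sum] at h3 h4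
  rw [← Finset.mul_sum] at h4
  nlinarith

theorem card_chosenSum₃ {ι K : Type*} [Fintype ι] [DecidableEq ι] [AddCommGroup K]
    [DecidableEq K] (c : ι → ι → ι → K) (h : c ≠ 0) :
    Fintype.card (ι → Bool) ^ 3 ≤ 8 * ∑ b : ι → Bool, ∑ b' : ι → Bool,
      (Finset.univ.filter fun b'' => chosenSum (chosenSum (chosenSum c b) b') b'' ≠ 0).card := by
  obtain ⟨i₀, hi⟩ := Function.ne_iff.1 h
  have h1 := two_pow_le_card_chosenSum_ne_zero c i₀ hi
  have h2 : ∀ b ∈ Finset.univ.filter fun b => chosenSum c b ≠ 0,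
      Fintype.card (ι → Bool) ^ 2 ≤ 4 * ∑ b' : ι → Bool, (Finset.univ.filter fun b'' =>
        chosenSum (chosenSum (chosenSum c b) b') b'' ≠ 0).card :=
    fun b hb => card_chosenSum₂ _ (Finset.mem_filter.1 hb).2
  have h3 := Finset.card_nsmul_le_sum _ _ _ h2
  have h4 := Finset.sum_le_sum_of_subset (f := fun b => 4 * ∑ b' : ι → Bool,
    (Finset.univ.filter fun b'' => chosenSum (chosenSum (chosenSum c b) b') b'' ≠ 0).card)
    (Finset.filter_subset (fun b => chosenSum c b ≠ 0) Finset.univ)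
  rw [smul_eq_mul] at h3
  rw [← Finset.mul_sum] at h3 h4
  rw [← Finset.mul_sum] at h4
  nlinarith [Nat.zero_le (Fintype.card (ι → Bool) ^ 2)]

/-- A nonzero trilinear form vanishes at none of nine independent random zero-one points with
probability at most `1 / 3`. -/
theorem card_exists_chosenSum_ne_zero {ι K : Type*} [Fintype ι] [DecidableEq ι] [AddCommGroup K]
    [DecidableEq K] (c : ι → ι → ι → K) (h : c ≠ 0) :
    2 * Fintype.card (Fin 9 → Fin 3 → ι → Bool) ≤
      3 * Fintype.card {b : Fin 9 → Fin 3 → ι → Bool //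
        ∃ ρ, chosenSum (chosenSum (chosenSum c (b ρ 0)) (b ρ 1)) (b ρ 2) ≠ 0} := by
  set M := Fintype.card (ι → Bool) with hM
  let P : (Fin 3 → ι → Bool) → Prop := fun b =>
    chosenSum (chosenSum (chosenSum c (b 0)) (b 1)) (b 2) ≠ 0
  have hP : M ^ 3 ≤ 8 * (Finset.univ.filter P).card := by
    refine (card_chosenSum₃ c h).trans (Nat.mul_le_mul_left _ ?_)
    let S : Finset ((b : ι → Bool) × (_ : ι → Bool) × (ι → Bool)) :=
      Finset.univ.sigma fun b => Finset.univ.sigma fun b' => Finset.univ.filter fun b'' =>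
        chosenSum (chosenSum (chosenSum c b) b') b'' ≠ 0
    have hS : S.card = ∑ b : ι → Bool, ∑ b' : ι → Bool, (Finset.univ.filter fun b'' =>
        chosenSum (chosenSum (chosenSum c b) b') b'' ≠ 0).card := by
      simp only [S, Finset.card_sigma]
    rw [← hS]
    refine Finset.card_le_card_of_injOn (fun b => ![b.1, b.2.1, b.2.2]) ?_ ?_
    · intro b hb
      simpa [S, P] using hb
    · rintro ⟨b, b', b''⟩ _ ⟨d, d', d''⟩ _ hbd
      have e0 := congrFun hbd 0
      have e1 := congrFun hbd 1
      have e2 := congrFun hbd 2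
      simp at e0 e1 e2
      subst e0 e1 e2
      rfl
  have htot : Fintype.card (Fin 3 → ι → Bool) = M ^ 3 := by simp [hM]
  have hadd := Finset.card_filter_add_card_filter_not
    (s := (Finset.univ : Finset (Fin 3 → ι → Bool))) P
  rw [Finset.card_univ, htot] at hadd
  have hbad : 8 * (Finset.univ.filter fun b => ¬ P b).card ≤ 7 * M ^ 3 := by omega
  have hadd' := Finset.card_filter_add_card_filter_not
    (s := (Finset.univ : Finset (Fin 9 → Fin 3 → ι → Bool))) (fun b => ∃ ρ, P (b ρ))
  have hpi : (Finset.univ.filter fun b : Fin 9 → Fin 3 → ι → Bool => ¬ ∃ ρ, P (b ρ)) =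
      Fintype.piFinset fun _ => Finset.univ.filter fun b => ¬ P b := by
    ext b
    simp [Fintype.mem_piFinset]
  rw [hpi, Fintype.card_piFinset, Finset.prod_const, Finset.card_univ, Finset.card_univ,
    Fintype.card_fin] at hadd'
  have htot' : Fintype.card (Fin 9 → Fin 3 → ι → Bool) = (M ^ 3) ^ 9 := by
    rw [Fintype.card_fun, htot, Fintype.card_fin]
  -- Nine independent experiments fail with probability at most `(7/8)^9`, which is less than `1/3`.
  have hpow : (8 * (Finset.univ.filter fun b => ¬ P b).card) ^ 9 ≤ (7 * M ^ 3) ^ 9 :=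
    Nat.pow_le_pow_left hbad 9
  rw [mul_pow, mul_pow, ← htot'] at hpow
  rw [Fintype.card_subtype]
  change _ ≤ 3 * (Finset.univ.filter fun b : Fin 9 → Fin 3 → ι → Bool => ∃ ρ, P (b ρ)).card
  omega

/-- The coins as numbers. -/
def coinBits {m : ℕ} (b : Fin m → Bool) (j : ℕ) : ℕ := if h : j < m then (b ⟨j, h⟩).toNat else 0

theorem coinBits_le_one {m : ℕ} (b : Fin m → Bool) (j : ℕ) : coinBits b j ≤ 1 := by
  rw [coinBits]
  split_ifs
  · exact Bool.toNat_le _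
  · omega

/-- The position of the coin for the experiment `ρ`, the vector `a`, and the index `i`. -/
def coinEquiv (N : ℕ) : (Fin 9 → Fin 3 → Fin N → Bool) ≃ (Fin (9 * (3 * N)) → Bool) :=
  (Equiv.piCongrRight fun _ : Fin 9 => (Equiv.curry (Fin 3) (Fin N) Bool).symm).trans
    ((Equiv.curry (Fin 9) (Fin 3 × Fin N) Bool).symm.trans
      (Equiv.arrowCongr (((Equiv.refl _).prodCongr finProdFinEquiv).trans finProdFinEquiv)
        (Equiv.refl _)))

theorem coinBits_coinEquiv {N : ℕ} (b : Fin 9 → Fin 3 → Fin N → Bool) (ρ : Fin 9) (a : Fin 3)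
    (i : Fin N) : coinBits (coinEquiv N b) (ρ * (3 * N) + (a * N + i)) = (b ρ a i).toNat := by
  have hval : ((finProdFinEquiv (ρ, finProdFinEquiv (a, i)) : Fin (9 * (3 * N))) : ℕ) =
      ρ * (3 * N) + (a * N + i) := by
    simp only [finProdFinEquiv_apply_val]
    ring
  have hlt : (ρ : ℕ) * (3 * N) + (a * N + i) < 9 * (3 * N) := hval ▸ Fin.is_lt _
  have hidx : (⟨ρ * (3 * N) + (a * N + i), hlt⟩ : Fin (9 * (3 * N))) =
      finProdFinEquiv (ρ, finProdFinEquiv (a, i)) := Fin.ext hval.symm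
  rw [coinBits, dif_pos hlt, hidx]
  simp [coinEquiv, Equiv.arrowCongr, Function.uncurry]

theorem testBit_setCode {n : ℕ} (X : Finset (Fin n)) (e : ℕ) :
    (setCode X).testBit e = true ↔ ∃ h : e < n, ⟨e, h⟩ ∈ X := by
  have h1 : setCode X = ∑ i ∈ X.map Fin.valEmbedding, 2 ^ i := by simp [setCode]
  rw [h1, ← Nat.mem_bitIndices, ← List.mem_toFinset, Finset.toFinset_bitIndices_sum_two_pow,
    Finset.mem_map]
  constructor
  · rintro ⟨x, hx, rfl⟩
    exact ⟨x.2, hx⟩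
  · rintro ⟨h, hx⟩
    exact ⟨_, hx, rfl⟩

/-- The code of the set number `x` of a list. -/
def listCode {n : ℕ} (L : List (Finset (Fin n))) (x : ℕ) : ℕ := (L.map setCode).getD x 0

theorem listCode_eq {n : ℕ} (L : List (Finset (Fin n))) {x : ℕ} (hx : x < L.length) :
    listCode L x = setCode L[x] := by
  simp [listCode, hx]

theorem chosenSum₃_eq {ι K : Type*} [Fintype ι] [AddCommGroup K] (c : ι → ι → ι → K)
    (b b' b'' : ι → Bool) : chosenSum (chosenSum (chosenSum c b) b') b'' =
      ∑ x, ∑ y, ∑ z, if b x then if b' y then if b'' z then c x y z else 0 else 0 else 0 := by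
  rw [Finset.sum_comm_cycle]
  simp only [chosenSum, Finset.sum_apply, ite_apply, Pi.zero_apply]
  refine Finset.sum_congr rfl fun z _ => ?_
  rw [Finset.sum_comm]
  by_cases hz : b'' z = true
  · simp only [hz, if_true]
    refine Finset.sum_congr rfl fun y _ => ?_
    by_cases hy : b' y = true <;> simp [hy]
  · simp [hz]

/-! ### Soundness and success probability of the search -/

namespace CoverScheme

variable {s : ℕ} (D : CoverScheme s)

theorem query_ne_zero {N T : ℕ} {f W : ℕ → ℕ} {ρ j₁ j₂ a i : ℕ} (hi : i < N)
    (h : query N T f W ρ j₁ j₂ (a * N + i) ≠ 0) : f i ≤ quota T j₁ j₂ a ∧ j₁ + j₂ ≤ T := by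
  rw [query, mul_comm a, Nat.mul_add_mod, Nat.mod_eq_of_lt hi, Nat.mul_add_div (by omega),
    Nat.div_eq_of_lt hi, add_zero] at h
  have h1 := right_ne_zero_of_mul h
  have h2 := left_ne_zero_of_mul h1
  have h3 := right_ne_zero_of_mul h1
  omega

/-- A nonzero value of the form has a nonzero term. Its three indices are within their quotas, and
its block coefficients do not vanish, so by `sound` the three sets cover every block. The union of
their subfamilies is a cover. The coins play no role here. -/
theorem hasSetCover_of_hit {n t : ℕ} (L : List (Finset (Fin n))) {f W : ℕ → ℕ}
    (hf : ∀ i < D.R ^ D.blocks n, f i ≤ n → ∃ G ⊆ Finset.range L.length, G.card ≤ f i ∧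
      D.Covers (listCode L) n G i) {ρ j₁ j₂ : ℕ}
    (h : D.Hit (D.blocks n) (min t n) f W ρ j₁ j₂) : HasSetCover L.toFinset t := by
  have : Fact D.p.Prime := ⟨D.prime⟩
  set N := D.R ^ D.blocks n with hN
  set T := min t n with hT
  obtain ⟨x, hx, h⟩ := Finset.exists_ne_zero_of_sum_ne_zero h
  obtain ⟨y, hy, h⟩ := Finset.exists_ne_zero_of_sum_ne_zero h
  obtain ⟨z, hz, h⟩ := Finset.exists_ne_zero_of_sum_ne_zero h
  rw [← hN, Finset.mem_range] at hx hy hz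
  have hc := left_ne_zero_of_mul h
  have hw := right_ne_zero_of_mul h
  have hcast : ∀ k : ℕ, (k : ZMod D.p) ≠ 0 → k ≠ 0 := fun k hk h0 => hk (by simp [h0])
  obtain ⟨q0, hj⟩ := query_ne_zero hx (hcast _ (left_ne_zero_of_mul (left_ne_zero_of_mul hw)))
  obtain ⟨q1, -⟩ := query_ne_zero hy (hcast _ (right_ne_zero_of_mul (left_ne_zero_of_mul hw)))
  obtain ⟨q2, -⟩ := query_ne_zero hz (hcast _ (right_ne_zero_of_mul hw))
  simp only [quota, if_true, one_ne_zero, if_false, show (2 : ℕ) ≠ 0 by norm_num,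
    show (2 : ℕ) ≠ 1 by norm_num] at q0 q1 q2
  have hTn : T ≤ n := min_le_right _ _
  have hTt : T ≤ t := min_le_left _ _
  obtain ⟨G0, r0, c0, v0⟩ := hf x hx (by omega)
  obtain ⟨G1, r1, c1, v1⟩ := hf y hy (by omega)
  obtain ⟨G2, r2, c2, v2⟩ := hf z hz (by omega)
  have hsub : G0 ∪ G1 ∪ G2 ⊆ Finset.range L.length :=
    Finset.union_subset (Finset.union_subset r0 r1) r2
  refine ⟨(G0 ∪ G1 ∪ G2).image fun i => L.getD i ∅, ?_, ?_, ?_⟩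
  · intro X hX
    obtain ⟨i, hi, rfl⟩ := Finset.mem_image.1 hX
    have hi' := Finset.mem_range.1 (hsub hi)
    rw [List.mem_toFinset, List.getD_eq_getElem _ _ hi']
    exact List.getElem_mem _
  · refine Finset.card_image_le.trans ((Finset.card_union_le _ _).trans ?_)
    have := Finset.card_union_le G0 G1
    omega
  · refine Finset.eq_univ_iff_forall.2 fun e => ?_
    have he : (e : ℕ) < D.m * D.blocks n := e.2.trans_le (D.le_blocks n)
    have hcoef := Finset.prod_ne_zero_iff.1 hc (e / D.m)
      (Finset.mem_range.2 (Nat.div_lt_of_lt_mul he))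
    obtain ⟨a, ha, hhas⟩ := D.sound (fun a => if a = 0 then
      digit D.R (e / D.m) x else if a = 1 then digit D.R (e / D.m) y else digit D.R (e / D.m) z)
      (fun a _ => by split_ifs <;> exact digit_lt D.R_pos _ _) hcoef (e % D.m) (Nat.mod_lt _ D.m_pos)
    have hcov : ∃ i ∈ G0 ∪ G1 ∪ G2, (listCode L i).testBit e = true := by
      interval_cases a
      · rcases v0 e he hhas with h | ⟨i, hi, h⟩
        · exact absurd e.2 (by omega)
        · exact ⟨i, by simp [hi], h⟩
      · rcases v1 e he hhas with h | ⟨i, hi, h⟩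
        · exact absurd e.2 (by omega)
        · exact ⟨i, by simp [hi], h⟩
      · rcases v2 e he hhas with h | ⟨i, hi, h⟩
        · exact absurd e.2 (by omega)
        · exact ⟨i, by simp [hi], h⟩
    obtain ⟨i, hi, h⟩ := hcov
    have hi' := Finset.mem_range.1 (hsub hi)
    rw [listCode_eq L hi', testBit_setCode] at h
    obtain ⟨_, h⟩ := h
    refine Finset.mem_biUnion.2 ⟨L.getD i ∅, Finset.mem_image_of_mem _ hi, ?_⟩
    rw [List.getD_eq_getElem _ _ hi']
    exact h

/-- Every element of `[n]` is assigned to one set of the cover that contains it. The resulting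
pieces are small, and `complete` colours them with three colours. The sets of colour `a` cover the
set with index `x a`, and their numbers serve as quotas. -/
theorem exists_digits_of_hasSetCover {s' n t : ℕ} (D : CoverScheme (s' + 1))
    (L : List (Finset (Fin n))) (hL : ∀ X ∈ L, X.card ≤ s') {f : ℕ → ℕ}
    (hf : ∀ i < D.R ^ D.blocks n, ∀ G ⊆ Finset.range L.length, D.Covers (listCode L) n G i →
      f i ≤ G.card) (h : HasSetCover L.toFinset t) :
    ∃ j₁ j₂, j₁ + j₂ ≤ min t n ∧ ∃ x : ℕ → ℕ, (∀ a < 3, x a < D.R ^ D.blocks n) ∧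
      (∀ a < 3, f (x a) ≤ quota (min t n) j₁ j₂ a) ∧
      ∏ v ∈ Finset.range (D.blocks n), D.coeff (fun a => digit D.R v (x a)) ≠ 0 := by
  classical
  have : Fact D.p.Prime := ⟨D.prime⟩
  set r := D.blocks n with hr
  obtain ⟨𝓖, hsub, hcard, hunion⟩ := h
  have hpick : ∀ e : Fin n, ∃ X ∈ 𝓖, e ∈ X := by
    intro e
    have : e ∈ 𝓖.biUnion id := by rw [hunion]; exact Finset.mem_univ _
    simpa using this
  choose pick hpick𝓖 hpick using hpick
  have hpickL : ∀ e, pick e ∈ L := fun e => List.mem_toFinset.1 (hsub (hpick𝓖 e))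
  let idx : Fin n → ℕ := fun e => L.idxOf (pick e)
  have hidx : ∀ e, idx e < L.length := fun e => List.idxOf_lt_length_of_mem (hpickL e)
  have hget : ∀ e, L[idx e]'(hidx e) = pick e := fun e => List.getElem_idxOf _
  -- The elements beyond `n` are pieces of their own. These singletons are the reason for asking for
  -- a scheme for `s' + 1`, which is positive even if `s' = 0`.
  let piece : ℕ → ℕ ⊕ ℕ := fun e => if h : e < n then Sum.inl (idx ⟨e, h⟩) else Sum.inr e
  obtain ⟨χ, hχ, hdig⟩ := D.complete r (ℕ ⊕ ℕ) piece (by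
    rintro (i | e')
    · by_cases hi : ∃ e, idx e = i
      · obtain ⟨e₀, rfl⟩ := hi
        refine le_trans ?_ ((hL _ (hpickL e₀)).trans (Nat.le_succ _))
        rw [← Finset.card_map Fin.valEmbedding]
        refine Finset.card_le_card fun e he => ?_
        have he := (Finset.mem_filter.1 he).2
        simp only [piece] at he
        split_ifs at he with hlt
        have he : idx ⟨e, hlt⟩ = idx e₀ := Sum.inl_injective he
        refine Finset.mem_map.2 ⟨⟨e, hlt⟩, ?_, rfl⟩
        have h1 := hget ⟨e, hlt⟩
        have h2 := hget e₀
        simp only [he] at h1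
        rw [← h2, h1]
        exact hpick _
      · rw [Finset.card_eq_zero.2]
        · omega
        · refine Finset.filter_eq_empty_iff.2 fun e _ he => hi ?_
          simp only [piece] at he
          split_ifs at he with hlt
          exact ⟨_, Sum.inl_injective he⟩
    · refine le_trans (Finset.card_le_one.2 fun e he e'' he'' => ?_) (by omega)
      have he := (Finset.mem_filter.1 he).2
      have he'' := (Finset.mem_filter.1 he'').2
      simp only [piece] at he he''
      split_ifs at he he''
      rw [Sum.inr_injective he, Sum.inr_injective he''])
  choose! d hdR hdhas hdcoef using hdig
  let U : Finset ℕ := Finset.univ.image idx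
  let G : ℕ → Finset ℕ := fun a => U.filter fun i => χ (Sum.inl i) = a
  have hU : U.card ≤ min t n := by
    refine le_min ?_ ?_
    · have : U = (Finset.univ.image pick).image fun X => L.idxOf X := by
        simp only [U, Finset.image_image]; rfl
      rw [this]
      refine Finset.card_image_le.trans ((Finset.card_le_card ?_).trans hcard)
      intro X hX
      obtain ⟨e, -, rfl⟩ := Finset.mem_image.1 hX
      exact hpick𝓖 e
    · exact Finset.card_image_le.trans (by simp)
  have hsum : (G 0).card + (G 1).card + (G 2).card = U.card := by
    have := Finset.card_eq_sum_card_fiberwise (f := fun i => χ (Sum.inl i)) (s := U)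
      (t := Finset.range 3) (fun i _ => by simpa using hχ (Sum.inl i))
    rw [this]
    simp [Finset.sum_range_succ, G]
  have hGsub : ∀ a, G a ⊆ Finset.range L.length := by
    intro a i hi
    obtain ⟨e, -, rfl⟩ := Finset.mem_image.1 (Finset.mem_filter.1 hi).1
    exact Finset.mem_range.2 (hidx e)
  let x : ℕ → ℕ := fun a => ∑ v ∈ Finset.range r, D.R ^ v * d v a
  have hxdig : ∀ a < 3, ∀ v < r, digit D.R v (x a) = d v a := fun a ha v hv =>
    digit_sum D.R_pos r (fun u hu => hdR u hu a ha) hv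
  have hxlt : ∀ a < 3, x a < D.R ^ r := fun a ha =>
    sum_digits_lt D.R_pos r fun u hu => hdR u hu a ha
  have hfx : ∀ a < 3, f (x a) ≤ (G a).card := by
    intro a ha
    refine hf _ (hxlt a ha) _ (hGsub a) fun e he hmem => ?_
    by_cases hen : n ≤ e
    · exact Or.inl hen
    have hlt : e < n := by omega
    have hv : e / D.m < r := Nat.div_lt_of_lt_mul he
    rw [Mem, hxdig a ha _ hv, hdhas _ hv a ha _ (Nat.mod_lt _ D.m_pos), Nat.div_add_mod] at hmem
    simp only [piece, hlt, dif_pos] at hmem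
    refine Or.inr ⟨idx ⟨e, hlt⟩, Finset.mem_filter.2
      ⟨Finset.mem_image_of_mem _ (Finset.mem_univ _), hmem⟩, ?_⟩
    rw [listCode_eq L (hidx _), hget, testBit_setCode]
    exact ⟨hlt, hpick _⟩
  refine ⟨(G 0).card, (G 1).card, by omega, x, hxlt, fun a ha => (hfx a ha).trans ?_, ?_⟩
  · interval_cases a <;> simp only [quota, if_true, one_ne_zero, if_false, le_refl,
      show (2 : ℕ) ≠ 0 by norm_num, show (2 : ℕ) ≠ 1 by norm_num]
    omega
  · refine Finset.prod_ne_zero_iff.2 fun v hv => ?_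
    have hv := Finset.mem_range.1 hv
    have := hdcoef v hv
    rwa [coeff, hxdig 0 (by norm_num) v hv, hxdig 1 (by norm_num) v hv,
      hxdig 2 (by norm_num) v hv]

/-- For these quotas the masked form has a nonzero coefficient at `x`, and the coins choose the
coordinates of its arguments. Each experiment uses coins of its own, as
`card_exists_chosenSum_ne_zero` demands. Reuse of the same coins for other quotas does no harm,
since only one good pair of quotas matters. -/
theorem card_hit {r T : ℕ} {f : ℕ → ℕ} {j₁ j₂ : ℕ} (hj : j₁ + j₂ ≤ T) (x : ℕ → ℕ)
    (hx : ∀ a < 3, x a < D.R ^ r) (hf : ∀ a < 3, f (x a) ≤ quota T j₁ j₂ a)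
    (hc : ∏ v ∈ Finset.range r, D.coeff (fun a => digit D.R v (x a)) ≠ 0) :
    2 * 2 ^ (9 * (3 * D.R ^ r)) ≤ 3 * Nat.card {b : Fin (9 * (3 * D.R ^ r)) → Bool //
      ∃ ρ < 9, D.Hit r T f (coinBits b) ρ j₁ j₂} := by
  classical
  set N := D.R ^ r with hN
  have : Fact D.p.Prime := ⟨D.prime⟩
  let mask : ℕ → ℕ → ℕ := fun a i => (1 - (f i - quota T j₁ j₂ a)) * (1 - (j₁ + j₂ - T))
  let c : Fin N → Fin N → Fin N → ZMod D.p := fun y₀ y₁ y₂ =>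
    (∏ v ∈ Finset.range r, D.coeff (fun a => if a = 0 then digit D.R v y₀ else
      if a = 1 then digit D.R v y₁ else digit D.R v y₂)) *
      (mask 0 y₀ * mask 1 y₁ * mask 2 y₂)
  have hcne : c ≠ 0 := by
    intro h0
    have h1 := congrFun (congrFun (congrFun h0 ⟨x 0, hx 0 (by norm_num)⟩)
      ⟨x 1, hx 1 (by norm_num)⟩) ⟨x 2, hx 2 (by norm_num)⟩
    have hm : ∀ a < 3, mask a (x a) = 1 := by
      intro a ha
      simp only [mask]
      rw [Nat.sub_eq_zero_of_le (hf a ha), Nat.sub_eq_zero_of_le hj]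
    simp only [c, hm 0 (by norm_num), hm 1 (by norm_num), hm 2 (by norm_num), Pi.zero_apply,
      Nat.cast_one, mul_one] at h1
    refine hc (Eq.trans (Finset.prod_congr rfl fun v _ => ?_) h1)
    simp [coeff]
  have hhit : ∀ b : Fin 9 → Fin 3 → Fin N → Bool, ∀ ρ : Fin 9,
      chosenSum (chosenSum (chosenSum c (b ρ 0)) (b ρ 1)) (b ρ 2) ≠ 0 →
      D.Hit r T f (coinBits (coinEquiv N b)) ρ j₁ j₂ := by
    intro b ρ h
    rw [Hit]
    refine ne_of_eq_of_ne ?_ h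
    have hq : ∀ (a : Fin 3) (i : Fin N), (query N T f (coinBits (coinEquiv N b)) ρ j₁ j₂
        (a * N + i) : ZMod D.p) = if b ρ a i then (mask a i : ZMod D.p) else 0 := by
      intro a i
      rw [query, coinBits_coinEquiv, mul_comm (a : ℕ), Nat.mul_add_mod, Nat.mod_eq_of_lt i.2,
        Nat.mul_add_div (by have := i.2; omega), Nat.div_eq_of_lt i.2, add_zero]
      cases b ρ a i <;> simp [mask]
    rw [chosenSum₃_eq]
    simp only [form, Finset.sum_range, ← hN]
    refine Finset.sum_congr rfl fun x _ => Finset.sum_congr rfl fun y _ =>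
      Finset.sum_congr rfl fun z _ => ?_
    have q0 := hq 0 x
    have q1 := hq 1 y
    have q2 := hq 2 z
    simp only [Fin.val_zero, Fin.val_one, Fin.val_two] at q0 q1 q2
    rw [q0, q1, q2]
    cases b ρ 0 x <;> cases b ρ 1 y <;> cases b ρ 2 z <;> simp [c]
  have hcard := card_exists_chosenSum_ne_zero c hcne
  have htot : Fintype.card (Fin 9 → Fin 3 → Fin N → Bool) = 2 ^ (9 * (3 * N)) := by
    rw [Fintype.card_congr (coinEquiv N)]; simp
  rw [htot] at hcard
  refine hcard.trans (Nat.mul_le_mul_left _ ?_)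
  rw [← Nat.card_eq_fintype_card]
  refine Nat.card_le_card_of_injective (fun b => ⟨coinEquiv N b.1, ?_⟩) ?_
  · obtain ⟨ρ, hρ⟩ := b.2
    exact ⟨ρ, ρ.2, hhit b.1 ρ hρ⟩
  · intro b b' h
    exact Subtype.ext ((coinEquiv N).injective (Subtype.ext_iff.1 h))

end CoverScheme

/-! ### Running time of the parts of the program -/

namespace ArrayLang

/-- The part of the running time that does not depend on the numbers of rounds. -/
def Cmd.weight : Cmd → ℕ
  | .assign c i e => RAM.storeWeight (addr c i.compile) e.compile
  | .seq p q => p.weight + q.weight + 1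
  | .loop v e body => body.weight + forWeight v e

/-- The running time is at most `G` times the weight. -/
def TimeLe (I : ℕ → ℕ) (p : Cmd) (σ : Store) (G : ℕ) : Prop := p.time I σ ≤ p.weight * G

theorem TimeLe.assign {I : ℕ → ℕ} {c : Fin 32} {i e : HExpr} {σ : Store} {G : ℕ} (hG : 1 ≤ G) :
    TimeLe I (.assign c i e) σ G := Nat.le_mul_of_pos_right _ hG

theorem TimeLe.set {I : ℕ → ℕ} {c : Fin 32} {e : HExpr} {σ : Store} {G : ℕ} (hG : 1 ≤ G) :
    TimeLe I (ArrayLang.set c e) σ G := TimeLe.assign hG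

theorem TimeLe.seq {I : ℕ → ℕ} {p q : Cmd} {σ : Store} {G : ℕ} (hG : 1 ≤ G)
    (hp : TimeLe I p σ G) (hq : TimeLe I q σ G) : TimeLe I (.seq p q) σ G := by
  simp only [TimeLe, Cmd.time, Cmd.weight, add_mul, one_mul] at *
  omega

theorem TimeLe.loop {I : ℕ → ℕ} {v : Fin 32} {e : HExpr} {p : Cmd} {σ : Store} {G : ℕ}
    (K G' : ℕ) (hK : e.eval I σ = K) (hG' : 1 ≤ G') (hp : TimeLe I p σ G')
    (hG : (K + 1) * G' ≤ G) : TimeLe I (.loop v e p) σ G := by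
  simp only [TimeLe, Cmd.time, Cmd.weight, hK] at *
  calc (K + 1) * (p.time I σ + forWeight v e)
      ≤ (K + 1) * (p.weight * G' + forWeight v e * G') :=
        Nat.mul_le_mul_left _ (Nat.add_le_add hp (Nat.le_mul_of_pos_right _ hG'))
    _ = (p.weight + forWeight v e) * ((K + 1) * G') := by ring
    _ ≤ _ := Nat.mul_le_mul_left _ hG

theorem TimeLe.mono {I : ℕ → ℕ} {p : Cmd} {σ : Store} {G G' : ℕ} (h : TimeLe I p σ G)
    (hG : G ≤ G') : TimeLe I p σ G' := h.trans (Nat.mul_le_mul_left _ hG)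

end ArrayLang

namespace CoverScheme

open ArrayLang

variable {s : ℕ} (D : CoverScheme s)

theorem timeLe_setupCmd {I : ℕ → ℕ} {n r : ℕ} (hI : I 0 = n) (σ : Store) (h0 : σ 0 0 = r) :
    TimeLe I D.setupCmd σ (n + r + 1) := by
  have h1 : 1 ≤ n + r + 1 := by omega
  exact TimeLe.seq h1 (TimeLe.set h1) (TimeLe.seq h1 (TimeLe.set h1) (TimeLe.seq h1
    (TimeLe.loop r 1 h0 le_rfl (TimeLe.seq le_rfl (TimeLe.set le_rfl) (TimeLe.set le_rfl))
      (by omega)) (TimeLe.seq h1 (TimeLe.set h1) (TimeLe.seq h1 (TimeLe.loop n 1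
        (by simp [eval_input, eval_const, hI]) le_rfl (TimeLe.set le_rfl) (by omega))
          (TimeLe.set h1)))))

theorem timeLe_relaxCmd {I : ℕ → ℕ} {N r : ℕ} (σ : Store) (h0 : σ 0 0 = r) (h1 : σ 1 0 = N) :
    TimeLe I D.relaxCmd σ ((N + 1) * (r + 1)) := by
  have hr : 1 ≤ r + 1 := by omega
  refine TimeLe.loop N (r + 1) h1 hr (TimeLe.seq hr ?_ (TimeLe.assign hr)) le_rfl
  exact TimeLe.seq hr (TimeLe.set hr) (TimeLe.seq hr (TimeLe.set hr) (TimeLe.seq hr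
    (TimeLe.set hr) (TimeLe.seq hr (TimeLe.set hr) (TimeLe.loop r 1 h0 le_rfl (TimeLe.seq le_rfl
      (TimeLe.set le_rfl) (TimeLe.seq le_rfl (TimeLe.set le_rfl) (TimeLe.seq le_rfl
        (TimeLe.set le_rfl) (TimeLe.set le_rfl)))) (by omega)))))

theorem timeLe_coverNumbersCmd {I : ℕ → ℕ} {N r ℓ : ℕ} (hI : I 2 = ℓ) (σ : Store)
    (h0 : σ 0 0 = r) (h1 : σ 1 0 = N) :
    TimeLe I D.coverNumbersCmd σ ((ℓ + 1) * ((N + 1) * (r + 1))) := by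
  have e1 : N + 1 ≤ (N + 1) * (r + 1) := Nat.le_mul_of_pos_right _ (by omega)
  have e2 : (N + 1) * (r + 1) ≤ (ℓ + 1) * ((N + 1) * (r + 1)) :=
    Nat.le_mul_of_pos_left _ (by omega)
  have hG : 1 ≤ (ℓ + 1) * ((N + 1) * (r + 1)) := by omega
  have hrel := D.timeLe_relaxCmd (I := I) σ h0 h1
  refine TimeLe.seq hG (TimeLe.loop N 1 h1 le_rfl (TimeLe.assign le_rfl) (by omega)) ?_
  refine TimeLe.seq hG (TimeLe.set hG) (TimeLe.seq hG (hrel.mono e2) (TimeLe.seq hG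
    (TimeLe.set hG) (TimeLe.loop ℓ ((N + 1) * (r + 1)) ?_ (by omega)
      (TimeLe.seq (by omega) (TimeLe.set (by omega)) hrel) le_rfl)))
  simp only [eval_input, eval_const, hI]
  rw [Nat.mod_eq_of_lt (by omega), hI]

theorem timeLe_queryRound {I : ℕ → ℕ} {N r : ℕ} (σ : Store) (h0 : σ 0 0 = r)
    (h1 : σ 1 0 = N) (hr : 0 < r) :
    TimeLe I D.queryRound σ ((3 * N * r + 1) * (D.R + 1)) := by
  have e1 : 3 * N * r + 1 ≤ (3 * N * r + 1) * (D.R + 1) := Nat.le_mul_of_pos_right _ (by omega)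
  have e2 : 3 * N ≤ 3 * N * r := Nat.le_mul_of_pos_right _ hr
  have hG : 1 ≤ (3 * N * r + 1) * (D.R + 1) := by omega
  have hR : 1 ≤ D.R + 1 := by omega
  refine TimeLe.seq hG (TimeLe.seq hG (TimeLe.assign hG) (TimeLe.seq hG (TimeLe.assign hG)
    (TimeLe.seq hG (TimeLe.assign hG) (TimeLe.loop (3 * N) 1 ?_ le_rfl (TimeLe.assign le_rfl)
      (by omega))))) (TimeLe.seq hG (TimeLe.seq hG (TimeLe.loop (3 * N * r) (D.R + 1) ?_ hR ?_
        le_rfl) (TimeLe.seq hG (TimeLe.set hG) (TimeLe.loop N 1 h1 le_rfl (TimeLe.set le_rfl)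
          (by omega)))) (TimeLe.set hG))
  · simp [eval_mul, eval_const, eval_var, h1]
  · simp [eval_mul, eval_const, eval_var, h1, h0]
  · exact TimeLe.seq hR (TimeLe.set hR) (TimeLe.seq hR (TimeLe.loop D.R 1 rfl le_rfl
      (TimeLe.set le_rfl) (by omega)) (TimeLe.assign hR))

theorem timeLe_searchCmd {I : ℕ → ℕ} {N r T : ℕ} (hT : I 1 = T) (σ : Store) (h0 : σ 0 0 = r)
    (h1 : σ 1 0 = N) (hr : 0 < r) : TimeLe I D.searchCmd σ
      ((9 + 1) * ((T + 1 + 1) * ((T + 1 + 1) * ((3 * N * r + 1) * (D.R + 1))))) := by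
  have h := D.timeLe_queryRound (I := I) σ h0 h1 hr
  have hT' : (HExpr.input (.const 1) + .const 1).eval I σ = T + 1 := by
    simp [eval_add, eval_input, eval_const, hT]
  have p1 : 1 ≤ (3 * N * r + 1) * (D.R + 1) := Nat.mul_pos (by omega) (by omega)
  have p2 : 1 ≤ (T + 1 + 1) * ((3 * N * r + 1) * (D.R + 1)) := Nat.mul_pos (by omega) p1
  have p3 : 1 ≤ (T + 1 + 1) * ((T + 1 + 1) * ((3 * N * r + 1) * (D.R + 1))) :=
    Nat.mul_pos (by omega) p2
  have p4 := Nat.mul_pos (show 0 < 9 + 1 by omega) p3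
  exact TimeLe.seq p4 (TimeLe.set p4) (TimeLe.loop 9 _ rfl p3 (TimeLe.loop (T + 1) _ hT' p2
    (TimeLe.loop (T + 1) _ hT' p1 h le_rfl) le_rfl) le_rfl)

/-- The number of coin tosses. -/
def coinBound : HExpr := .const 9 * (.const 3 * var 1)

/-- Fills the array `18` with random bits. -/
def coinProg : RAM.Prog := forProg 24 coinBound (.coin (addr 18 (scalar 24)))

/-- The weight of a coin toss. -/
def coinWeight : ℕ :=
  (addr 18 (scalar 24)).costWeight + (addr 18 (scalar 24)).sizeWeight + 1

/-- The body of the loop is a coin toss and hence no command of the array language, so the loop rule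
`exec_for` is applied directly, with the list of remaining coins shrinking by one per round. -/
theorem exec_coinProg {I : ℕ → ℕ} {b K : ℕ} (hI : ∀ a, Nat.size (I a) ≤ b) (σ : Store)
    (hσ : ∀ c i, Nat.size (σ c i) ≤ b) (hK : 9 * (3 * σ 1 0) = K) (hb : Nat.size K ≤ b)
    (hb1 : 1 ≤ b) (h18 : σ 18 = 0) (coins : Fin K → Bool) :
    ∃ τ : Store, (∀ c i, Nat.size (τ c i) ≤ b) ∧ τ 18 = coinBits coins ∧
      (∀ c, c ≠ 18 → c ≠ 24 → τ c = σ c) ∧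
      ∃ t ≤ (K + 1) * (coinWeight + forWeight 24 coinBound) * (b + 1) ^ 2,
        RAM.Exec coinProg (mem I σ) (List.ofFn coins) (mem I τ) [] t := by
  let f : Store → Store := fun τ => upd τ 18 (τ 24 0) (coinBits coins (τ 24 0))
  have hf : ∀ τ, f τ = upd τ 18 (τ 24 0) (coinBits coins (τ 24 0)) := fun _ => rfl
  have hbit : ∀ j, Nat.size (coinBits coins j) ≤ b := fun j =>
    (Nat.size_le_size (coinBits_le_one coins j)).trans hb1
  have hinv : ∀ i ≤ K, (∀ c j, Nat.size (iter 24 f σ i c j) ≤ b) ∧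
      (∀ c, c ≠ 18 → c ≠ 24 → iter 24 f σ i c = σ c) ∧
      ∀ j, iter 24 f σ i 18 j = if j < i then coinBits coins j else 0 := by
    intro i
    induction i with
    | zero =>
      refine fun _ => ⟨fun c j => size_upd hσ (by simp) c j, fun c _ h => upd_ne _ _ _ h,
        fun j => ?_⟩
      rw [iter, upd_ne _ _ _ (by decide), h18]
      simp
    | succ i ih =>
      intro hi
      obtain ⟨h1, h2, h3⟩ := ih (by omega)
      refine ⟨fun c j => size_upd (size_upd h1 (hbit _)) ((Nat.size_le_size hi).trans hb) c j,
        fun c hc hc' => ?_, fun j => ?_⟩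
      · rw [iter, upd_ne _ _ _ hc', hf, upd_ne _ _ _ hc, h2 c hc hc']
      · rw [iter, upd_ne _ _ _ (by decide), hf, upd_apply, h3, iter_var]
        by_cases hji : j = i
        · simp [hji]
        · rw [if_neg hji]
          have : j < i + 1 ↔ j < i := by omega
          simp only [this]
  obtain ⟨t, ht, hx⟩ := exec_for hI 24 coinBound (.coin (addr 18 (scalar 24))) f σ hσ
    (fun i => (List.ofFn coins).drop i) K coinWeight
    (fun i hi => by
      simp only [coinBound, eval_mul, eval_const, eval_var]
      rw [(hinv i hi).2.1 1 (by decide) (by decide), hK])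
    (fun i hi => (hinv i hi).1)
    (fun i hi => size_upd (hinv i hi.le).1 (hbit _))
    (fun i hi => by
      simp only [f]
      rw [upd_ne _ _ _ (by decide), iter_var])
    (fun i hi => by
      have hd : (List.ofFn coins).drop i = coins ⟨i, hi⟩ :: (List.ofFn coins).drop (i + 1) := by
        rw [List.drop_eq_getElem_cons (by simpa using hi)]
        simp
      have hM := size_mem hI (hinv i hi.le).1
      have hx := RAM.Exec.coin (addr 18 (scalar 24)) (mem I (iter 24 f σ i)) (coins ⟨i, hi⟩)
        ((List.ofFn coins).drop (i + 1))
      rw [eval_addr, eval_scalar, iter_var, mem_update] at hx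
      have hfi : f (iter 24 f σ i) = upd (iter 24 f σ i) 18 i (coins ⟨i, hi⟩).toNat := by
        simp only [f, iter_var, coinBits, hi, dif_pos]
      simp only [hd]
      rw [hfi]
      refine ⟨_, ?_, hx⟩
      have h1 := (addr 18 (scalar 24)).cost_le hM
      have h2 := (addr 18 (scalar 24)).size_eval_le hM
      rw [eval_addr, eval_scalar, iter_var] at h2
      have hb : 1 ≤ (b + 1) ^ 2 := Nat.one_le_pow _ _ (by omega)
      have hb' : b + 1 ≤ (b + 1) ^ 2 := by nlinarith
      have h6 := Nat.mul_le_mul_left (addr 18 (scalar 24)).sizeWeight hb'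
      simp only [coinWeight, add_mul, one_mul]
      omega)
  obtain ⟨h1, h2, h3⟩ := hinv K le_rfl
  refine ⟨iter 24 f σ K, h1, ?_, h2, t, ht, ?_⟩
  · funext j
    rw [h3]
    split_ifs with h
    · rfl
    · simp [coinBits, h]
  · have : (List.ofFn coins).drop K = [] := List.drop_eq_nil_of_le (by simp)
    simpa [this, coinProg] using hx

end CoverScheme

theorem setCode_lt {n : ℕ} (X : Finset (Fin n)) : setCode X < 2 ^ n := by
  refine Nat.lt_pow_two_of_testBit _ fun i hi => ?_
  by_contra h
  obtain ⟨h', -⟩ := (testBit_setCode X i).1 (by simpa using h)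
  omega

theorem ArrayLang.Cmd.run_eq {I : ℕ → ℕ} (p : ArrayLang.Cmd) {a : Fin 32}
    (h : p.mods.elem a = false) (σ : ArrayLang.Store) : p.run I σ a = σ a :=
  p.run_frame (by simpa using h) σ

/-! ### The complete program -/

namespace CoverScheme

open ArrayLang

variable {s : ℕ} (D : CoverScheme s)

/-- The minimum of the cells `0` and `1`. -/
def minExpr : RAM.Expr :=
  .op .sub (.load (.const 1)) (.op .sub (.load (.const 1)) (.load (.const 0)))

/-- The program for set cover that belongs to a covering scheme. -/
def program : RAM.Prog :=
  .seq (.store (.const 1) minExpr) (.seq D.blocksCmd.compile (.seq D.setupCmd.compile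
    (.seq D.coverNumbersCmd.compile (.seq coinProg (.seq D.searchCmd.compile
      (.store (.const 0) (scalar 15)))))))

/-- A bound for the numbers in the memory. -/
def big (n : ℕ) : ℕ := 27 * D.R ^ D.blocks n * D.blocks n * 2 ^ (D.m * D.blocks n) *
  (D.R * D.p ^ 2)

/-- The input, with the threshold replaced by its minimum with `n`. -/
def cappedInput {n : ℕ} (t : ℕ) (L : List (Finset (Fin n))) : ℕ → ℕ :=
  Function.update (setCoverInput n t L) 1 (min t n)

theorem cappedInput_add_three {n : ℕ} (t : ℕ) (L : List (Finset (Fin n))) (x : ℕ) :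
    cappedInput t L (3 + x) = listCode L x := by
  rw [cappedInput, Function.update_of_ne (by omega), add_comm]
  rfl

theorem listCode_lt {n : ℕ} (L : List (Finset (Fin n))) (x : ℕ) : listCode L x < 2 ^ n := by
  by_cases hx : x < L.length
  · rw [listCode_eq L hx]; exact setCode_lt _
  · rw [listCode, List.getD_eq_default _ _ (by simpa using hx)]; positivity

theorem mem_cappedInput {n : ℕ} (t : ℕ) (L : List (Finset (Fin n))) :
    Function.update (setCoverInput n t L) 1 (min t n) = mem (cappedInput t L) 0 := by
  funext a
  simp only [mem]
  have h2 : cappedInput t L 2 = L.length := rfl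
  split_ifs with h
  · rfl
  · rw [h2] at h
    obtain ⟨x, rfl⟩ : ∃ x, a = x + 3 := ⟨a - 3, by omega⟩
    rw [Function.update_of_ne (by omega)]
    exact List.getD_eq_default _ _ (by simp; omega)

/-- More than `n` sets are never needed. This is the only instruction that handles `t` itself, hence
the only source of the term `Nat.size t` in the running time; all later numbers are bounded by `big
n`. -/
theorem exec_capThreshold {n : ℕ} (t : ℕ) (L : List (Finset (Fin n))) (B : List Bool) :
    ∃ t' ≤ 6 * Nat.size t + 3 * Nat.size n + 20, RAM.Exec (.store (.const 1) minExpr)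
      (setCoverInput n t L) B (mem (cappedInput t L) 0) B t' := by
  have h := RAM.Exec.store (.const 1) minExpr (setCoverInput n t L) B
  have hv : minExpr.eval (setCoverInput n t L) = min t n := by
    simp only [minExpr, RAM.Expr.eval, RAM.Op.eval, setCoverInput]
    omega
  rw [hv] at h
  simp only [RAM.Expr.eval] at h
  rw [mem_cappedInput] at h
  refine ⟨_, ?_, h⟩
  have h1 : Nat.size (t - n) ≤ Nat.size t := Nat.size_le_size (Nat.sub_le _ _)
  have h2 : Nat.size (min t n) ≤ Nat.size n := Nat.size_le_size (min_le_right _ _)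
  simp only [minExpr, RAM.Expr.cost, RAM.Op.cost, RAM.Expr.eval, RAM.Op.eval, setCoverInput,
    Nat.size_one, Nat.size_zero]
  omega

theorem le_big {n : ℕ} : 27 * D.R ^ D.blocks n * D.blocks n ≤ D.big n ∧
    2 ^ (D.m * D.blocks n) ≤ D.big n ∧ D.R * D.p ^ 2 ≤ D.big n := by
  have h1 : 0 < D.R ^ D.blocks n := Nat.pow_pos D.R_pos
  have h2 : 0 < D.blocks n := Nat.succ_pos _
  have h3 : 0 < 2 ^ (D.m * D.blocks n) := by positivity
  have h4 : 0 < D.R * D.p ^ 2 := Nat.mul_pos D.R_pos (Nat.pow_pos D.prime.pos)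
  refine ⟨?_, ?_, ?_⟩
  · rw [big, mul_assoc _ _ (D.R * D.p ^ 2)]
    exact Nat.le_mul_of_pos_right _ (by positivity)
  · rw [big, mul_right_comm]
    exact Nat.le_mul_of_pos_left _ (by positivity)
  · exact Nat.le_mul_of_pos_left _ (by positivity)

theorem length_le_two_pow {n : ℕ} {L : List (Finset (Fin n))} (hL : L.Nodup) :
    L.length ≤ 2 ^ n := by
  rw [← List.toFinset_card_of_nodup hL]
  exact (Finset.card_le_univ _).trans (by simp)

/-- A bound for the running time of the program, in units of `(b + 1) ^ 2`. -/
def cost (n ℓ : ℕ) : ℕ :=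
  D.blocksCmd.weight + D.setupCmd.weight * (n + D.blocks n + 1) +
    D.coverNumbersCmd.weight * ((ℓ + 1) * ((D.R ^ D.blocks n + 1) * (D.blocks n + 1))) +
    (9 * (3 * D.R ^ D.blocks n) + 1) * (coinWeight + forWeight 24 coinBound) +
    D.searchCmd.weight * ((9 + 1) * ((n + 1 + 1) * ((n + 1 + 1) *
      ((3 * D.R ^ D.blocks n * D.blocks n + 1) * (D.R + 1))))) +
    RAM.storeWeight (.const 0) (scalar 15) + 6

/-- The cover numbers `f` are computed before the coins are tossed, so they are the same for all
outcomes, and the probability concerns the weights only. -/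
theorem exec_program {n : ℕ} (t : ℕ) (L : List (Finset (Fin n))) (hL : L.Nodup) :
    ∃ f : ℕ → ℕ,
      (∀ i < D.R ^ D.blocks n, f i ≤ n + 1 ∧
        (f i ≤ n → ∃ G ⊆ Finset.range L.length, G.card ≤ f i ∧ D.Covers (listCode L) n G i) ∧
        ∀ G ⊆ Finset.range L.length, D.Covers (listCode L) n G i → f i ≤ G.card) ∧
      ∀ coins : Fin (9 * (3 * D.R ^ D.blocks n)) → Bool, ∃ M' : RAM.Memory, ∃ t' : ℕ,
        RAM.Exec D.program (setCoverInput n t L) (List.ofFn coins) M' [] t' ∧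
        t' ≤ 6 * Nat.size t + 3 * Nat.size n + 20 +
          D.cost n L.length * (Nat.size (D.big n) + 1) ^ 2 ∧
        (M' 0 = 1 ↔ ∃ ρ < 9, ∃ j₁ ≤ min t n, ∃ j₂ ≤ min t n,
          D.Hit (D.blocks n) (min t n) f (coinBits coins) ρ j₁ j₂) := by
  set r := D.blocks n with hr
  set N := D.R ^ r with hN
  set I := cappedInput t L with hIdef
  set b := Nat.size (D.big n) with hb
  obtain ⟨big1, big2, big3⟩ := D.le_big (n := n)
  have hr0 : 0 < r := Nat.succ_pos _
  have hN0 : 0 < N := Nat.pow_pos D.R_pos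
  have b27 : 27 * N ≤ D.big n := (Nat.le_mul_of_pos_right _ hr0).trans big1
  have br : r ≤ D.big n :=
    (Nat.le_mul_of_pos_left _ (by positivity : 0 < 27 * N)).trans big1
  have b3 : 3 * N * r ≤ D.big n :=
    le_trans (Nat.mul_le_mul_right _ (show 3 * N ≤ 27 * N by omega)) big1
  have bN : D.R ^ D.blocks n ≤ D.big n := le_trans (show N ≤ 27 * N by omega) b27
  have hnm : 2 ^ n ≤ D.big n :=
    (Nat.pow_le_pow_right (by norm_num) (D.le_blocks n)).trans big2
  have hn2 : n + 1 ≤ D.big n := Nat.lt_two_pow_self.trans_le hnm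
  have I0 : I 0 = n := rfl
  have I1 : I 1 = min t n := rfl
  have I2 : I 2 = L.length := rfl
  have I3 : ∀ x, I (3 + x) = listCode L x := cappedInput_add_three t L
  have hIle : ∀ a, I a ≤ D.big n := by
    intro a
    match a with
    | 0 => rw [I0]; omega
    | 1 => rw [I1]; exact (min_le_right _ _).trans (by omega)
    | 2 => rw [I2]; exact (length_le_two_pow hL).trans hnm
    | x + 3 => rw [add_comm, I3]; exact (listCode_lt L x).le.trans hnm
  have hI : ∀ a, Nat.size (I a) ≤ b := fun a => Nat.size_le_size (hIle a)
  have hb1 : 1 ≤ b := by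
    rw [hb, ← Nat.size_one]; exact Nat.size_le_size (by omega)
  have z0 : ∀ (c : Fin 32) (i : ℕ), Nat.size ((0 : Store) c i) ≤ b := fun c i => by simp
  have sp1 := D.spec_blocksCmd I0 (Nat.size_le_size br) (0 : Store)
  set σ₁ := D.blocksCmd.run I 0 with hσ₁
  have s1 := D.blocksCmd.size_run z0 sp1.1
  have sp2 := D.spec_setupCmd I0 le_rfl σ₁ sp1.2 br bN big2
  set σ₂ := D.setupCmd.run I σ₁ with hσ₂
  have s2 := D.setupCmd.size_run s1 sp2.1
  have a20 : σ₂ 0 0 = r :=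
    (congrFun (D.setupCmd.run_eq rfl σ₁) 0).trans sp1.2
  obtain ⟨a21, a22⟩ := sp2.2
  have sp3 := D.spec_coverNumbersCmd I0 I2 (listCode L) (fun x _ => ⟨I3 x,
    (listCode_lt L x).le.trans hnm⟩) le_rfl σ₂ br bN big2 hn2
    ((length_le_two_pow hL).trans hnm) a20 a21 a22
  set σ₃ := D.coverNumbersCmd.run I σ₂ with hσ₃
  have s3 := D.coverNumbersCmd.size_run s2 sp3.1
  have e30 : σ₃ 0 0 = r := (congrFun (D.coverNumbersCmd.run_eq rfl σ₂) 0).trans a20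
  have e31 : σ₃ 1 0 = N := (congrFun (D.coverNumbersCmd.run_eq rfl σ₂) 0).trans a21
  have e318 : σ₃ 18 = 0 := (D.coverNumbersCmd.run_eq rfl σ₂).trans
    ((D.setupCmd.run_eq rfl σ₁).trans (D.blocksCmd.run_eq rfl 0))
  refine ⟨σ₃ 17, sp3.2, fun coins => ?_⟩
  obtain ⟨σ₄, s4, e418, e4, t₄, ht₄, x₄⟩ := exec_coinProg hI σ₃ s3 (by rw [e31])
    (Nat.size_le_size (by omega)) hb1 e318 coins
  have e40 : σ₄ 0 0 = r := by rw [e4 0 (by decide) (by decide), e30]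
  have e41 : σ₄ 1 0 = N := by rw [e4 1 (by decide) (by decide), e31]
  have e417 : σ₄ 17 = σ₃ 17 := e4 17 (by decide) (by decide)
  have sp5 := D.spec_searchCmd le_rfl σ₄ r (min t n) I1 hr0 e40 e41 b3 big3
    ((Nat.add_le_add_right (min_le_right t n) 1).trans hn2)
    (by omega) (fun j _ => by rw [e418]; exact coinBits_le_one _ _)
  set σ₅ := D.searchCmd.run I σ₄ with hσ₅
  have s5 := D.searchCmd.size_run s4 sp5.1
  obtain ⟨t₀, ht₀, x₀⟩ := exec_capThreshold t L (List.ofFn coins)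
  obtain ⟨t₁, ht₁, x₁⟩ := D.blocksCmd.exec_compile hI rfl 0 z0 sp1.1 (List.ofFn coins)
  obtain ⟨t₂, ht₂, x₂⟩ := D.setupCmd.exec_compile hI rfl σ₁ s1 sp2.1 (List.ofFn coins)
  obtain ⟨t₃, ht₃, x₃⟩ := D.coverNumbersCmd.exec_compile hI rfl σ₂ s2 sp3.1 (List.ofFn coins)
  obtain ⟨t₅, ht₅, x₅⟩ := D.searchCmd.exec_compile hI rfl σ₄ s4 sp5.1 []
  obtain ⟨t₆, ht₆, x₆⟩ := RAM.exec_store (size_mem hI s5) (.const 0) (scalar 15) []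
  refine ⟨_, _, x₀.seq (x₁.seq (x₂.seq (x₃.seq (x₄.seq (x₅.seq x₆))))), ?_, ?_⟩
  · have w₁ : D.blocksCmd.time I 0 ≤ D.blocksCmd.weight := le_rfl
    have w₂ : D.setupCmd.time I σ₁ ≤ _ := D.timeLe_setupCmd I0 σ₁ sp1.2
    have w₃ : D.coverNumbersCmd.time I σ₂ ≤ _ := D.timeLe_coverNumbersCmd I2 σ₂ a20 a21
    have w₅ : D.searchCmd.time I σ₄ ≤ _ := D.timeLe_searchCmd I1 σ₄ e40 e41 hr0
    have w₅' : D.searchCmd.time I σ₄ ≤ D.searchCmd.weight * ((9 + 1) * ((n + 1 + 1) *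
        ((n + 1 + 1) * ((3 * N * r + 1) * (D.R + 1))))) := by
      refine w₅.trans (Nat.mul_le_mul_left _ (Nat.mul_le_mul_left _ ?_))
      have : min t n ≤ n := min_le_right _ _
      exact Nat.mul_le_mul (by omega) (Nat.mul_le_mul_right _ (by omega))
    have y₁ := ht₁.trans (Nat.mul_le_mul_right _ w₁)
    have y₂ := ht₂.trans (Nat.mul_le_mul_right _ w₂)
    have y₃ := ht₃.trans (Nat.mul_le_mul_right _ w₃)
    have y₅ := ht₅.trans (Nat.mul_le_mul_right _ w₅')
    have hq : 1 ≤ (b + 1) ^ 2 := Nat.one_le_pow _ _ (by omega)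
    refine (?_ : _ ≤ (6 * Nat.size t + 3 * Nat.size n + 20) + _ * (b + 1) ^ 2)
    generalize (b + 1) ^ 2 = q at *
    rw [cost]
    simp only [Nat.add_mul _ _ q]
    have h : ∀ {A₀ A₁ A₂ A₃ A₄ A₅ A₆ : ℕ}, t₀ ≤ A₀ → t₁ ≤ A₁ → t₂ ≤ A₂ → t₃ ≤ A₃ → t₄ ≤ A₄ →
        t₅ ≤ A₅ → t₆ ≤ A₆ → t₀ + (t₁ + (t₂ + (t₃ + (t₄ + (t₅ + t₆ + 1) + 1) + 1) + 1) + 1) + 1 ≤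
          A₀ + (A₁ + A₂ + A₃ + A₄ + A₅ + A₆ + 6 * q) := by
      intros; omega
    exact h ht₀ y₁ y₂ y₃ ht₄ y₅ ht₆
  · change Function.update _ 0 _ 0 = 1 ↔ _
    rw [Function.update_self, eval_scalar, sp5.2.2, e417, e418]

end CoverScheme

/-! ### Asymptotic running time -/

theorem length_le_of_card_le {n s : ℕ} {L : List (Finset (Fin n))} (hL : L.Nodup)
    (hs : ∀ X ∈ L, X.card ≤ s) : L.length ≤ (s + 1) * (n + 1) ^ s := by
  classical
  rw [← List.toFinset_card_of_nodup hL]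
  have h : L.toFinset ⊆ (Finset.range (s + 1)).biUnion fun j =>
      Finset.powersetCard j (Finset.univ : Finset (Fin n)) := by
    intro X hX
    have := hs X (by simpa using hX)
    simp only [Finset.mem_biUnion, Finset.mem_range, Finset.mem_powersetCard]
    exact ⟨X.card, by omega, Finset.subset_univ _, rfl⟩
  refine (Finset.card_le_card h).trans (Finset.card_biUnion_le.trans ?_)
  refine (Finset.sum_le_card_nsmul _ _ ((n + 1) ^ s) fun j hj => ?_).trans (by simp)
  rw [Finset.card_powersetCard, Finset.card_univ, Fintype.card_fin]
  refine (Nat.choose_le_pow n j).trans ?_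
  refine (Nat.pow_le_pow_left (Nat.le_succ n) j).trans (Nat.pow_le_pow_right (by omega) ?_)
  have := Finset.mem_range.1 hj
  omega

theorem exists_pow_le_mul_rpow (k : ℕ) {δ : ℝ} (hδ : 0 < δ) :
    ∃ C : ℝ, 0 ≤ C ∧ ∀ n : ℕ, ((n : ℝ) + 1) ^ k ≤ C * 2 ^ (δ * (n : ℝ)) := by
  have hr : (1 : ℝ) < 2 ^ δ := Real.one_lt_rpow (by norm_num) hδ
  obtain ⟨B, hB⟩ := (tendsto_pow_const_div_const_pow_of_one_lt k hr).bddAbove_range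
  have hr0 : (0 : ℝ) < 2 ^ δ := by positivity
  refine ⟨|B| * 2 ^ δ, by positivity, fun n => ?_⟩
  have h := hB ⟨n + 1, rfl⟩
  simp only at h
  rw [div_le_iff₀ (by positivity)] at h
  push_cast at h
  rw [Real.rpow_mul (by norm_num), Real.rpow_natCast, mul_assoc, mul_comm ((2 : ℝ) ^ δ), ← pow_succ]
  exact h.trans (mul_le_mul_of_nonneg_right (le_abs_self B) (by positivity))

namespace CoverScheme

open ArrayLang

variable {s : ℕ} (D : CoverScheme s)

theorem blocks_le (n : ℕ) : D.blocks n ≤ n + 1 :=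
  Nat.succ_le_succ (Nat.div_le_self _ _)

theorem exists_size_big_le : ∃ κ : ℕ, ∀ n, Nat.size (D.big n) + 1 ≤ κ * (n + 1) := by
  set A := Nat.size D.R
  set B := Nat.size (D.R * D.p ^ 2)
  refine ⟨5 + A + 1 + D.m + B + 1, fun n => ?_⟩
  have hr := D.blocks_le n
  set r := D.blocks n with hrdef
  have h1 : D.R ^ r ≤ 2 ^ (A * r) := by
    rw [pow_mul]
    exact Nat.pow_le_pow_left (Nat.lt_size_self _).le _
  have h2 : D.big n < 2 ^ (5 + A * r + r + D.m * r + B) := by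
    rw [big, ← hrdef, pow_add, pow_add, pow_add, pow_add]
    have h3 : D.R * D.p ^ 2 < 2 ^ B := Nat.lt_size_self _
    have h4 : 27 * D.R ^ r * r * 2 ^ (D.m * r) ≤
        2 ^ 5 * 2 ^ (A * r) * 2 ^ r * 2 ^ (D.m * r) :=
      Nat.mul_le_mul_right _ (Nat.mul_le_mul (Nat.mul_le_mul (by norm_num) h1)
        Nat.lt_two_pow_self.le)
    exact Nat.mul_lt_mul_of_le_of_lt h4 h3 (by positivity)
  have h5 := Nat.size_le.2 h2
  have h6 := Nat.mul_le_mul_left A hr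
  have h7 := Nat.mul_le_mul_left D.m hr
  have h8 : B ≤ B * (n + 1) := Nat.le_mul_of_pos_right _ (by omega)
  simp only [add_mul]
  omega

theorem exists_cost_le : ∃ κ : ℕ, ∀ n ℓ,
    D.cost n ℓ ≤ κ * ((ℓ + 1) * D.R ^ D.blocks n * (n + 1) ^ 3) := by
  refine ⟨D.blocksCmd.weight + D.setupCmd.weight * 2 + D.coverNumbersCmd.weight * 4 +
    28 * (coinWeight + forWeight 24 coinBound) + D.searchCmd.weight * (160 * (D.R + 1)) +
    RAM.storeWeight (.const 0) (scalar 15) + 6, fun n ℓ => ?_⟩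
  have hr := D.blocks_le n
  have hN : 1 ≤ D.R ^ D.blocks n := Nat.pow_pos D.R_pos
  rw [cost]
  set r := D.blocks n
  set N := D.R ^ r
  set x := n + 1 with hx
  have hx1 : 1 ≤ x := by omega
  have hx3 : x ≤ x ^ 3 := Nat.le_self_pow (by norm_num) x
  set P := (ℓ + 1) * N * x ^ 3 with hP
  have hNP : N * x ^ 3 ≤ P := by
    rw [hP, mul_assoc]; exact Nat.le_mul_of_pos_left _ (by omega)
  have hxP : x ≤ P := hx3.trans ((Nat.le_mul_of_pos_left _ (by omega)).trans hNP)
  have hN' : N ≤ P := (Nat.le_mul_of_pos_right _ (by positivity)).trans hNP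
  have hP1 : 1 ≤ P := hx1.trans hxP
  have c1 : n + r + 1 ≤ 2 * P := by omega
  have c2 : (ℓ + 1) * ((N + 1) * (r + 1)) ≤ 4 * P := by
    have : (N + 1) * (r + 1) ≤ (2 * N) * (2 * x ^ 3) := Nat.mul_le_mul (by omega) (by omega)
    calc _ ≤ (ℓ + 1) * ((2 * N) * (2 * x ^ 3)) := Nat.mul_le_mul_left _ this
      _ = 4 * P := by rw [hP]; ring
  have c3 : 9 * (3 * N) + 1 ≤ 28 * P := by omega
  have c4 : (9 + 1) * ((x + 1) * ((x + 1) * ((3 * N * r + 1) * (D.R + 1)))) ≤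
      160 * (D.R + 1) * P := by
    have h1 : 3 * N * r ≤ 3 * N * x := Nat.mul_le_mul_left _ hr
    have h2 : 1 ≤ N * x := Nat.mul_pos hN hx1
    have h3 : 3 * N * r + 1 ≤ 4 * (N * x) := by
      simp only [mul_assoc] at h1 ⊢; omega
    calc _ ≤ (9 + 1) * ((2 * x) * ((2 * x) * ((4 * (N * x)) * (D.R + 1)))) := by
          gcongr <;> omega
      _ = 160 * (D.R + 1) * (N * x ^ 3) := by ring
      _ ≤ _ := Nat.mul_le_mul_left _ hNP
  have d0 : D.blocksCmd.weight ≤ D.blocksCmd.weight * P := Nat.le_mul_of_pos_right _ hP1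
  have d1 := Nat.mul_le_mul_left D.setupCmd.weight c1
  have d2 := Nat.mul_le_mul_left D.coverNumbersCmd.weight c2
  have d3 := Nat.mul_le_mul_right (coinWeight + forWeight 24 coinBound) c3
  have d4 := Nat.mul_le_mul_left D.searchCmd.weight c4
  have d5 : RAM.storeWeight (.const 0) (scalar 15) ≤
    RAM.storeWeight (.const 0) (scalar 15) * P := Nat.le_mul_of_pos_right _ hP1
  calc _ ≤ _ := Nat.add_le_add (Nat.add_le_add (Nat.add_le_add (Nat.add_le_add (Nat.add_le_add
        (Nat.add_le_add d0 d1) d2) d3) d4) d5) (Nat.mul_le_mul_left 6 hP1)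
    _ = _ := by ring

theorem exists_time_le (t' : ℕ) : ∃ κ : ℕ, ∀ (n t : ℕ) (L : List (Finset (Fin n))), L.Nodup →
    (∀ X ∈ L, X.card ≤ t') → 6 * Nat.size t + 3 * Nat.size n + 20 +
      D.cost n L.length * (Nat.size (D.big n) + 1) ^ 2 ≤
        6 * Nat.size t + κ * (D.R ^ D.blocks n * (n + 1) ^ (t' + 5)) := by
  obtain ⟨κ₁, h₁⟩ := D.exists_cost_le
  obtain ⟨κ₂, h₂⟩ := D.exists_size_big_le
  refine ⟨23 + κ₁ * (t' + 2) * κ₂ ^ 2, fun n t L hL ht => ?_⟩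
  have hN : 1 ≤ D.R ^ D.blocks n := Nat.pow_pos D.R_pos
  have hℓ : L.length + 1 ≤ (t' + 2) * (n + 1) ^ t' := by
    have := length_le_of_card_le hL ht
    have h1 : 1 ≤ (n + 1) ^ t' := Nat.one_le_pow _ _ (by omega)
    calc _ ≤ (t' + 1) * (n + 1) ^ t' + (n + 1) ^ t' := by omega
      _ = _ := by ring
  have h3 : D.cost n L.length * (Nat.size (D.big n) + 1) ^ 2 ≤
      κ₁ * (((t' + 2) * (n + 1) ^ t') * D.R ^ D.blocks n * (n + 1) ^ 3) * (κ₂ * (n + 1)) ^ 2 :=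
    Nat.mul_le_mul ((h₁ n _).trans (by gcongr)) (Nat.pow_le_pow_left (h₂ n) 2)
  have h4 : Nat.size n ≤ n := Nat.size_le.2 Nat.lt_two_pow_self
  have h5 : n + 1 ≤ D.R ^ D.blocks n * (n + 1) ^ (t' + 5) :=
    (Nat.le_self_pow (by omega) _).trans (Nat.le_mul_of_pos_left _ (by omega))
  calc _ ≤ 6 * Nat.size t + 23 * (D.R ^ D.blocks n * (n + 1) ^ (t' + 5)) +
        κ₁ * (((t' + 2) * (n + 1) ^ t') * D.R ^ D.blocks n * (n + 1) ^ 3) *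
          (κ₂ * (n + 1)) ^ 2 := by omega
    _ = _ := by ring

/-- The error is one-sided: without a cover no outcome of the coins gives a hit, and with a cover a
suitable pair of quotas is hit with probability at least `2/3`. -/
theorem decidesWithin {t' n t : ℕ} (D : CoverScheme (t' + 1)) (L : List (Finset (Fin n)))
    (hL : L.Nodup) (hs : ∀ X ∈ L, X.card ≤ t') {τ : ℝ}
    (hτ : ((6 * Nat.size t + 3 * Nat.size n + 20 +
      D.cost n L.length * (Nat.size (D.big n) + 1) ^ 2 : ℕ) : ℝ) ≤ τ) :
    RAM.DecidesWithin D.program (setCoverInput n t L) (HasSetCover L.toFinset t) τ := by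
  classical
  obtain ⟨f, hf, hex⟩ := D.exec_program t L hL
  refine ⟨9 * (3 * D.R ^ D.blocks n), fun b => ?_, ?_⟩
  · obtain ⟨M', c, hx, hc, -⟩ := hex b
    exact ⟨M', [], c, hx, (Nat.cast_le.2 hc).trans hτ⟩
  have hmono : ∀ P Q : (Fin (9 * (3 * D.R ^ D.blocks n)) → Bool) → Prop, (∀ b, P b → Q b) →
      Nat.card {b // P b} ≤ Nat.card {b // Q b} := fun P Q h =>
    Nat.card_le_card_of_injective (Subtype.map id h) (Subtype.map_injective h Function.injective_id)
  have hreal : ∀ A B : ℕ, 2 * 2 ^ A ≤ 3 * B → (2 / 3 : ℝ) * 2 ^ A ≤ B := fun A B h => by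
    have : (2 * 2 ^ A : ℝ) ≤ 3 * B := by exact_mod_cast h
    linarith
  by_cases hc : HasSetCover L.toFinset t
  · obtain ⟨j₁, j₂, hj, x, hx, hq, hne⟩ := exists_digits_of_hasSetCover D L hs
      (fun i hi => (hf i hi).2.2) hc
    have h1 := D.card_hit hj x hx hq hne
    have h2 := hmono _ (fun b => ∃ (M' : RAM.Memory) (b' : List Bool) (c : ℕ),
        RAM.Exec D.program (setCoverInput n t L) (List.ofFn b) M' b' c ∧
          (M' 0 = 1 ↔ HasSetCover L.toFinset t))
        (fun b (hb : ∃ ρ < 9, D.Hit (D.blocks n) (min t n) f (coinBits b) ρ j₁ j₂) => by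
      obtain ⟨M', c, hx, -, h0⟩ := hex b
      obtain ⟨ρ, hρ, hh⟩ := hb
      exact ⟨M', [], c, hx, fun _ => hc,
        fun _ => h0.2 ⟨ρ, hρ, j₁, by omega, j₂, by omega, hh⟩⟩)
    exact hreal _ _ (h1.trans (Nat.mul_le_mul_left 3 h2))
  · have h2 := hmono (fun _ => True) (fun b => ∃ (M' : RAM.Memory) (b' : List Bool) (c : ℕ),
        RAM.Exec D.program (setCoverInput n t L) (List.ofFn b) M' b' c ∧
          (M' 0 = 1 ↔ HasSetCover L.toFinset t)) (fun b _ => by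
      obtain ⟨M', c, hx, -, h0⟩ := hex b
      refine ⟨M', [], c, hx, fun h => ?_, fun h => absurd h hc⟩
      obtain ⟨ρ, hρ, j₁, _, j₂, _, hh⟩ := h0.1 h
      exact D.hasSetCover_of_hit L (fun i hi => (hf i hi).2.1) hh)
    have h3 : Nat.card {b : Fin (9 * (3 * D.R ^ D.blocks n)) → Bool // True} =
        2 ^ (9 * (3 * D.R ^ D.blocks n)) := by
      simp [Nat.card_eq_fintype_card]
    rw [h3] at h2
    exact hreal _ _ (by omega)

/-- The `s`-dependent polynomial factors, from the number of sets, the number of quotas and the bit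
lengths, are absorbed by giving up half of `δ`. -/
theorem exists_solvesSetCover {t' : ℕ} (D : CoverScheme (t' + 1)) {δ : ℝ} (hδ : 0 < δ)
    (hδ1 : δ ≤ 1) (hR : (D.R : ℝ) ≤ 2 ^ ((1 - δ) * (D.m : ℝ))) :
    ∃ (p : RAM.Prog) (C : ℝ), SolvesSetCover t' p (fun n t =>
      C * ((2 : ℝ) ^ ((1 - δ / 2) * (n : ℝ)) + (Nat.size t : ℝ))) := by
  obtain ⟨κ, hκ⟩ := D.exists_time_le t'
  obtain ⟨C, hC0, hC⟩ := exists_pow_le_mul_rpow (t' + 5) (half_pos hδ)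
  set B : ℝ := κ * ((2 : ℝ) ^ ((1 - δ) * (D.m : ℝ)) * C) with hB
  have hB0 : 0 ≤ B := by positivity
  refine ⟨D.program, 6 + B, fun n t L hL hs => D.decidesWithin L hL hs ?_⟩
  refine (Nat.cast_le.2 (hκ n t L hL hs)).trans ?_
  push_cast
  -- There is at most one block more than `n / m`, which accounts for the constant factor.
  have h1 : (D.R : ℝ) ^ D.blocks n ≤ 2 ^ ((1 - δ) * (D.m : ℝ)) * 2 ^ ((1 - δ) * (n : ℝ)) := by
    refine (pow_le_pow_left₀ (Nat.cast_nonneg _) hR _).trans ?_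
    rw [← Real.rpow_mul_natCast (by norm_num), ← Real.rpow_add (by norm_num)]
    refine Real.rpow_le_rpow_of_exponent_le (by norm_num) ?_
    rw [blocks]
    push_cast
    have h : (D.m : ℝ) * ((n / D.m : ℕ) : ℝ) ≤ n := by exact_mod_cast Nat.mul_div_le n D.m
    nlinarith
  have h2 : (D.R : ℝ) ^ D.blocks n * ((n : ℝ) + 1) ^ (t' + 5) ≤
      2 ^ ((1 - δ) * (D.m : ℝ)) * C * 2 ^ ((1 - δ / 2) * (n : ℝ)) := by
    calc _ ≤ (2 ^ ((1 - δ) * (D.m : ℝ)) * 2 ^ ((1 - δ) * (n : ℝ))) *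
          (C * (2 : ℝ) ^ (δ / 2 * (n : ℝ))) :=
          mul_le_mul h1 (hC n) (by positivity) (by positivity)
      _ = 2 ^ ((1 - δ) * (D.m : ℝ)) * C * (2 ^ ((1 - δ) * (n : ℝ)) * 2 ^ (δ / 2 * (n : ℝ))) := by
          ring
      _ = _ := by rw [← Real.rpow_add (by norm_num)]; congr 2; ring
  have h3 := mul_le_mul_of_nonneg_left h2 (Nat.cast_nonneg (α := ℝ) κ)
  have h4 : (0 : ℝ) ≤ B * Nat.size t := by positivity
  have h5 : (0 : ℝ) ≤ 2 ^ ((1 - δ / 2) * (n : ℝ)) := by positivity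
  have h6 : (κ : ℝ) * (2 ^ ((1 - δ) * (D.m : ℝ)) * C * 2 ^ ((1 - δ / 2) * (n : ℝ))) =
    B * 2 ^ ((1 - δ / 2) * (n : ℝ)) := by rw [hB]; ring
  rw [h6] at h3
  nlinarith

end CoverScheme

/-! ### The theorem of Beck and Fiala, and balanced colourings -/

namespace BeckFiala

/-- There are more unknowns, indexed by `Q`, than homogeneous linear equations, indexed by `A`. -/
theorem exists_kernel_vector {α β : Type*} [Fintype β] (w : β → α → ℝ) (Q : Finset α)
    (A : Finset β) (h : A.card < Q.card) : ∃ z : α → ℝ, (∀ i ∉ Q, z i = 0) ∧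
      (∃ i ∈ Q, z i ≠ 0) ∧ ∀ v ∈ A, ∑ i ∈ Q, w v i * z i = 0 := by
  classical
  let f : (Q → ℝ) →ₗ[ℝ] (A → ℝ) := (Matrix.of fun (v : A) (i : Q) => w v i).mulVecLin
  have hf : LinearMap.ker f ≠ ⊥ := LinearMap.ker_ne_bot_of_finrank_lt (by simpa using h)
  obtain ⟨z, hz, hz0⟩ := Submodule.exists_mem_ne_zero_of_ne_bot hf
  refine ⟨fun i => if hi : i ∈ Q then z ⟨i, hi⟩ else 0, fun i hi => by simp [hi], ?_, ?_⟩
  · obtain ⟨i, hi⟩ := Function.ne_iff.1 hz0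
    exact ⟨i, i.2, by simpa using hi⟩
  · intro v hv
    have h1 := congrFun (LinearMap.mem_ker.1 hz) ⟨v, hv⟩
    rw [← Finset.sum_coe_sort]
    simpa [f, Matrix.mulVec, dotProduct] using h1

/-- A point of the open cube can be moved in a given direction until it hits the boundary. -/
theorem exists_boundary_point {α : Type*} (Q : Finset α) (x z : α → ℝ)
    (hx : ∀ i ∈ Q, 0 < x i ∧ x i < 1) (hz : ∃ i ∈ Q, z i ≠ 0) :
    ∃ c : ℝ, (∀ i ∈ Q, 0 ≤ x i + c * z i ∧ x i + c * z i ≤ 1) ∧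
      ∃ i ∈ Q, x i + c * z i = 0 ∨ x i + c * z i = 1 := by
  classical
  -- The time at which the moving coordinate `i` leaves the unit interval. The smallest of these
  -- times is the desired `c`.
  let d : α → ℝ := fun i => if 0 < z i then (1 - x i) / z i else x i / (-z i)
  obtain ⟨i₁, hi₁, hz₁⟩ := hz
  obtain ⟨i₀, hi₀, hmin⟩ := Finset.exists_min_image (Q.filter fun i => z i ≠ 0) d
    ⟨i₁, Finset.mem_filter.2 ⟨hi₁, hz₁⟩⟩
  obtain ⟨hi₀Q, hz₀⟩ := Finset.mem_filter.1 hi₀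
  have hd : ∀ i ∈ Q, z i ≠ 0 → 0 ≤ d i := by
    intro i hi hzi
    obtain ⟨h0, h1⟩ := hx i hi
    simp only [d]
    split_ifs with h
    · exact div_nonneg (by linarith) h.le
    · exact div_nonneg h0.le (by linarith)
  have hd0 := hd i₀ hi₀Q hz₀
  refine ⟨d i₀, fun i hi => ?_, i₀, hi₀Q, ?_⟩
  · obtain ⟨h0, h1⟩ := hx i hi
    rcases lt_trichotomy (z i) 0 with h | h | h
    · have hm := hmin i (Finset.mem_filter.2 ⟨hi, h.ne⟩)
      have e : d i = x i / (-z i) := if_neg (by linarith)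
      rw [e, le_div_iff₀ (by linarith)] at hm
      constructor <;> nlinarith
    · rw [h]; constructor <;> linarith
    · have hm := hmin i (Finset.mem_filter.2 ⟨hi, h.ne'⟩)
      have e : d i = (1 - x i) / z i := if_pos h
      rw [e, le_div_iff₀ h] at hm
      constructor <;> nlinarith
  · rcases lt_or_gt_of_ne hz₀ with h | h
    · left
      have e : d i₀ = x i₀ / (-z i₀) := if_neg (by linarith)
      rw [e]; field_simp; ring
    · right
      have e : d i₀ = (1 - x i₀) / z i₀ := if_pos h
      rw [e]; field_simp; ring

/-- The theorem of Beck and Fiala: if every item has total weight at most `s` in all the blocks,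
then the fractions can be rounded at a change of at most `s` in every block. -/
theorem exists_rounding {α β : Type*} [Fintype β] (w : β → α → ℝ) (hw : ∀ v i, 0 ≤ w v i)
    (P : Finset α) {s : ℝ} (hs0 : 0 ≤ s) (hs : ∀ i ∈ P, ∑ v, w v i ≤ s) (x : α → ℝ)
    (hx : ∀ i ∈ P, 0 ≤ x i ∧ x i ≤ 1) : ∃ y : α → ℝ, (∀ i ∈ P, y i = 0 ∨ y i = 1) ∧
      ∀ v, |∑ i ∈ P, w v i * (y i - x i)| ≤ s := by
  classical
  suffices H : ∀ n : ℕ, ∀ x : α → ℝ, (∀ i ∈ P, 0 ≤ x i ∧ x i ≤ 1) →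
      (P.filter fun i => x i ≠ 0 ∧ x i ≠ 1).card = n → ∃ y : α → ℝ,
        (∀ i ∈ P, y i = 0 ∨ y i = 1) ∧ (∀ i ∈ P, (x i = 0 ∨ x i = 1) → y i = x i) ∧
        ∀ v, |∑ i ∈ P, w v i * (y i - x i)| ≤ s by
    obtain ⟨y, hy, -, hv⟩ := H _ x hx rfl
    exact ⟨y, hy, hv⟩
  intro n
  induction n using Nat.strong_induction_on with
  | _ n ih =>
    intro x hx hn
    set Q := P.filter fun i => x i ≠ 0 ∧ x i ≠ 1 with hQ
    have hQP : Q ⊆ P := Finset.filter_subset _ _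
    have hQx : ∀ i ∈ Q, 0 < x i ∧ x i < 1 := by
      intro i hi
      obtain ⟨hiP, h0, h1⟩ := Finset.mem_filter.1 hi
      exact ⟨lt_of_le_of_ne (hx i hiP).1 h0.symm, lt_of_le_of_ne (hx i hiP).2 h1⟩
    have hPQ : ∀ i ∈ P, i ∉ Q → x i = 0 ∨ x i = 1 := by
      intro i hi hiQ
      by_contra h
      push Not at h
      exact hiQ (Finset.mem_filter.2 ⟨hi, h⟩)
    rcases Q.eq_empty_or_nonempty with hQ0 | hQ0
    · exact ⟨x, fun i hi => hPQ i hi (by simp [hQ0]), fun _ _ _ => rfl, fun v => by simpa using hs0⟩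
    -- Only the blocks with more than `s` fractional weight have to be preserved exactly. Double
    -- counting shows that there are fewer of them than fractional items, since every item
    -- contributes at most `s` in total.
    set A := Finset.univ.filter fun v => s < ∑ i ∈ Q, w v i with hA
    have hcard : A.card < Q.card := by
      rcases A.eq_empty_or_nonempty with h | h
      · rw [h]; exact Finset.card_pos.2 hQ0
      have h1 : (A.card : ℝ) * s < ∑ v ∈ A, ∑ i ∈ Q, w v i := by
        rw [← nsmul_eq_mul, ← Finset.sum_const]
        exact Finset.sum_lt_sum_of_nonempty h fun v hv => (Finset.mem_filter.1 hv).2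
      have h2 : ∑ v ∈ A, ∑ i ∈ Q, w v i ≤ Q.card * s := by
        rw [Finset.sum_comm, ← nsmul_eq_mul, ← Finset.sum_const]
        refine Finset.sum_le_sum fun i hi => le_trans ?_ (hs i (hQP hi))
        exact Finset.sum_le_sum_of_subset_of_nonneg (Finset.subset_univ _) fun v _ _ => hw v i
      by_contra hcon
      have : (Q.card : ℝ) ≤ A.card := by exact_mod_cast not_lt.1 hcon
      nlinarith
    obtain ⟨z, hzQ, hz0, hzA⟩ := exists_kernel_vector w Q A hcard
    obtain ⟨c, hc, i₀, hi₀, hb⟩ := exists_boundary_point Q x z hQx hz0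
    have hx'P : ∀ i ∈ P, i ∉ Q → x i + c * z i = x i := fun i _ hi => by simp [hzQ i hi]
    have hlt : (P.filter fun i => x i + c * z i ≠ 0 ∧ x i + c * z i ≠ 1).card < n := by
      rw [← hn]
      refine Finset.card_lt_card (Finset.ssubset_iff_of_subset ?_ |>.2 ⟨i₀, hi₀, ?_⟩)
      · intro i hi
        obtain ⟨hiP, h⟩ := Finset.mem_filter.1 hi
        by_contra hiQ
        rw [hx'P i hiP hiQ] at h
        exact hiQ (Finset.mem_filter.2 ⟨hiP, h⟩)
      · intro h
        obtain ⟨-, h0, h1⟩ := Finset.mem_filter.1 h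
        rcases hb with hb | hb
        · exact h0 hb
        · exact h1 hb
    have hx' : ∀ i ∈ P, 0 ≤ x i + c * z i ∧ x i + c * z i ≤ 1 := by
      intro i hi
      by_cases hiQ : i ∈ Q
      · exact hc i hiQ
      · rw [hx'P i hi hiQ]; exact hx i hi
    obtain ⟨y, hy, hyx, hyv⟩ := ih _ hlt (fun i => x i + c * z i) hx' rfl
    have hyx' : ∀ i ∈ P, i ∉ Q → y i = x i := by
      intro i hi hiQ
      rw [← hx'P i hi hiQ]
      refine hyx i hi ?_
      rw [hx'P i hi hiQ]
      exact hPQ i hi hiQ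
    refine ⟨y, hy, fun i hi h => hyx' i hi fun hiQ => ?_, fun v => ?_⟩
    · have := hQx i hiQ
      rcases h with h | h <;> linarith
    -- For a block in `A` the move along `z` changes nothing, and induction applies. In any other
    -- block the fractional weight is at most `s`, and every fractional item changes by at most `1`
    -- from now until the end.
    · by_cases hv : v ∈ A
      · have e : ∑ i ∈ P, w v i * (y i - x i) =
            ∑ i ∈ P, w v i * (y i - (x i + c * z i)) + c * ∑ i ∈ Q, w v i * z i := by
          rw [Finset.mul_sum, Finset.sum_subset hQP (f := fun i => c * (w v i * z i)) (by
            intro i _ hi; simp [hzQ i hi]), ← Finset.sum_add_distrib]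
          exact Finset.sum_congr rfl fun i _ => by ring
        rw [e, hzA v hv, mul_zero, add_zero]
        exact hyv v
      · have e : ∑ i ∈ P, w v i * (y i - x i) = ∑ i ∈ Q, w v i * (y i - x i) := by
          refine (Finset.sum_subset hQP fun i hi hiQ => ?_).symm
          rw [hyx' i hi hiQ]; ring
        rw [e]
        have h1 : ∑ i ∈ Q, w v i ≤ s := by
          by_contra h
          exact hv (Finset.mem_filter.2 ⟨Finset.mem_univ _, not_le.1 h⟩)
        refine (Finset.abs_sum_le_sum_abs _ _).trans ((Finset.sum_le_sum fun i hi => ?_).trans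
          h1)
        rw [abs_mul, abs_of_nonneg (hw v i)]
        refine mul_le_of_le_one_right (hw v i) ?_
        have h2 := hQx i hi
        rw [abs_le]
        rcases hy i (hQP hi) with h | h <;> rw [h] <;> constructor <;> linarith

theorem sum_range_mul {K : Type*} [AddCommMonoid K] (f : ℕ → K) (m M : ℕ) :
    ∑ e ∈ Finset.range (m * M), f e =
      ∑ v ∈ Finset.range M, ∑ q ∈ Finset.range m, f (m * v + q) := by
  induction M with
  | zero => simp
  | succ M ih => rw [mul_add_one, Finset.sum_range_add, ih, Finset.sum_range_succ]

/-- Pieces with at most `s` elements can be distributed over three bins so that every block of `m`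
elements is split almost evenly. -/
theorem exists_balanced_coloring {α : Type*} [DecidableEq α] (m M s : ℕ) (piece : ℕ → α)
    (hp : ∀ i, ((Finset.range (m * M)).filter fun e => piece e = i).card ≤ s) :
    ∃ χ : α → ℕ, (∀ i, χ i < 3) ∧ ∀ v < M, ∀ a < 3,
      3 * ((Finset.range m).filter fun q => χ (piece (m * v + q)) = a).card ≤ m + 6 * s := by
  set P := (Finset.range (m * M)).image piece with hP
  let w : Fin M → α → ℝ := fun v i =>
    ∑ q ∈ Finset.range m, if piece (m * v + q) = i then 1 else 0
  have hw : ∀ v i, 0 ≤ w v i := fun v i => Finset.sum_nonneg fun q _ => by split_ifs <;> norm_num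
  have hws : ∀ i, ∑ v, w v i ≤ s := by
    intro i
    have h1 : (((Finset.range (m * M)).filter fun e => piece e = i).card : ℝ) ≤ s := by
      exact_mod_cast hp i
    rw [Finset.card_filter] at h1
    refine le_trans (le_of_eq ?_) h1
    push_cast
    rw [sum_range_mul, Finset.sum_range]
  have hmem : ∀ v : Fin M, ∀ q ∈ Finset.range m, piece (m * v + q) ∈ P := by
    intro v q hq
    refine Finset.mem_image_of_mem _ (Finset.mem_range.2 ?_)
    have h1 := Finset.mem_range.1 hq
    calc m * v + q < m * (v + 1) := by rw [mul_add]; omega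
      _ ≤ m * M := Nat.mul_le_mul_left _ v.2
  have hsum : ∀ (v : Fin M) (h : α → ℝ), ∑ i ∈ P, w v i * h i =
      ∑ q ∈ Finset.range m, h (piece (m * v + q)) := by
    intro v h
    simp only [w, Finset.sum_mul, ite_mul, one_mul, zero_mul]
    rw [Finset.sum_comm]
    refine Finset.sum_congr rfl fun q hq => ?_
    rw [Finset.sum_ite_eq, if_pos (hmem v q hq)]
  -- The first rounding selects about one third of every block for colour `0`.
  obtain ⟨y, hy, hyv⟩ := exists_rounding w hw P (Nat.cast_nonneg s) (fun i _ => hws i) (fun _ => 1 / 3)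
    (fun i _ => by norm_num)
  have hy01 : ∀ i ∈ P, 0 ≤ 1 - y i ∧ 1 - y i ≤ 1 := fun i hi => by
    rcases hy i hi with h | h <;> rw [h] <;> norm_num
  -- The second rounding halves the rest; the items that already have colour `0` get weight zero.
  obtain ⟨y', hy', hyv'⟩ := exists_rounding (fun v i => w v i * (if y i = 1 then 0 else 1))
    (fun v i => mul_nonneg (hw v i) (by split_ifs <;> norm_num)) P (Nat.cast_nonneg s) (fun i _ =>
      (Finset.sum_le_sum fun v _ => mul_le_of_le_one_right (hw v i)
        (by split_ifs <;> norm_num)).trans (hws i)) (fun _ => 1 / 2) (fun i _ => by norm_num)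
  refine ⟨fun i => if y i = 1 then 0 else if y' i = 1 then 1 else 2, fun i => ?_,
    fun v hv a ha => ?_⟩
  · dsimp only; split_ifs <;> norm_num
  have b1 := abs_le.1 (hyv ⟨v, hv⟩)
  have b2 := abs_le.1 (hyv' ⟨v, hv⟩)
  rw [hsum] at b1
  simp only [mul_assoc] at b2
  rw [hsum ⟨v, hv⟩ (fun i => (if y i = 1 then 0 else 1) * (y' i - 1 / 2))] at b2
  simp only at b1 b2
  have hp' : ∀ q ∈ Finset.range m, piece (m * v + q) ∈ P := hmem ⟨v, hv⟩
  let κ : ℕ → ℝ := fun a => ∑ q ∈ Finset.range m, if (if y (piece (m * v + q)) = 1 then 0 else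
    if y' (piece (m * v + q)) = 1 then 1 else 2) = a then 1 else 0
  have hκ : ∀ a, (((Finset.range m).filter fun q => (if y (piece (m * v + q)) = 1 then 0 else
    if y' (piece (m * v + q)) = 1 then 1 else 2) = a).card : ℝ) = κ a := by
    intro a; rw [Finset.card_filter]; push_cast; rfl
  have e0 : ∑ q ∈ Finset.range m, (y (piece (m * v + q)) - 1 / 3) = κ 0 - m / 3 := by
    simp only [κ]
    rw [Finset.sum_sub_distrib]
    simp only [Finset.sum_const, Finset.card_range, nsmul_eq_mul]
    congr 1
    · refine Finset.sum_congr rfl fun q hq => ?_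
      rcases hy _ (hp' q hq) with h | h
      · rw [h, if_neg zero_ne_one]; split_ifs <;> simp_all
      · simp [h]
    · ring
  have e1 : ∑ q ∈ Finset.range m, ((if y (piece (m * v + q)) = 1 then (0 : ℝ) else 1) *
      (y' (piece (m * v + q)) - 1 / 2)) = (κ 1 - κ 2) / 2 := by
    simp only [κ]
    rw [← Finset.sum_sub_distrib, Finset.sum_div]
    refine Finset.sum_congr rfl fun q hq => ?_
    by_cases h1 : y (piece (m * v + q)) = 1 <;> rcases hy' _ (hp' q hq) with h | h <;>
      simp [h1, h] <;> norm_num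
  have e2 : κ 0 + κ 1 + κ 2 = m := by
    simp only [κ]
    rw [← Finset.sum_add_distrib, ← Finset.sum_add_distrib]
    calc _ = ∑ q ∈ Finset.range m, (1 : ℝ) := Finset.sum_congr rfl fun q hq => by
          by_cases h1 : y (piece (m * v + q)) = 1 <;> by_cases h2 : y' (piece (m * v + q)) = 1 <;>
            simp [h1, h2]
      _ = _ := by simp
  rw [e0] at b1
  rw [e1] at b2
  -- The roundings give `|κ 0 - m / 3| ≤ s` and `|κ 1 - κ 2| ≤ 2 * s`, so colour `0` exceeds `m / 3`
  -- by at most `s`, and the others by at most `3 * s / 2`.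
  have hfin : 3 * κ a ≤ m + 6 * s := by
    have hs0 : (0 : ℝ) ≤ s := Nat.cast_nonneg s
    interval_cases a <;> linarith [b1.1, b1.2, b2.1, b2.2]
  rw [← hκ] at hfin
  exact_mod_cast hfin

end BeckFiala

universe u

/-! ### From an arbitrary field to a prime field -/

theorem IsSumOfRankOne.mono {F ι : Type*} [Field F] {T : Tensor F ι} {r r' : ℕ}
    (h : IsSumOfRankOne T r) (hr : r ≤ r') : IsSumOfRankOne T r' := by
  obtain ⟨a, b, c, h⟩ := h
  obtain ⟨d, rfl⟩ := Nat.exists_eq_add_of_le hr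
  refine ⟨Fin.append a 0, Fin.append b 0, Fin.append c 0, fun i j k => ?_⟩
  rw [h, Fin.sum_univ_add]
  simp

theorem isSumOfRankOne_of_tensorRank_le {F ι : Type*} [Field F] [Fintype ι] {T : Tensor F ι}
    {r : ℕ} (h : tensorRank T ≤ r) : IsSumOfRankOne T r :=
  (isSumOfRankOne_tensorRank T).mono h

theorem tensorRank_kroneckerPow_mul_le {F ι : Type*} [Field F] [Fintype ι] (T : Tensor F ι)
    (r n : ℕ) : tensorRank (kroneckerPow T (r * n)) ≤ tensorRank (kroneckerPow T r) ^ n := by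
  induction n with
  | zero =>
    refine Nat.sInf_le ⟨fun _ _ => 1, fun _ _ => 1, fun _ _ => 1, fun i j k => ?_⟩
    change _ = ∑ _l : Fin 1, _
    simp [kroneckerPow]
  | succ n ih =>
    rw [pow_succ]
    exact (tensorRank_kroneckerPow_add T (r * n) r).trans (Nat.mul_le_mul_right _ ih)

/-- Restriction of scalars multiplies the number of rank-one tensors by at most the cube of the
degree of the extension. -/
theorem IsSumOfRankOne.restrictScalars {k K ι : Type*} [Field k] [Field K] [Algebra k K]
    [Module.Finite k K] {T : Tensor k ι} {r : ℕ}
    (h : IsSumOfRankOne (fun x y z => algebraMap k K (T x y z)) r) :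
    IsSumOfRankOne T (r * Module.finrank k K ^ 3) := by
  obtain ⟨a, b, c, h⟩ := h
  let e := Module.finBasis k K
  -- A linear form that does not vanish at `1` recovers the coefficient of `T` from the sum of
  -- products in `K`. Expanding the three factors in a basis turns each product into `finrank ^ 3`
  -- products over `k`.
  obtain ⟨φ, hφ⟩ := Module.Projective.exists_dual_ne_zero k (one_ne_zero (α := K))
  have key := IsSumOfRankOne.of_fintype (T := T)
    (κ := Fin r × Fin (Module.finrank k K) × Fin (Module.finrank k K) × Fin (Module.finrank k K))
    (fun l x => (φ 1)⁻¹ * φ (e l.2.2.2 * e l.2.2.1 * e l.2.1) * e.repr (a l.1 x) l.2.2.2)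
    (fun l x => e.repr (b l.1 x) l.2.2.1) (fun l x => e.repr (c l.1 x) l.2.1) ?_
  · refine key.mono (le_of_eq ?_)
    simp [pow_succ, mul_assoc]
  intro x y z
  have h1 : φ (algebraMap k K (T x y z)) = T x y z * φ 1 := by
    rw [Algebra.algebraMap_eq_smul_one, map_smul, smul_eq_mul]
  have h2 : T x y z = (φ 1)⁻¹ * φ (∑ l, a l x * b l y * c l z) := by
    rw [← h, h1, mul_comm (T x y z), inv_mul_cancel_left₀ hφ]
  rw [h2, map_sum, Finset.mul_sum, Fintype.sum_prod_type]
  refine Finset.sum_congr rfl fun l _ => ?_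
  conv_lhs => rw [← e.sum_repr (a l x), ← e.sum_repr (b l y), ← e.sum_repr (c l z)]
  simp only [Finset.sum_mul, Finset.mul_sum, map_sum, Fintype.sum_prod_type,
    smul_mul_smul_comm, map_smul, smul_eq_mul]
  refine Finset.sum_congr rfl fun u _ => Finset.sum_congr rfl fun v _ =>
    Finset.sum_congr rfl fun w _ => ?_
  ring

theorem Int.isJacobsonRing : IsJacobsonRing ℤ := by
  refine isJacobsonRing_iff_prime_eq.2 fun P hP => ?_
  by_cases h0 : P = ⊥
  · subst h0
    refine (Submodule.eq_bot_iff _).2 fun x hx => ?_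
    -- For `x` in the Jacobson radical of `0`, the number `3 * x ^ 2 + 1` is a unit, so it is `1` or
    -- `-1`, and `x = 0`.
    have h1 := Int.isUnit_iff.1 (Ideal.mem_jacobson_bot.1 hx (3 * x))
    rcases h1 with h1 | h1 <;> nlinarith [sq_nonneg x]
  · have := hP.isMaximal h0
    exact Ideal.jacobson_eq_self_of_isMaximal

/-- In characteristic zero `ℤ` would be a subring over which a field is integral, hence itself a
field. -/
theorem exists_finite_over_zmod (K : Type*) [Field K] [Module.Finite ℤ K] :
    ∃ (p : ℕ) (_ : Fact p.Prime) (_ : Algebra (ZMod p) K), Module.Finite (ZMod p) K := by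
  obtain ⟨p, hp⟩ := CharP.exists K
  refine ⟨p, ⟨(CharP.char_is_prime_or_zero K p).resolve_right ?_⟩, ZMod.algebra K p, ?_⟩
  · rintro rfl
    have := CharP.charP_to_charZero K
    exact Int.not_isField (isField_of_isIntegral_of_isField
      (algebraMap ℤ K).injective_int (Field.toIsField K))
  · let := ZMod.algebra K p
    exact Module.Finite.of_restrictScalars_finite ℤ (ZMod p) K

/-- A decomposition over a field of a tensor with integer coefficients gives one over a finite
extension of a prime field. -/
theorem exists_isSumOfRankOne_finite {F : Type u} {ι : Type*} [Field F] [Finite ι] (t : ι → ι → ι → ℤ) {r : ℕ}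
    (h : IsSumOfRankOne (fun x y z => (t x y z : F)) r) :
    ∃ (p : ℕ) (_ : Fact p.Prime) (K : Type u) (_ : Field K) (_ : Algebra (ZMod p) K)
      (_ : Module.Finite (ZMod p) K), IsSumOfRankOne (fun x y z => (t x y z : K)) r := by
  obtain ⟨a, b, c, h⟩ := h
  let S : Set F := Set.range (fun q : Fin r × ι => a q.1 q.2) ∪
    (Set.range (fun q : Fin r × ι => b q.1 q.2) ∪ Set.range (fun q : Fin r × ι => c q.1 q.2))
  have hS : S.Finite := (Set.finite_range _).union ((Set.finite_range _).union (Set.finite_range _))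
  let A := Algebra.adjoin ℤ S
  have hA : Algebra.FiniteType ℤ A := by
    refine (Subalgebra.fg_iff_finiteType A).1 ?_
    have := Subalgebra.fg_adjoin_finset (R := ℤ) hS.toFinset
    rwa [hS.coe_toFinset] at this
  have ha : ∀ l x, a l x ∈ A := fun l x => Algebra.subset_adjoin (Or.inl ⟨(l, x), rfl⟩)
  have hb : ∀ l x, b l x ∈ A := fun l x => Algebra.subset_adjoin (Or.inr (Or.inl ⟨(l, x), rfl⟩))
  have hc : ∀ l x, c l x ∈ A := fun l x => Algebra.subset_adjoin (Or.inr (Or.inr ⟨(l, x), rfl⟩))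
  -- The coefficients of the decomposition generate a finitely generated ring, and the decomposition
  -- may be reduced modulo any maximal ideal of it. By the Nullstellensatz over the Jacobson ring
  -- `ℤ` the residue field is finite over `ℤ`.
  obtain ⟨M, hM⟩ := Ideal.exists_maximal A
  let := Ideal.Quotient.field M
  have := Int.isJacobsonRing
  have hfin : Module.Finite ℤ (A ⧸ M) := finite_of_finite_type_of_isJacobsonRing ℤ (A ⧸ M)
  obtain ⟨p, hp, hK, hfinp⟩ := exists_finite_over_zmod (A ⧸ M)
  refine ⟨p, hp, A ⧸ M, inferInstance, hK, hfinp,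
    fun l x => Ideal.Quotient.mk M ⟨a l x, ha l x⟩, fun l x => Ideal.Quotient.mk M ⟨b l x, hb l x⟩,
    fun l x => Ideal.Quotient.mk M ⟨c l x, hc l x⟩, fun x y z => ?_⟩
  have h1 : ((t x y z : ℤ) : A) = ∑ l, (⟨a l x, ha l x⟩ : A) * ⟨b l y, hb l y⟩ * ⟨c l z, hc l z⟩ := by
    apply Subtype.ext
    have := h x y z
    push_cast
    exact this
  have h2 := congrArg (Ideal.Quotient.mk M) h1
  simp only [map_intCast, map_sum, map_mul] at h2
  exact h2

/-- The coefficients of the Kronecker powers of the tripartition tensor. -/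
def tripartitionCoeff (k r : ℕ) (x y z : Fin r → {S : Finset (Fin (3 * k)) // S.card = k}) : ℤ :=
  ∏ m, if (x m).1 ∪ (y m).1 ∪ (z m).1 = Finset.univ then 1 else 0

theorem kroneckerPow_tripartitionTensor (F : Type*) [Field F] (k r : ℕ) :
    kroneckerPow (tripartitionTensor F k) r =
      fun x y z => (tripartitionCoeff k r x y z : F) := by
  funext x y z
  simp [kroneckerPow, tripartitionTensor, tripartitionCoeff]

/-- A decomposition of a power of the tripartition tensor over a field gives decompositions over a
prime field. -/
theorem exists_prime_isSumOfRankOne (F : Type*) [Field F] {k r₀ ρ : ℕ}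
    (h : tensorRank (kroneckerPow (tripartitionTensor F k) r₀) ≤ ρ) :
    ∃ (p : ℕ) (_ : Fact p.Prime) (d : ℕ), ∀ n,
      IsSumOfRankOne (kroneckerPow (tripartitionTensor (ZMod p) k) (r₀ * n)) (ρ ^ n * d) := by
  have h0 := isSumOfRankOne_of_tensorRank_le h
  rw [kroneckerPow_tripartitionTensor] at h0
  obtain ⟨p, hp, K, hK, hA, hfin, h1⟩ := exists_isSumOfRankOne_finite _ h0
  rw [← kroneckerPow_tripartitionTensor] at h1
  -- Powers are taken over `K`, and scalars are restricted only afterwards, so that the factor does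
  -- not grow with `n`.
  refine ⟨p, hp, Module.finrank (ZMod p) K ^ 3, fun n => ?_⟩
  have h2 : tensorRank (kroneckerPow (tripartitionTensor K k) (r₀ * n)) ≤ ρ ^ n :=
    (tensorRank_kroneckerPow_mul_le _ r₀ n).trans (Nat.pow_le_pow_left (Nat.sInf_le h1) n)
  refine IsSumOfRankOne.restrictScalars (K := K) ?_
  have h3 := isSumOfRankOne_of_tensorRank_le h2
  rw [kroneckerPow_tripartitionTensor] at h3 ⊢
  simpa using h3

/-! ### Covering schemes from decompositions of powers of the tripartition tensor -/

/-- The element `o` will be the tuple of empty sets, which a covering scheme requires to be the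
digit `0`. -/
theorem exists_encoding {X : Type*} [Fintype X] (o : X) : ∃ (dec : ℕ → X) (enc : X → ℕ),
    (∀ x, dec (enc x) = x) ∧ (∀ x, enc x < Fintype.card X) ∧ enc o = 0 := by
  classical
  let e₀ := Fintype.equivFin X
  have hc : 0 < Fintype.card X := Fintype.card_pos_iff.2 ⟨o⟩
  let e := e₀.trans (Equiv.swap (e₀ o) ⟨0, hc⟩)
  refine ⟨fun d => if h : d < Fintype.card X then e.symm ⟨d, h⟩ else o, fun x => e x,
    fun x => by simp, fun x => (e x).2, ?_⟩
  simp [e]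

/-- A colouring of a part of `V` with three colours, none of which is used more than `k` times, can
be extended to a colouring of `V` that uses each colour `k` times. -/
theorem exists_equitable_extension {V : Type*} [Fintype V] [DecidableEq V] {k : ℕ}
    (hV : Fintype.card V = 3 * k) (L : Finset V) (f : V → ℕ) (hf : ∀ q ∈ L, f q < 3)
    (hk : ∀ a < 3, (L.filter fun q => f q = a).card ≤ k) :
    ∃ f' : V → ℕ, (∀ q ∈ L, f' q = f q) ∧ (∀ q, f' q < 3) ∧
      ∀ a < 3, (Finset.univ.filter fun q => f' q = a).card = k := by
  have hL : (L.filter fun q => f q = 0).card + (L.filter fun q => f q = 1).card +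
      (L.filter fun q => f q = 2).card = L.card := by
    have := Finset.card_eq_sum_card_fiberwise (f := f) (s := L) (t := Finset.range 3)
      (fun q hq => by simpa using hf q hq)
    rw [this]
    simp [Finset.sum_range_succ]
  have h0 := hk 0 (by norm_num)
  have h1 := hk 1 (by norm_num)
  have h2 := hk 2 (by norm_num)
  have hLc : Lᶜ.card + L.card = 3 * k := by rw [Finset.card_compl_add_card, hV]
  obtain ⟨D₀, hD₀, c₀⟩ := Finset.exists_subset_card_eq
    (show k - (L.filter fun q => f q = 0).card ≤ Lᶜ.card by omega)
  have hLD : (Lᶜ \ D₀).card = Lᶜ.card - D₀.card := Finset.card_sdiff_of_subset hD₀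
  obtain ⟨D₁, hD₁, c₁⟩ := Finset.exists_subset_card_eq
    (show k - (L.filter fun q => f q = 1).card ≤ (Lᶜ \ D₀).card by omega)
  have hLD' : ((Lᶜ \ D₀) \ D₁).card = (Lᶜ \ D₀).card - D₁.card := Finset.card_sdiff_of_subset hD₁
  let f' : V → ℕ := fun q => if q ∈ L then f q else if q ∈ D₀ then 0 else if q ∈ D₁ then 1 else 2
  have hmem : ∀ q ∈ D₀, q ∉ L := fun q hq => by simpa using hD₀ hq
  have hmem' : ∀ q ∈ D₁, q ∉ L ∧ q ∉ D₀ := fun q hq => by simpa using hD₁ hq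
  refine ⟨f', fun q hq => if_pos hq, fun q => ?_, fun a ha => ?_⟩
  · simp only [f']
    split_ifs with h
    · exact hf q h
    all_goals norm_num
  have hsplit : ∀ a, ∀ D : Finset V, Disjoint (L.filter fun q => f q = a) D →
      (∀ q, f' q = a ↔ (q ∈ L ∧ f q = a) ∨ q ∈ D) →
      (Finset.univ.filter fun q => f' q = a).card =
        (L.filter fun q => f q = a).card + D.card := by
    intro a D hd h
    rw [← Finset.card_union_of_disjoint hd]
    congr 1
    ext q
    simp [h]
  have hdis : ∀ a, ∀ D : Finset V, (∀ q ∈ D, q ∉ L) → Disjoint (L.filter fun q => f q = a) D := by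
    intro a D h
    rw [Finset.disjoint_left]
    exact fun q hq hD => h q hD (Finset.mem_filter.1 hq).1
  interval_cases a
  · rw [hsplit 0 D₀ (hdis _ _ hmem)]
    · omega
    · intro q
      by_cases hq : q ∈ L
      · have : q ∉ D₀ := fun h => hmem q h hq
        simp [f', hq, this]
      · simp only [f', hq, if_false, false_and, false_or]
        split_ifs <;> simp_all
  · rw [hsplit 1 D₁ (hdis _ _ fun q hq => (hmem' q hq).1)]
    · omega
    · intro q
      by_cases hq : q ∈ L
      · have : q ∉ D₁ := fun h => (hmem' q h).1 hq
        simp [f', hq, this]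
      · by_cases hq₀ : q ∈ D₀
        · have : q ∉ D₁ := fun h => (hmem' q h).2 hq₀
          simp [f', hq, hq₀, this]
        · simp [f', hq, hq₀]
  · rw [hsplit 2 ((Lᶜ \ D₀) \ D₁) (hdis _ _ fun q hq => by simp at hq; tauto)]
    · omega
    · intro q
      by_cases hq : q ∈ L
      · simp [f', hq]
      · by_cases hq₀ : q ∈ D₀
        · simp [f', hq, hq₀]
        · by_cases hq₁ : q ∈ D₁ <;> simp [f', hq, hq₀, hq₁]

/-- The sets of at most `k` elements of a set of `3 k` elements. -/
abbrev SmallSet (k : ℕ) := {S : Finset (Fin (3 * k)) // S.card ≤ k}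

/-- Give the set `S` the weight `2 ^ (-|S|)`. The total weight of all sets is `(3/2)^(3k)`, and
every small set has weight at least `2 ^ (-k)`. -/
theorem card_smallSet_le (k : ℕ) : (Fintype.card (SmallSet k) : ℝ) ≤ (27 / 4) ^ k := by
  have h := Fintype.sum_pow_mul_eq_add_pow (Fin (3 * k)) (1 / 2 : ℝ) 1
  simp only [one_pow, mul_one, Fintype.card_fin] at h
  have h1 : (Fintype.card (SmallSet k) : ℝ) * (1 / 2) ^ k ≤ (1 / 2 + 1) ^ (3 * k) := by
    rw [← h, Fintype.card_subtype, ← nsmul_eq_mul, ← Finset.sum_const]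
    refine (Finset.sum_le_sum fun S hS => ?_).trans (Finset.sum_le_sum_of_subset_of_nonneg
      (Finset.filter_subset _ _) fun S _ _ => by positivity)
    exact pow_le_pow_of_le_one (by norm_num) (by norm_num) (Finset.mem_filter.1 hS).2
  rw [pow_mul] at h1
  have h2 := mul_le_mul_of_nonneg_right h1 (show (0 : ℝ) ≤ 2 ^ k by positivity)
  rw [mul_assoc, ← mul_pow, ← mul_pow] at h2
  norm_num at h2
  exact h2

/-! ### Digits as tuples of small sets -/

namespace TripartitionScheme

variable {k n : ℕ}

/-- The element number `e` of a block of `m * n` elements belongs to the set of a digit, of which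
only the first `m` elements of each part count. -/
def Has (m : ℕ) (x : Fin n → SmallSet k) (e : ℕ) : Prop :=
  ∃ (v : Fin n) (q : Fin (3 * k)), (q : ℕ) < m ∧ e = m * v + q ∧ q ∈ (x v).1

/-- Removal of the elements of the set with the code `c`. -/
def remove (m : ℕ) (x : Fin n → SmallSet k) (c : ℕ) : Fin n → SmallSet k := fun v =>
  ⟨(x v).1.filter fun q => (q : ℕ) < m ∧ c.testBit (m * v + q) = false,
    (Finset.card_filter_le _ _).trans (x v).2⟩

theorem has_remove (m : ℕ) (x : Fin n → SmallSet k) (c e : ℕ) :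
    Has m (remove m x c) e ↔ Has m x e ∧ c.testBit e = false := by
  constructor
  · rintro ⟨v, q, hq, rfl, h⟩
    have h' := Finset.mem_filter.1 h
    exact ⟨⟨v, q, hq, rfl, h'.1⟩, h'.2.2⟩
  · rintro ⟨⟨v, q, hq, rfl, h⟩, h'⟩
    exact ⟨v, q, hq, rfl, Finset.mem_filter.2 ⟨h, hq, h'⟩⟩

theorem lt_mul {m v q : ℕ} (hv : v < n) (hq : q < m) : m * v + q < m * n :=
  calc m * v + q < m * (v + 1) := by rw [mul_add]; omega
    _ ≤ m * n := Nat.mul_le_mul_left _ hv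

/-- `remove` also drops the dummy elements `q ≥ m`, which `Has` does not see; without this, a tuple
with nothing left could differ from the tuple of empty sets. -/
theorem remove_eq (m : ℕ) (x : Fin n → SmallSet k) (c : ℕ)
    (h : ∀ e < m * n, Has m x e → c.testBit e = true) :
    remove m x c = fun _ => ⟨∅, by simp⟩ := by
  funext v
  refine Subtype.ext (Finset.filter_eq_empty_iff.2 ?_)
  rintro q hq ⟨hqm, hc⟩
  have := h _ (lt_mul v.2 hqm) ⟨v, q, hqm, rfl, hq⟩
  rw [hc] at this
  exact absurd this (by simp)

/-- A column of the matrix of a digit. -/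
noncomputable def column {F : Type*} [Field F] {R : ℕ}
    (A : Fin R → (Fin n → {S : Finset (Fin (3 * k)) // S.card = k}) → F) (l : ℕ)
    (x : Fin n → SmallSet k) : F :=
  if h : l < R ∧ ∀ v, (x v).1.card = k then A ⟨l, h.1⟩ fun v => ⟨(x v).1, h.2 v⟩ else 0

/-- Columns are zero unless all sets of the tuple have exactly `k` elements. Thus the matrices
represent the extension by zero of the tensor power to tuples of small sets. Smaller sets occur in
the dynamic program only. -/
theorem sum_column {F : Type*} [Field F] {R : ℕ}
    (A B C : Fin R → (Fin n → {S : Finset (Fin (3 * k)) // S.card = k}) → F)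
    (h : ∀ x y z, kroneckerPow (tripartitionTensor F k) n x y z =
      ∑ l, A l x * B l y * C l z) (x y z : Fin n → SmallSet k) :
    ∑ l ∈ Finset.range R, column A l x * column B l y * column C l z ≠ 0 ↔
      (∀ v, (x v).1.card = k) ∧ (∀ v, (y v).1.card = k) ∧ (∀ v, (z v).1.card = k) ∧
        ∀ v, (x v).1 ∪ (y v).1 ∪ (z v).1 = Finset.univ := by
  by_cases hx : ∀ v, (x v).1.card = k
  swap
  · simp [column, hx]
  by_cases hy : ∀ v, (y v).1.card = k
  swap
  · simp [column, hy]
  by_cases hz : ∀ v, (z v).1.card = k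
  swap
  · simp [column, hz]
  have e : ∑ l ∈ Finset.range R, column A l x * column B l y * column C l z =
      kroneckerPow (tripartitionTensor F k) n (fun v => ⟨(x v).1, hx v⟩)
        (fun v => ⟨(y v).1, hy v⟩) fun v => ⟨(z v).1, hz v⟩ := by
    rw [h, Finset.sum_range]
    exact Finset.sum_congr rfl fun l _ => by simp [column, hx, hy, hz]
  rw [e]
  simp [kroneckerPow, tripartitionTensor, Finset.prod_ne_zero_iff, hx, hy, hz]

/-- The balanced colouring puts at most `k` of the genuine elements of every part into each colour
class. The dummy elements are then coloured so that all classes have exactly `k` elements, which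
makes the coefficient of the tensor nonzero. -/
theorem exists_digits {g s : ℕ} (hg : 2 * s = g) (hk : g < k) {α : Type} [DecidableEq α] (r : ℕ)
    (piece : ℕ → α) (hp : ∀ i, ((Finset.range (3 * (k - g) * n * r)).filter
      fun e => piece e = i).card ≤ s) :
    ∃ χ : α → ℕ, (∀ i, χ i < 3) ∧ ∀ u < r, ∃ x : ℕ → Fin n → SmallSet k,
      (∀ a < 3, ∀ e < 3 * (k - g) * n, (Has (3 * (k - g)) (x a) e ↔
        χ (piece (3 * (k - g) * n * u + e)) = a)) ∧
      (∀ a < 3, ∀ v, (x a v).1.card = k) ∧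
      ∀ v, (x 0 v).1 ∪ (x 1 v).1 ∪ (x 2 v).1 = Finset.univ := by
  classical
  set m := 3 * (k - g) with hm
  rw [mul_assoc] at hp
  obtain ⟨χ, hχ, hb⟩ := BeckFiala.exists_balanced_coloring m (n * r) s piece hp
  refine ⟨χ, hχ, fun u hu => ?_⟩
  have hext : ∀ v : Fin n, ∃ f : Fin (3 * k) → ℕ,
      (∀ q : Fin (3 * k), (q : ℕ) < m → f q = χ (piece (m * n * u + (m * v + q)))) ∧
      (∀ q, f q < 3) ∧ ∀ a < 3, (Finset.univ.filter fun q => f q = a).card = k := by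
    intro v
    -- Part `v` of block `u` is part `n * u + v` of the whole. The bound is `3 * (k - g) + 6 * s`,
    -- which is `3 * k` for `g = 2 * s`.
    have hv := hb (n * u + v) (lt_mul hu v.2)
    have hle : ∀ a < 3, (Finset.filter (fun q : Fin (3 * k) =>
        χ (piece (m * n * u + (m * v + q))) = a)
          (Finset.univ.filter fun q => (q : ℕ) < m)).card ≤ k := by
      intro a ha
      have h1 := hv a ha
      have h2 : (Finset.filter (fun q : Fin (3 * k) => χ (piece (m * n * u + (m * v + q))) = a)
          (Finset.univ.filter fun q => (q : ℕ) < m)).card ≤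
          ((Finset.range m).filter fun q => χ (piece (m * (n * u + v) + q)) = a).card := by
        refine Finset.card_le_card_of_injOn (fun q => (q : ℕ)) ?_ Fin.val_injective.injOn
        intro q hq
        simp only [Finset.coe_filter, Finset.mem_filter, Finset.mem_univ, true_and,
          Set.mem_ofPred_eq, Finset.mem_range] at hq ⊢
        refine ⟨hq.1, ?_⟩
        rw [← hq.2]
        congr 2
        ring
      omega
    obtain ⟨f, hf, hf3, hfk⟩ := exists_equitable_extension (V := Fin (3 * k)) (k := k) (by simp)
      (Finset.univ.filter fun q => (q : ℕ) < m) (fun q => χ (piece (m * n * u + (m * v + q))))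
      (fun q _ => hχ _) hle
    exact ⟨f, fun q hq => hf q (by simpa using hq), hf3, hfk⟩
  choose f hf hf3 hfk using hext
  refine ⟨fun a v => if h : (Finset.univ.filter fun q => f v q = a).card ≤ k then
    ⟨Finset.univ.filter fun q => f v q = a, h⟩ else ⟨∅, by simp⟩, ?_, ?_, ?_⟩
  · intro a ha e he
    simp only [Has]
    constructor
    · rintro ⟨v, q, hq, rfl, h⟩
      rw [dif_pos (hfk v a ha).le] at h
      rw [← hf v q hq]
      simpa using h
    · intro h
      have hm0 : 0 < m := by omega
      have hv : e / m < n := Nat.div_lt_of_lt_mul he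
      have hq : e % m < m := Nat.mod_lt _ hm0
      refine ⟨⟨e / m, hv⟩, ⟨e % m, by omega⟩, hq, (Nat.div_add_mod e m).symm, ?_⟩
      rw [dif_pos (hfk _ a ha).le]
      simp only [Finset.mem_filter, Finset.mem_univ, true_and]
      rw [hf _ _ hq, ← h]
      simp only [Nat.div_add_mod]
  · intro a ha v
    simp only
    rw [dif_pos (hfk v a ha).le]
    exact hfk v a ha
  · intro v
    simp only
    rw [dif_pos (hfk v 0 (by norm_num)).le, dif_pos (hfk v 1 (by norm_num)).le,
      dif_pos (hfk v 2 (by norm_num)).le]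
    ext q
    have := hf3 v q
    simp only [Finset.mem_union, Finset.mem_filter, Finset.mem_univ, true_and, iff_true]
    omega

/-- A decomposition of the `n`-th power of the tripartition tensor over a prime field gives a
covering scheme. -/
theorem exists_coverScheme {p s ρ : ℕ} [Fact p.Prime] (hk : 2 * s < k) (hn : 0 < n)
    (h : IsSumOfRankOne (kroneckerPow (tripartitionTensor (ZMod p) k) n) ρ) :
    ∃ D : CoverScheme s, D.m = 3 * (k - 2 * s) * n ∧
      D.R = max ρ (Fintype.card (SmallSet k) ^ n) := by
  classical
  set m := 3 * (k - 2 * s) with hm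
  have hcard : Fintype.card (Fin n → SmallSet k) = Fintype.card (SmallSet k) ^ n := by simp
  -- The rows of the matrices are the rank-one terms and the columns are the digits; the maximum
  -- makes the matrices square.
  set R := max ρ (Fintype.card (SmallSet k) ^ n) with hR
  obtain ⟨A, B, C, hABC⟩ := h.mono (le_max_left ρ (Fintype.card (SmallSet k) ^ n))
  obtain ⟨dec, enc, hdec, henc, ho⟩ :=
    exists_encoding (X := Fin n → SmallSet k) fun _ => ⟨∅, by simp⟩
  have hlt : ∀ x, enc x < R := fun x =>
    (henc x).trans_le (hcard.le.trans (le_max_right _ _))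
  have hdec0 := hdec fun _ => ⟨∅, by simp⟩
  rw [ho] at hdec0
  have hm0 : 0 < m := by omega
  refine ⟨{
    m := m * n
    R := R
    p := p
    m_pos := Nat.mul_pos hm0 hn
    R_pos := (Nat.zero_le _).trans_lt (hlt (dec 0))
    prime := Fact.out
    has := fun d e => Has m (dec d) e
    sub := fun d c => enc (remove m (dec d) c)
    sub_lt := fun d c => hlt _
    not_has_zero := ?_
    has_sub := ?_
    sub_eq_zero := ?_
    mat := fun a l d => column (if a = 0 then A else if a = 1 then B else C) l (dec d)
    sound := ?_
    complete := ?_ }, rfl, rfl⟩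
  · rintro e ⟨v, q, -, -, hq⟩
    rw [hdec0] at hq
    simp at hq
  · intro d _ c e _
    rw [hdec, has_remove]
  · intro d _ c hc
    rw [remove_eq m _ c hc, ho]
  · intro d _ hne e he
    obtain ⟨-, -, -, hu⟩ := (sum_column A B C hABC _ _ _).1 hne
    have hq : e % m < m := Nat.mod_lt _ hm0
    have hv : e / m < n := Nat.div_lt_of_lt_mul he
    have hmem : (⟨e % m, by omega⟩ : Fin (3 * k)) ∈ (Finset.univ : Finset (Fin (3 * k))) :=
      Finset.mem_univ _
    rw [← hu ⟨e / m, hv⟩, Finset.mem_union, Finset.mem_union] at hmem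
    have key : ∀ a, (⟨e % m, by omega⟩ : Fin (3 * k)) ∈ (dec (d a) ⟨e / m, hv⟩).1 →
        Has m (dec (d a)) e := fun a ha =>
      ⟨_, _, hq, (Nat.div_add_mod e m).symm, ha⟩
    rcases hmem with (h | h) | h
    · exact ⟨0, by norm_num, key 0 h⟩
    · exact ⟨1, by norm_num, key 1 h⟩
    · exact ⟨2, by norm_num, key 2 h⟩
  · intro r α _ piece hp
    obtain ⟨χ, hχ, hd⟩ := exists_digits rfl hk r piece hp
    refine ⟨χ, hχ, fun u hu => ?_⟩
    obtain ⟨x, hx, hxk, hxu⟩ := hd u hu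
    refine ⟨fun a => enc (x a), fun a _ => hlt _, fun a ha e he => ?_, ?_⟩
    · rw [hdec]; exact hx a ha e he
    · refine (sum_column A B C hABC _ _ _).2 ?_
      rw [hdec, hdec, hdec]
      exact ⟨hxk 0 (by norm_num), hxk 1 (by norm_num), hxk 2 (by norm_num), hxu⟩

end TripartitionScheme

/-! ### Choice of parameters, and the main result -/

theorem exists_tensorRank_lt {F ι : Type*} [Field F] [Fintype ι] (T : Tensor F ι) {β : ℝ}
    (h : asymptoticRank T < β) : ∃ r, 0 < r ∧ (tensorRank (kroneckerPow T r) : ℝ) < β ^ r := by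
  obtain ⟨r, hr, hr0⟩ := (((tendsto_asymptoticRank T).eventually_lt_const h).and
    (eventually_ge_atTop 1)).exists
  refine ⟨r, hr0, ?_⟩
  have h0 : (0 : ℝ) ≤ tensorRank (kroneckerPow T r) := Nat.cast_nonneg _
  have h1 := pow_lt_pow_left₀ hr (Real.rpow_nonneg h0 _) (n := r) (by omega)
  rwa [one_div, Real.rpow_inv_natCast_pow h0 (by omega)] at h1

theorem exists_coverScheme_of_asymptoticRank_lt {F : Type*} [Field F] {k s : ℕ} {ν : ℝ}
    (hk : 2 * s < k) (hν : 27 / 4 ≤ ν)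
    (h : asymptoticRank (tripartitionTensor F k) < ν ^ k) :
    ∃ (D : CoverScheme s) (n : ℕ), D.m = 3 * (k - 2 * s) * n ∧ (D.R : ℝ) ≤ ν ^ (k * n) := by
  have hν0 : 0 < ν := by linarith
  obtain ⟨r, hr, hrank⟩ := exists_tensorRank_lt _ h
  obtain ⟨p, hp, d, hd⟩ := exists_prime_isSumOfRankOne F le_rfl (k := k) (r₀ := r)
  set ρ := tensorRank (kroneckerPow (tripartitionTensor F k) r)
  -- Because the inequality is strict, a high power of this quotient outweighs the factor `d` lost
  -- in the passage to the prime field.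
  have hq : (ρ : ℝ) / (ν ^ k) ^ r < 1 := (div_lt_one (by positivity)).2 hrank
  have hlim := (tendsto_pow_atTop_nhds_zero_of_lt_one (by positivity) hq).mul_const (d : ℝ)
  rw [zero_mul] at hlim
  obtain ⟨n, hn, hn0⟩ := ((hlim.eventually_lt_const one_pos).and (eventually_ge_atTop 1)).exists
  obtain ⟨D, hm, hR⟩ := TripartitionScheme.exists_coverScheme hk
    (Nat.mul_pos hr hn0) (hd n)
  refine ⟨D, r * n, hm, ?_⟩
  rw [hR, Nat.cast_max]
  refine max_le ?_ ?_
  · rw [div_pow, div_mul_eq_mul_div, div_lt_one (by positivity)] at hn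
    push_cast
    refine hn.le.trans (le_of_eq ?_)
    simp only [← pow_mul, mul_assoc]
  · rw [Nat.cast_pow, pow_mul ν k (r * n)]
    refine pow_le_pow_left₀ (Nat.cast_nonneg _) ((card_smallSet_le k).trans ?_) _
    exact pow_le_pow_left₀ (by norm_num) hν k

theorem pow_lt_asymptoticRank_tripartitionTensor (F : Type*) [Field F] (hSCC : SetCoverConjecture)
    {ε : ℝ} (hε : 0 < ε) (hε8 : ε ≤ 8) : ∃ k₀ : ℕ, ∀ k : ℕ, k₀ ≤ k →
      (8 - ε) ^ k < asymptoticRank (tripartitionTensor F k) := by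
  by_contra hcon
  push Not at hcon
  -- The base `ν` has to be below `8` to gain over brute force, above `8 - ε`, and at least `27/4`
  -- to leave room for the number of small sets.
  set ν : ℝ := max (8 - ε / 2) 7 with hν
  have hν7 : 7 ≤ ν := le_max_right _ _
  have hν8 : ν < 8 := max_lt (by linarith) (by norm_num)
  have hνε : 8 - ε < ν := lt_of_lt_of_le (by linarith) (le_max_left _ _)
  have hν0 : 0 < ν := by linarith
  set c : ℝ := Real.logb 2 ν with hc
  have hc3 : c < 3 := by
    rw [hc, Real.logb_lt_iff_lt_rpow (by norm_num) hν0]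
    norm_num
    exact hν8
  have hc0 : 0 ≤ c := Real.logb_nonneg (by norm_num) (by linarith)
  have hνc : ν = 2 ^ c := (Real.rpow_logb (by norm_num) (by norm_num) hν0).symm
  -- A block costs `2 ^ (c * k * n)` instead of `2 ^ (3 * k * n)`, a relative gain of `(3 - c) / 3`
  -- in the exponent. Half of it becomes `δ`, the other half pays for the dummy elements. As `δ` is
  -- fixed before `s`, the conjecture can be applied.
  set δ : ℝ := (3 - c) / 6 with hδ
  obtain ⟨s, hs⟩ := hSCC (δ / 2) (by linarith)
  -- For such `k` the `6 * (s + 1) * n` dummy elements of a block cost at most half of the gain `(3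
  -- - c) * k * n`.
  obtain ⟨k₁, hk₁⟩ := exists_nat_ge (12 * ((s + 1 : ℕ) : ℝ) / (3 - c))
  obtain ⟨k, hk, hAR⟩ := hcon (max k₁ (2 * (s + 1) + 1))
  have hks : 2 * (s + 1) < k := lt_of_lt_of_le (Nat.lt_succ_self _) ((le_max_right _ _).trans hk)
  have hkc : 12 * ((s + 1 : ℕ) : ℝ) ≤ (3 - c) * k := by
    rw [div_le_iff₀' (by linarith)] at hk₁
    have : (k₁ : ℝ) ≤ k := by exact_mod_cast (le_max_left _ _).trans hk
    nlinarith
  obtain ⟨D, n, hm, hR⟩ := exists_coverScheme_of_asymptoticRank_lt hks (by linarith)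
    (hAR.trans_lt (pow_lt_pow_left₀ hνε (by linarith) (by omega : k ≠ 0)))
  refine hs (D.exists_solvesSetCover (δ := δ) (by linarith) (by linarith) (hR.trans ?_))
  rw [hm, hνc, ← Real.rpow_mul_natCast (by norm_num)]
  refine Real.rpow_le_rpow_of_exponent_le (by norm_num) ?_
  have h1 : ((k - 2 * (s + 1) : ℕ) : ℝ) = k - 2 * ((s + 1 : ℕ) : ℝ) := by
    rw [Nat.cast_sub hks.le, Nat.cast_mul, Nat.cast_two]
  rw [Nat.cast_mul, Nat.cast_mul, Nat.cast_mul, h1, ← mul_assoc, ← mul_assoc]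
  refine mul_le_mul_of_nonneg_right ?_ (Nat.cast_nonneg n)
  rw [hδ]
  have hs0 : (0 : ℝ) ≤ ((s + 1 : ℕ) : ℝ) := Nat.cast_nonneg _
  push_cast at hkc hs0 ⊢
  nlinarith [mul_nonneg hs0 (by linarith : (0 : ℝ) ≤ 3 - c)]

theorem choose_le_pow (k : ℕ) : ((Nat.choose (3 * k) k : ℕ) : ℝ) ≤ (27 / 4) ^ k := by
  refine le_trans ?_ (card_smallSet_le k)
  have h : Fintype.card {S : Finset (Fin (3 * k)) // S.card = k} = Nat.choose (3 * k) k := by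
    rw [Fintype.card_finset_len, Fintype.card_fin]
  rw [← h]
  exact_mod_cast Fintype.card_subtype_mono (fun S : Finset (Fin (3 * k)) => S.card = k)
    (fun S => S.card ≤ k) fun _ hS => le_of_eq hS

theorem corollary3 (F : Type*) [Field F] (hSCC : SetCoverConjecture) :
    (∀ ε : ℝ, 0 < ε → ε ≤ 8 → ∃ k₀ : ℕ, ∀ k : ℕ, k₀ ≤ k →
      (8 - ε) ^ k < asymptoticRank (tripartitionTensor F k)) ∧
    (∃ k₀ : ℕ, ∀ k : ℕ, k₀ ≤ k →
      ((Nat.choose (3 * k) k : ℕ) : ℝ) ^ (1.08 : ℝ) <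
        asymptoticRank (tripartitionTensor F k)) := by
  refine ⟨fun ε hε hε8 => pow_lt_asymptoticRank_tripartitionTensor F hSCC hε hε8, ?_⟩
  obtain ⟨k₀, h⟩ := pow_lt_asymptoticRank_tripartitionTensor F hSCC
    (show (0 : ℝ) < 1 / 10 by norm_num) (by norm_num)
  refine ⟨k₀, fun k hk => lt_of_le_of_lt ?_ (h k hk)⟩
  -- Since `1.08 = 27/25`, this amounts to `(27/4)^27 ≤ 7.9^25`.
  have h1 : ((27 / 4 : ℝ)) ^ (1.08 : ℝ) ≤ 8 - 1 / 10 := by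
    have h2 : (1.08 : ℝ) = 27 * (25 : ℝ)⁻¹ := by norm_num
    rw [h2, Real.rpow_mul (by norm_num), Real.rpow_inv_le_iff_of_pos (by positivity)
      (by norm_num) (by norm_num)]
    norm_num
  calc ((Nat.choose (3 * k) k : ℕ) : ℝ) ^ (1.08 : ℝ) ≤ ((27 / 4 : ℝ) ^ k) ^ (1.08 : ℝ) :=
        Real.rpow_le_rpow (Nat.cast_nonneg _) (choose_le_pow k) (by norm_num)
    _ = ((27 / 4 : ℝ) ^ (1.08 : ℝ)) ^ k := by
        rw [← Real.rpow_natCast_mul (by norm_num), mul_comm, Real.rpow_mul_natCast (by norm_num)]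
    _ ≤ _ := pow_le_pow_left₀ (by positivity) h1 k
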